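/- Let $n\ge 4$ and let $(M,g)$ be a smooth $n$-dimensional Lorentzian manifold of signature $(-,+,\dots,+)$ that is vacuum ($R_{ab}=0$) and whose Weyl tensor does not vanish identically on any nonempty open set. For a smooth vector field $k^a$ on $M$ the following are equivalent. (a) $k^a$ is nowhere zero and null, and it is a Kerr-Schild congruence with zero expansion: around every point there are coordinates in which $$g_{ab}=\eta_{ab}-2\mathcal H\,k_ak_b,\qquad \eta_{ab}=\mathrm{diag}(-1,1,\dots,1),\qquad \eta^{ab}k_ak_b=0,\qquad k^a=\eta^{ab}k_b,$$ with a smooth function $\mathcal H$, and $\theta=\frac1{n-2}L_{ii}=0$ at every point for some adapted frame there, where $L_{ij}=k_{a;b}m^{(i)a}m^{(j)b}$ and $m^{(1)},\dots,m^{(n-2)}$ are orthonormal spacelike vectors orthogonal to $k^a$. ($\theta$ is independent of the frame wherever $k^a$ is geodetic; that $k^a$ is geodetic is not assumed.) (b) $k^a$ is a Kundt congruence (nowhere zero, null and geodetic, with vanishing expansion, shear and twist) and the Weyl tensor is of type N wherever it is nonzero, that is, at every such point there is a null frame $(\ell,n,m^{(i)})$ in which all its components of boost weight greater than $-2$ vanish.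 In particular, $(M,g)$ admits a non-expanding Kerr-Schild congruence if and only if it is a Kundt spacetime (it admits a Kundt congruence) and its Weyl tensor is of type N wherever it is nonzero. (If the Weyl tensor vanishes nowhere, this is type N at every point.) -/

import Mathlib

open scoped Manifold ContDiff Matrix

noncomputable section

/-! ### Tensor calculus in a coordinate domain of `ℝⁿ`

`G x` is the matrix `g_{ab}(x)` of a metric and `K x` the vector `k^a(x)`. Everything below is only
used on open sets on which `G` and `K` are smooth and `G` is invertible. -/

namespace Coordinates

variable {n : ℕ}

/-- The matrix `diag(-1, 1, …, 1)`. -/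
def minkowski (n : ℕ) : Matrix (Fin n) (Fin n) ℝ :=
  Matrix.diagonal fun a => if a.val = 0 then -1 else 1

/-- The partial derivative `∂_a f` at `x`. -/
def pderiv (a : Fin n) (f : (Fin n → ℝ) → ℝ) (x : Fin n → ℝ) : ℝ :=
  fderiv ℝ f x (Pi.single a 1)

/-- The Christoffel symbols `Γ^a_{bc}`. -/
def christoffel (G : (Fin n → ℝ) → Matrix (Fin n) (Fin n) ℝ) (a b c : Fin n)
    (x : Fin n → ℝ) : ℝ :=
  (1 / 2) * ∑ d, (G x)⁻¹ a d *
    (pderiv b (fun y => G y d c) x + pderiv c (fun y => G y d b) x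
      - pderiv d (fun y => G y b c) x)

/-- The curvature tensor `R^a_{bcd}`. -/
def riemannUp (G : (Fin n → ℝ) → Matrix (Fin n) (Fin n) ℝ) (a b c d : Fin n)
    (x : Fin n → ℝ) : ℝ :=
  pderiv c (christoffel G a b d) x - pderiv d (christoffel G a b c) x
    + ∑ e, (christoffel G a c e x * christoffel G e b d x
        - christoffel G a d e x * christoffel G e b c x)

/-- The curvature tensor `R_{abcd}`. -/
def riemann (G : (Fin n → ℝ) → Matrix (Fin n) (Fin n) ℝ) (a b c d : Fin n)
    (x : Fin n → ℝ) : ℝ :=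
  ∑ e, G x a e * riemannUp G e b c d x

/-- The Ricci tensor `R_{bd} = R^a_{bad}`. -/
def ricci (G : (Fin n → ℝ) → Matrix (Fin n) (Fin n) ℝ) (b d : Fin n) (x : Fin n → ℝ) : ℝ :=
  ∑ a, riemannUp G a b a d x

/-- The scalar curvature `g^{bd} R_{bd}`. -/
def scalarCurv (G : (Fin n → ℝ) → Matrix (Fin n) (Fin n) ℝ) (x : Fin n → ℝ) : ℝ :=
  ∑ b, ∑ d, (G x)⁻¹ b d * ricci G b d x

/-- The Weyl tensor `C_{abcd}` (for `n ≥ 3`). -/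
def weyl (G : (Fin n → ℝ) → Matrix (Fin n) (Fin n) ℝ) (a b c d : Fin n) (x : Fin n → ℝ) : ℝ :=
  riemann G a b c d x
    - 1 / ((n : ℝ) - 2) * (G x a c * ricci G b d x - G x a d * ricci G b c x
        - G x b c * ricci G a d x + G x b d * ricci G a c x)
    + scalarCurv G x / (((n : ℝ) - 1) * ((n : ℝ) - 2))
        * (G x a c * G x b d - G x a d * G x b c)

/-- The scalar product `g_{ab} u^a v^b` at `x`. -/
def ip (G : (Fin n → ℝ) → Matrix (Fin n) (Fin n) ℝ) (x u v : Fin n → ℝ) : ℝ :=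
  u ⬝ᵥ (G x *ᵥ v)

/-- The covariant derivative `∇_b k^a`. -/
def covDeriv (G : (Fin n → ℝ) → Matrix (Fin n) (Fin n) ℝ) (K : (Fin n → ℝ) → (Fin n → ℝ))
    (a b : Fin n) (x : Fin n → ℝ) : ℝ :=
  pderiv b (fun y => K y a) x + ∑ c, christoffel G a b c x * K x c

/-- The covariant derivative `k_{a;b}` of the corresponding 1-form. -/
def covDerivLow (G : (Fin n → ℝ) → Matrix (Fin n) (Fin n) ℝ)
    (K : (Fin n → ℝ) → (Fin n → ℝ)) (a b : Fin n) (x : Fin n → ℝ) : ℝ :=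
  ∑ c, G x a c * covDeriv G K c b x

/-- `k` is geodetic at `x`: `k^b ∇_b k^a` is a multiple of `k^a`. -/
def IsGeodeticAt (G : (Fin n → ℝ) → Matrix (Fin n) (Fin n) ℝ)
    (K : (Fin n → ℝ) → (Fin n → ℝ)) (x : Fin n → ℝ) : Prop :=
  ∃ c : ℝ, ∀ a, ∑ b, K x b * covDeriv G K a b x = c * K x a

/-- The spacelike vectors `m^{(i)}`, `i = 1, …, n - 2`, of a null frame adapted to `k` at `x`. -/
def IsScreen (G : (Fin n → ℝ) → Matrix (Fin n) (Fin n) ℝ) (K : (Fin n → ℝ) → (Fin n → ℝ))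
    (x : Fin n → ℝ) (m : Fin (n - 2) → (Fin n → ℝ)) : Prop :=
  (∀ i, ip G x (K x) (m i) = 0) ∧ ∀ i j, ip G x (m i) (m j) = if i = j then 1 else 0

/-- The optical matrix `L_{ij} = k_{a;b} m^{(i)a} m^{(j)b}`. -/
def optical (G : (Fin n → ℝ) → Matrix (Fin n) (Fin n) ℝ) (K : (Fin n → ℝ) → (Fin n → ℝ))
    (x : Fin n → ℝ) (m : Fin (n - 2) → (Fin n → ℝ)) (i j : Fin (n - 2)) : ℝ :=
  ∑ a, ∑ b, covDerivLow G K a b x * m i a * m j b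

/-- The expansion `θ = L_{ii} / (n - 2)`. -/
def expansion (G : (Fin n → ℝ) → Matrix (Fin n) (Fin n) ℝ) (K : (Fin n → ℝ) → (Fin n → ℝ))
    (x : Fin n → ℝ) (m : Fin (n - 2) → (Fin n → ℝ)) : ℝ :=
  (∑ i, optical G K x m i i) / ((n : ℝ) - 2)

/-- The shear `σ² = L_{(ij)} L_{(ij)} - (n - 2) θ²`. -/
def shearSq (G : (Fin n → ℝ) → Matrix (Fin n) (Fin n) ℝ) (K : (Fin n → ℝ) → (Fin n → ℝ))
    (x : Fin n → ℝ) (m : Fin (n - 2) → (Fin n → ℝ)) : ℝ :=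
  (∑ i, ∑ j, ((optical G K x m i j + optical G K x m j i) / 2) ^ 2)
    - ((n : ℝ) - 2) * expansion G K x m ^ 2

/-- The twist `ω² = L_{[ij]} L_{[ij]}`. -/
def twistSq (G : (Fin n → ℝ) → Matrix (Fin n) (Fin n) ℝ) (K : (Fin n → ℝ) → (Fin n → ℝ))
    (x : Fin n → ℝ) (m : Fin (n - 2) → (Fin n → ℝ)) : ℝ :=
  ∑ i, ∑ j, ((optical G K x m i j - optical G K x m j i) / 2) ^ 2

/-- Gram matrix of a null frame: `inl 0` is the index of `ℓ`, `inl 1` that of `n`, and `inr i`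
that of `m^{(i)}`; the products are `ℓ·n = 1`, `m^{(i)}·m^{(j)} = δ_{ij}`, all others `0`. -/
def nullGram {m : ℕ} : Fin 2 ⊕ Fin m → Fin 2 ⊕ Fin m → ℝ
  | .inl s, .inl t => if s = t then 0 else 1
  | .inr i, .inr j => if i = j then 1 else 0
  | _, _ => 0

/-- Boost weight of a frame vector: `+1` for `ℓ`, `-1` for `n`, `0` for `m^{(i)}`. -/
def boostWeight {m : ℕ} : Fin 2 ⊕ Fin m → ℤ
  | .inl s => if s = 0 then 1 else -1
  | .inr _ => 0

/-- `E` is a null frame `(ℓ, n, m^{(i)})` at `x`. -/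
def IsNullFrame (G : (Fin n → ℝ) → Matrix (Fin n) (Fin n) ℝ) (x : Fin n → ℝ)
    (E : Fin 2 ⊕ Fin (n - 2) → (Fin n → ℝ)) : Prop :=
  ∀ s t, ip G x (E s) (E t) = nullGram s t

/-- The frame component `C_{abcd} E_s^a E_t^b E_u^c E_v^d`. -/
def weylFrame (G : (Fin n → ℝ) → Matrix (Fin n) (Fin n) ℝ) (x : Fin n → ℝ)
    (E : Fin 2 ⊕ Fin (n - 2) → (Fin n → ℝ)) (s t u v : Fin 2 ⊕ Fin (n - 2)) : ℝ :=
  ∑ a, ∑ b, ∑ c, ∑ d, weyl G a b c d x * E s a * E t b * E u c * E v d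

/-- The Weyl tensor vanishes at `x` (type O). -/
def WeylVanishes (G : (Fin n → ℝ) → Matrix (Fin n) (Fin n) ℝ) (x : Fin n → ℝ) : Prop :=
  ∀ a b c d, weyl G a b c d x = 0

/-- The Weyl tensor is of type N at `x`: it is nonzero, and in some null frame all its components
of boost weight greater than `-2` vanish. -/
def WeylTypeN (G : (Fin n → ℝ) → Matrix (Fin n) (Fin n) ℝ) (x : Fin n → ℝ) : Prop :=
  ¬ WeylVanishes G x ∧ ∃ E, IsNullFrame G x E ∧
    ∀ s t u v, -2 < boostWeight s + boostWeight t + boostWeight u + boostWeight v →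
      weylFrame G x E s t u v = 0

end Coordinates

/-! ### Lorentzian manifolds -/

section Manifold

variable {n : ℕ} {M : Type*} [TopologicalSpace M] [ChartedSpace (Fin n → ℝ) M]

/-- Components `g(∂_a, ∂_b)` in the chart `e` of a field of bilinear forms on `M`. -/
def metricInChart
    (g : ∀ p : M, TangentSpace 𝓘(ℝ, Fin n → ℝ) p →ₗ[ℝ]
      TangentSpace 𝓘(ℝ, Fin n → ℝ) p →ₗ[ℝ] ℝ)
    (e : OpenPartialHomeomorph M (Fin n → ℝ)) (x : Fin n → ℝ) : Matrix (Fin n) (Fin n) ℝ :=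
  Matrix.of fun a b => g (e.symm x)
    (mfderiv 𝓘(ℝ, Fin n → ℝ) 𝓘(ℝ, Fin n → ℝ) e.symm x (Pi.single a (1 : ℝ) : Fin n → ℝ))
    (mfderiv 𝓘(ℝ, Fin n → ℝ) 𝓘(ℝ, Fin n → ℝ) e.symm x (Pi.single b (1 : ℝ) : Fin n → ℝ))

/-- Components `k^a` in the chart `e` of a vector field on `M`. -/
def vectorInChart (k : ∀ p : M, TangentSpace 𝓘(ℝ, Fin n → ℝ) p)
    (e : OpenPartialHomeomorph M (Fin n → ℝ)) (x : Fin n → ℝ) : Fin n → ℝ :=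
  (mfderiv 𝓘(ℝ, Fin n → ℝ) 𝓘(ℝ, Fin n → ℝ) e (e.symm x) (k (e.symm x)) :)

variable (n M) in
/-- A smooth metric of signature `(-, +, …, +)` on the smooth `n`-manifold `M`. -/
structure LorentzMetric where
  /-- The scalar product on each tangent space. -/
  val : ∀ p : M, TangentSpace 𝓘(ℝ, Fin n → ℝ) p →ₗ[ℝ]
    TangentSpace 𝓘(ℝ, Fin n → ℝ) p →ₗ[ℝ] ℝ
  symm : ∀ p u v, val p u v = val p v u
  signature : ∀ p : M, ∃ b : Module.Basis (Fin n) ℝ (TangentSpace 𝓘(ℝ, Fin n → ℝ) p),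
    ∀ i j, val p (b i) (b j) = Coordinates.minkowski n i j
  smooth : ∀ e ∈ IsManifold.maximalAtlas 𝓘(ℝ, Fin n → ℝ) ∞ M, ∀ a b,
    ContDiffOn ℝ ∞ (fun x => metricInChart val e x a b) e.target

namespace LorentzMetric

/-- The components `g_{ab}` in the chart `e`. -/
def inChart (g : LorentzMetric n M) (e : OpenPartialHomeomorph M (Fin n → ℝ)) :
    (Fin n → ℝ) → Matrix (Fin n) (Fin n) ℝ :=
  metricInChart g.val e

/-- The vacuum Einstein equations `R_{ab} = 0`. -/
def IsVacuum (g : LorentzMetric n M) : Prop :=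
  ∀ e ∈ IsManifold.maximalAtlas 𝓘(ℝ, Fin n → ℝ) ∞ M, ∀ x ∈ e.target, ∀ a b,
    Coordinates.ricci (g.inChart e) a b x = 0

/-- The Weyl tensor vanishes at the point `p`. -/
def WeylVanishesAt (g : LorentzMetric n M) (p : M) : Prop :=
  ∀ e ∈ IsManifold.maximalAtlas 𝓘(ℝ, Fin n → ℝ) ∞ M, p ∈ e.source →
    Coordinates.WeylVanishes (g.inChart e) (e p)

/-- The Weyl tensor is of type N (and, in particular, nonzero) at the point `p`. -/
def WeylTypeNAt (g : LorentzMetric n M) (p : M) : Prop :=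
  ∀ e ∈ IsManifold.maximalAtlas 𝓘(ℝ, Fin n → ℝ) ∞ M, p ∈ e.source →
    Coordinates.WeylTypeN (g.inChart e) (e p)

/-- The Weyl tensor is of type N at every point at which it does not vanish. -/
def IsWeylTypeN (g : LorentzMetric n M) : Prop :=
  ∀ p : M, ¬ g.WeylVanishesAt p → g.WeylTypeNAt p

/-- `k` is a smooth nowhere vanishing null vector field. -/
def IsNullCongruence (g : LorentzMetric n M)
    (k : ∀ p : M, TangentSpace 𝓘(ℝ, Fin n → ℝ) p) : Prop :=
  (∀ e ∈ IsManifold.maximalAtlas 𝓘(ℝ, Fin n → ℝ) ∞ M,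
      ContDiffOn ℝ ∞ (vectorInChart k e) e.target) ∧
    ∀ p, k p ≠ 0 ∧ g.val p (k p) (k p) = 0

/-- `k` has zero expansion: at every point `θ = 0` in some adapted frame. The expansion does not
depend on the frame if `k` is geodetic, which is not part of this definition. (If `k` is not
geodetic at a point, then `θ` takes every real value there as the frame varies.) -/
def IsNonexpanding (g : LorentzMetric n M)
    (k : ∀ p : M, TangentSpace 𝓘(ℝ, Fin n → ℝ) p) : Prop :=
  ∀ e ∈ IsManifold.maximalAtlas 𝓘(ℝ, Fin n → ℝ) ∞ M, ∀ x ∈ e.target,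
    ∃ m, Coordinates.IsScreen (g.inChart e) (vectorInChart k e) x m ∧
      Coordinates.expansion (g.inChart e) (vectorInChart k e) x m = 0

/-- `k` is a Kundt congruence: null and geodetic, with vanishing expansion, shear and twist. -/
def IsKundtCongruence (g : LorentzMetric n M)
    (k : ∀ p : M, TangentSpace 𝓘(ℝ, Fin n → ℝ) p) : Prop :=
  g.IsNullCongruence k ∧
    ∀ e ∈ IsManifold.maximalAtlas 𝓘(ℝ, Fin n → ℝ) ∞ M, ∀ x ∈ e.target,
      Coordinates.IsGeodeticAt (g.inChart e) (vectorInChart k e) x ∧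
      ∀ m, Coordinates.IsScreen (g.inChart e) (vectorInChart k e) x m →
        Coordinates.expansion (g.inChart e) (vectorInChart k e) x m = 0 ∧
        Coordinates.shearSq (g.inChart e) (vectorInChart k e) x m = 0 ∧
        Coordinates.twistSq (g.inChart e) (vectorInChart k e) x m = 0

/-- `g` is a Kerr-Schild metric with Kerr-Schild congruence `k`: around every point there are
coordinates with `g_{ab} = η_{ab} - 2 H k_a k_b`, where `η = diag(-1, 1, …, 1)`,
`η^{ab} k_a k_b = 0` and `k^a = η^{ab} k_b`. -/
def IsKerrSchildCongruence (g : LorentzMetric n M)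
    (k : ∀ p : M, TangentSpace 𝓘(ℝ, Fin n → ℝ) p) : Prop :=
  g.IsNullCongruence k ∧
    ∀ p : M, ∃ e ∈ IsManifold.maximalAtlas 𝓘(ℝ, Fin n → ℝ) ∞ M, p ∈ e.source ∧
      ∃ (H : (Fin n → ℝ) → ℝ) (κ : (Fin n → ℝ) → (Fin n → ℝ)),
        ContDiffOn ℝ ∞ H e.target ∧ ContDiffOn ℝ ∞ κ e.target ∧
        ∀ x ∈ e.target,
          κ x ⬝ᵥ ((Coordinates.minkowski n)⁻¹ *ᵥ κ x) = 0 ∧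
          vectorInChart k e x = (Coordinates.minkowski n)⁻¹ *ᵥ κ x ∧
          ∀ a b, g.inChart e x a b = Coordinates.minkowski n a b - 2 * H x * κ x a * κ x b

end LorentzMetric

end Manifold

end

/-! Both implications pass through one pointwise condition, `LeafFlatAt`: the curvature operator
R(u, v) vanishes for all u, v orthogonal to k.

From Kerr-Schild to Kundt. Rescale k to l with l⁰ = 1 and absorb the factor into H. The Levi-Civita
connection is then explicit (`connForm_eq`). Since l is null, Γ^a_{ab} = 0, and for X orthogonal to
l and to dl(l) the equation Ric(X, X) = 0 collapses to a divergence (`ricci_contraction`). The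
choice X = l gives H |dl(l)|² = 0, so l is geodetic where H ≠ 0; this need not be assumed. The
choice X = m_i, summed over i, gives H Σ |α_i|² = (l(H) + H div l) Σ L_ii with α_i = η(dl ·, m_i).
Zero expansion kills the right side and every |α_i|² is nonnegative, hence dl vanishes on the
orthogonal complement of l. Because the Weyl tensor is nonzero on a dense set, H ≠ 0 on a dense set,
and continuity extends the conclusion to every point (`fderiv_l_eq`). The Kundt property and leaf
flatness follow (`leafFlatAt_of_recurrent`), and leaf flatness together with Ricci flatness leaves
only components of boost weight -2 (`LeafFlatAt.weylFrame_eq_zero`).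

From Kundt and type N to Kerr-Schild. If k points along the null direction ℓ of the type N frame,
leaf flatness is immediate. Otherwise the Ricci identity for a Kundt congruence makes R(u, v)k
proportional to k on the complement of k, which forces the curvature to vanish at that point
(`leafFlatAt_of_typeN`). The hyperplanes orthogonal to k are integrable, and by the Frobenius
theorem they become lam = const in suitable coordinates. Leaf flatness allows a coframe θ that is
parallel along the leaves and along one transversal line, with a map Ξ satisfying dΞ = θ in these
directions (`exists_coframe`). This coframe is orthonormal (`gram`). In the remaining direction e,
the derivative of the error θ(e) - dΞ(e) along a leaf is driven by terms θ(R(e, v)u) with u and v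
tangent to the leaf; these are multiples of θ(k), whose direction is constant on each leaf. So the
error is a multiple of θ(k) (`transverse_eq`, `defect_eq`). Therefore the flat metric pulled back by
Ξ differs from g by a multiple of the square of the 1-form of k (`kerrSchild_form`), and the
components of Ξ are Kerr-Schild coordinates.

The Frobenius theorem itself is derived from the inverse function theorem on the Banach space of
continuous paths. -/

section

open scoped Manifold ContDiff Matrix Topology
open Set Metric Filter

noncomputable section

set_option maxSynthPendingDepth 3

/-! ### Linear differential equations and the Frobenius theorem -/

section Frobenius

/-- A solution of a homogeneous linear differential equation with zero initial value is zero. -/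
theorem eq_zero_of_linear_ode {F : Type*} [NormedAddCommGroup F] [NormedSpace ℝ F]
    {y : ℝ → F} {B : ℝ → F →L[ℝ] F} (hB : ContinuousOn B (Icc 0 1))
    (hy : ∀ s ∈ Icc (0 : ℝ) 1, HasDerivAt y (B s (y s)) s) (h0 : y 0 = 0) :
    ∀ s ∈ Icc (0 : ℝ) 1, y s = 0 := by
  obtain ⟨K, hK⟩ := isCompact_Icc.exists_bound_of_continuousOn hB
  refine eq_zero_of_abs_deriv_le_mul_abs_self_of_eq_zero_right (f' := fun s => B s (y s)) (K := K)
    (fun s hs => (hy s hs).continuousAt.continuousWithinAt)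
    (fun s hs => (hy s (Ico_subset_Icc_self hs)).hasDerivWithinAt) h0 fun s hs => ?_
  exact (B s).le_of_opNorm_le (hK s (Ico_subset_Icc_self hs)) _

/-- The inverse function theorem, with a smooth inverse on an open set. -/
theorem exists_smooth_localInverse {X Y : Type*} [NormedAddCommGroup X] [NormedSpace ℝ X]
    [NormedAddCommGroup Y] [NormedSpace ℝ Y] [CompleteSpace X]
    {S : X → Y} {O : Set X} (hO : IsOpen O) (hS : ContDiffOn ℝ ∞ S O) {x₀ : X} (hx₀ : x₀ ∈ O)
    {S' : X ≃L[ℝ] Y} (hS' : HasFDerivAt S (S' : X →L[ℝ] Y) x₀) :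
    ∃ h : OpenPartialHomeomorph X Y, (h : X → Y) = S ∧ x₀ ∈ h.source ∧ h.source ⊆ O ∧
      ContDiffOn ℝ ∞ h.symm h.target := by
  have hat : ∀ x ∈ O, ContDiffAt ℝ ∞ S x := fun x hx => hS.contDiffAt (hO.mem_nhds hx)
  have hne : (∞ : WithTop ℕ∞) ≠ 0 := by simp
  set h₀ := (hat x₀ hx₀).toOpenPartialHomeomorph S hS' hne with hh₀
  have hcont : ContinuousOn (fderiv ℝ S) O := hS.continuousOn_fderiv_of_isOpen hO (by simp)
  -- Invertibility of the derivative is an open condition; restricting to it makes the inverse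
  -- smooth at every point of the target and not only at the image of `x₀`.
  set O' := O ∩ fderiv ℝ S ⁻¹' (range ((↑) : (X ≃L[ℝ] Y) → X →L[ℝ] Y)) with hO'
  have hO'o : IsOpen O' := hcont.isOpen_inter_preimage hO (ContinuousLinearEquiv.isOpen)
  refine ⟨h₀.restrOpen O' hO'o, rfl, ⟨?_, hx₀, S', hS'.fderiv.symm⟩, fun x hx => hx.2.1, ?_⟩
  · exact (hat x₀ hx₀).mem_toOpenPartialHomeomorph_source hS' hne
  · intro y hy
    have hy' := (h₀.restrOpen O' hO'o).map_target hy
    obtain ⟨-, hyO, e, he⟩ := hy'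
    refine ((h₀.restrOpen O' hO'o).contDiffAt_symm hy (f₀' := e) ?_ (hat _ hyO)).contDiffWithinAt
    rw [he]
    exact ((hat _ hyO).differentiableAt hne).hasFDerivAt

/-! ### Smoothness of superposition operators on spaces of continuous functions -/

section Superposition

variable {K : Type*} [TopologicalSpace K] [CompactSpace K]

/-- Pointwise application of a continuous family of linear maps. -/
def pointwiseApply (K : Type*) [TopologicalSpace K] [CompactSpace K]
    (Z F : Type*) [NormedAddCommGroup Z] [NormedSpace ℝ Z] [NormedAddCommGroup F]
    [NormedSpace ℝ F] : C(K, Z →L[ℝ] F) →L[ℝ] C(K, Z) →L[ℝ] C(K, F) :=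
  LinearMap.mkContinuous₂
    (LinearMap.mk₂ ℝ (fun (B : C(K, Z →L[ℝ] F)) (h : C(K, Z)) =>
        (⟨fun s => B s (h s), by fun_prop⟩ : C(K, F)))
      (fun _ _ _ => by ext; simp) (fun _ _ _ => by ext; simp) (fun _ _ _ => by ext; simp)
      (fun _ _ _ => by ext; simp)) 1 (by
    intro B h
    rw [ContinuousMap.norm_le _ (by positivity)]
    intro s
    simp only [LinearMap.mk₂_apply, ContinuousMap.coe_mk, one_mul]
    exact (B s).le_of_opNorm_le_of_le (B.norm_coe_le_norm s) (h.norm_coe_le_norm s))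

@[simp] theorem pointwiseApply_apply {Z F : Type*} [NormedAddCommGroup Z] [NormedSpace ℝ Z]
    [NormedAddCommGroup F] [NormedSpace ℝ F] (B : C(K, Z →L[ℝ] F)) (h : C(K, Z)) (s : K) :
    pointwiseApply K Z F B h s = B s (h s) := rfl

/-- The mean value inequality on the segment from γ(s) to γ(s) + h(s) bounds the remainder at s. The
bound is uniform in s because γ ↦ f' ∘ γ is continuous for the supremum norm. -/
theorem hasFDerivAt_postcomp {Z F : Type*} [NormedAddCommGroup Z] [NormedSpace ℝ Z]
    [NormedAddCommGroup F] [NormedSpace ℝ F] {f : Z → F} (hf : ContDiff ℝ 1 f) (γ : C(K, Z)) :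
    HasFDerivAt (fun γ : C(K, Z) => (⟨f, hf.continuous⟩ : C(Z, F)).comp γ)
      (pointwiseApply K Z F
        ((⟨fderiv ℝ f, hf.continuous_fderiv one_ne_zero⟩ : C(Z, Z →L[ℝ] F)).comp γ)) γ := by
  set f' : C(Z, Z →L[ℝ] F) := ⟨fderiv ℝ f, hf.continuous_fderiv one_ne_zero⟩
  rw [hasFDerivAt_iff_isLittleO_nhds_zero, Asymptotics.isLittleO_iff]
  intro c hc
  have hcont : Continuous fun γ : C(K, Z) => f'.comp γ := f'.continuous_postcomp
  obtain ⟨δ, hδ, hδ'⟩ := (Metric.tendsto_nhds_nhds (α := C(K, Z))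
    (β := C(K, Z →L[ℝ] F))).1 (hcont.tendsto γ) c hc
  filter_upwards [Metric.ball_mem_nhds (0 : C(K, Z)) hδ] with h hh
  rw [mem_ball_zero_iff] at hh
  rw [ContinuousMap.norm_le _ (by positivity)]
  intro s
  have key : ∀ x ∈ segment ℝ (γ s) (γ s + h s), ‖fderiv ℝ f x - fderiv ℝ f (γ s)‖ ≤ c := by
    intro x hx
    rw [segment_eq_image'] at hx
    obtain ⟨t, ht, rfl⟩ := hx
    have h1 : dist (γ + t • h) γ < δ := by
      rw [dist_eq_norm, add_sub_cancel_left, norm_smul, Real.norm_of_nonneg ht.1]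
      nlinarith [ht.2, norm_nonneg h]
    have h2 := (ContinuousMap.dist_lt_iff hc).1 (hδ' h1) s
    rw [dist_eq_norm] at h2
    simpa [f'] using h2.le
  have := (convex_segment (γ s) (γ s + h s)).norm_image_sub_le_of_norm_fderiv_le' (𝕜 := ℝ)
    (fun x _ => (hf.differentiable one_ne_zero) x) key (left_mem_segment _ _ _)
    (right_mem_segment _ _ _)
  simp only [add_sub_cancel_left] at this
  refine le_trans ?_ (this.trans (by gcongr; exact h.norm_coe_le_norm s))
  simp [f']

universe u

/-- The derivative of the superposition operator of f is the superposition operator of f' followed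
by a continuous linear map. The induction therefore changes the target from F to Z →L F, so F is
quantified inside it and all spaces share a universe. -/
theorem contDiff_postcomp_nat {Z : Type u} [NormedAddCommGroup Z] [NormedSpace ℝ Z] (n : ℕ) :
    ∀ {F : Type u} [NormedAddCommGroup F] [NormedSpace ℝ F] {f : Z → F} (hf : ContDiff ℝ n f),
      ContDiff ℝ n (fun γ : C(K, Z) => (⟨f, hf.continuous⟩ : C(Z, F)).comp γ) := by
  induction n with
  | zero =>
    intro F _ _ f hf
    exact contDiff_zero.2 (ContinuousMap.continuous_postcomp _)
  | succ n ih =>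
    intro F _ _ f hf
    have hf1 : ContDiff ℝ 1 f := hf.of_le (by norm_cast; omega)
    have hf' : ContDiff ℝ n (fderiv ℝ f) := hf.fderiv_right (by norm_cast)
    have hd : ∀ γ, HasFDerivAt (fun γ : C(K, Z) => (⟨f, hf.continuous⟩ : C(Z, F)).comp γ) _ γ :=
      fun γ => hasFDerivAt_postcomp hf1 γ
    push_cast
    rw [contDiff_succ_iff_fderiv]
    refine ⟨fun γ => (hd γ).differentiableAt, by simp, ?_⟩
    have : fderiv ℝ (fun γ : C(K, Z) => (⟨f, hf.continuous⟩ : C(Z, F)).comp γ) = fun γ =>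
        pointwiseApply K Z F ((⟨fderiv ℝ f, hf'.continuous⟩ : C(Z, Z →L[ℝ] F)).comp γ) :=
      funext fun γ => (hd γ).fderiv
    rw [this]
    exact (pointwiseApply K Z F).contDiff.comp (ih hf')

/-- Composition with a smooth map is a smooth operation on continuous functions. -/
theorem contDiff_postcomp {Z F : Type u} [NormedAddCommGroup Z] [NormedSpace ℝ Z]
    [NormedAddCommGroup F] [NormedSpace ℝ F] {f : Z → F} (hf : ContDiff ℝ ∞ f) :
    ContDiff ℝ ∞ (fun γ : C(K, Z) => (⟨f, hf.continuous⟩ : C(Z, F)).comp γ) :=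
  contDiff_infty.2 fun n => contDiff_postcomp_nat n (hf.of_le (by exact_mod_cast le_top))

end Superposition

/-- The primitive, vanishing at `0`, of a continuous function on `[0, 1]`. -/
def primitiveCLM (Z : Type*) [NormedAddCommGroup Z] [NormedSpace ℝ Z] [CompleteSpace Z] :
    C(Icc (0 : ℝ) 1, Z) →L[ℝ] C(Icc (0 : ℝ) 1, Z) :=
  LinearMap.mkContinuous
    { toFun := fun h => ⟨fun s => ∫ r in (0 : ℝ)..s, IccExtend zero_le_one h r, by
        have : Continuous (IccExtend (zero_le_one' ℝ) h) := h.continuous.Icc_extend'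
        exact (intervalIntegral.continuous_primitive (fun a b => this.intervalIntegrable a b)
          0).comp continuous_subtype_val⟩
      map_add' := by
        intro f g
        have hf : Continuous (IccExtend (zero_le_one' ℝ) f) := f.continuous.Icc_extend'
        have hg : Continuous (IccExtend (zero_le_one' ℝ) g) := g.continuous.Icc_extend'
        ext s
        exact intervalIntegral.integral_add (hf.intervalIntegrable _ _) (hg.intervalIntegrable _ _)
      map_smul' := by
        intro c f
        ext s
        exact intervalIntegral.integral_smul c _ } 1 (by
    intro h
    rw [ContinuousMap.norm_le _ (by positivity)]
    intro s
    have := intervalIntegral.norm_integral_le_of_norm_le_const (a := (0 : ℝ)) (b := s)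
      (f := IccExtend (zero_le_one' ℝ) h) (C := ‖h‖) (fun r _ => h.norm_coe_le_norm _)
    refine this.trans ?_
    rw [one_mul, sub_zero, abs_of_nonneg s.2.1]
    exact mul_le_of_le_one_right (norm_nonneg _) s.2.2)

/-- Constant functions. -/
def constCLM (Z : Type*) [NormedAddCommGroup Z] [NormedSpace ℝ Z] :
    Z →L[ℝ] C(Icc (0 : ℝ) 1, Z) :=
  LinearMap.mkContinuous
    { toFun := fun z => ContinuousMap.const _ z
      map_add' := fun _ _ => rfl
      map_smul' := fun _ _ => rfl } 1 (by
    intro z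
    rw [ContinuousMap.norm_le _ (by positivity)]
    intro s
    simp only [one_mul]
    exact le_rfl)

@[simp] theorem constCLM_apply {Z : Type*} [NormedAddCommGroup Z] [NormedSpace ℝ Z] (z : Z)
    (s : Icc (0 : ℝ) 1) : constCLM Z z s = z := rfl

universe u

variable {V Z : Type u} [NormedAddCommGroup V] [NormedSpace ℝ V] [NormedAddCommGroup Z]
  [NormedSpace ℝ Z]

/-- Solutions of a radial differential equation `d/ds Φ(sv) = A(Φ(sv)) v` depend smoothly on `v`
and on the initial value. -/
theorem exists_radial_solution [CompleteSpace V] [CompleteSpace Z] {A : Z → V →L[ℝ] Z}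
    (hA : ContDiff ℝ ∞ A) (z₀ : Z) :
    ∃ Φ : V × Z → Z, ∃ ε > 0, ContDiffOn ℝ ∞ Φ (ball 0 ε ×ˢ ball z₀ ε) ∧
      ∀ v ∈ ball (0 : V) ε, ∀ z ∈ ball z₀ ε, ∀ s ∈ Icc (0 : ℝ) 1,
        Φ (s • v, z) = z + ∫ r in (0 : ℝ)..s, A (Φ (r • v, z)) v := by
  set I := Icc (0 : ℝ) 1
  have h1I : (1 : ℝ) ∈ I := ⟨zero_le_one, le_rfl⟩
  have hsup := contDiff_postcomp (K := I) hA
  set N : C(I, Z) → C(I, V →L[ℝ] Z) :=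
    fun γ => (⟨A, hA.continuous⟩ : C(Z, V →L[ℝ] Z)).comp γ with hN
  -- The zeros of G are the paths with γ(s) = z + ∫₀ˢ A(γ(r)) v dr. At v = 0 this is γ - const, so
  -- the partial derivative in γ is the identity and the implicit function theorem applies.
  set G : (V × Z) × C(I, Z) → C(I, Z) := fun u =>
    u.2 - constCLM Z u.1.2 - primitiveCLM Z (pointwiseApply I V Z (N u.2) (constCLM V u.1.1))
    with hG
  have hGs : ContDiff ℝ ∞ G := by
    have h1 : ContDiff ℝ ∞ fun u : (V × Z) × C(I, Z) => u.1.1 := contDiff_fst.comp contDiff_fst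
    have h2 : ContDiff ℝ ∞ fun u : (V × Z) × C(I, Z) => u.1.2 := contDiff_snd.comp contDiff_fst
    refine (contDiff_snd.sub ((constCLM Z).contDiff.comp h2)).sub
      ((primitiveCLM Z).contDiff.comp ?_)
    exact ((pointwiseApply I V Z).contDiff.comp (hsup.comp contDiff_snd)).clm_apply
      ((constCLM V).contDiff.comp h1)
  have hGapp : ∀ (p : V × Z) (γ : C(I, Z)) (s : I), G (p, γ) s =
      γ s - (p.2 + ∫ r in (0 : ℝ)..s, A (IccExtend zero_le_one γ r) p.1) :=
    fun _ _ _ => sub_sub _ _ _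
  set u₀ : (V × Z) × C(I, Z) := ((0, z₀), constCLM Z z₀) with hu₀
  have hG' := (hGs.differentiable (by simp) u₀).hasFDerivAt
  have hinr : ∀ γ, fderiv ℝ G u₀ (0, γ) = γ := by
    intro γ
    have h1 : HasFDerivAt (fun γ : C(I, Z) => G ((0, z₀), γ))
        ((fderiv ℝ G u₀).comp (ContinuousLinearMap.inr ℝ (V × Z) C(I, Z))) (constCLM Z z₀) :=
      HasFDerivAt.comp (constCLM Z z₀) hG' (hasFDerivAt_prodMk_right _ _)
    have h2 : (fun γ : C(I, Z) => G ((0, z₀), γ)) = fun γ => γ - constCLM Z z₀ := by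
      funext γ; simp [hG]
    rw [h2] at h1
    have h3 := h1.unique ((hasFDerivAt_id _).sub_const _)
    simpa using DFunLike.congr_fun h3 γ
  -- The implicit function is extracted from the local inverse of this map; its derivative is block
  -- triangular with identities on the diagonal.
  set S : (V × Z) × C(I, Z) → (V × Z) × C(I, Z) := fun u => (u.1, G u) with hS
  set S' := (ContinuousLinearEquiv.refl ℝ (V × Z)).skewProd (ContinuousLinearEquiv.refl ℝ C(I, Z))
    ((fderiv ℝ G u₀).comp (ContinuousLinearMap.inl ℝ (V × Z) C(I, Z))) with hSe
  have hSd : HasFDerivAt S (S' : _ →L[ℝ] _) u₀ := by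
    refine (hasFDerivAt_fst.prodMk hG').congr_fderiv ?_
    refine ContinuousLinearMap.ext fun ⟨p, γ⟩ => ?_
    have : fderiv ℝ G u₀ (p, γ) = γ + fderiv ℝ G u₀ (p, 0) := by
      rw [← hinr γ, ← map_add, hinr]; simp
    simp [hSe, this]
  obtain ⟨h, hhS, hu₀s, -, hsym⟩ := exists_smooth_localInverse isOpen_univ
    (S := S) (contDiff_fst.prodMk hGs).contDiffOn (mem_univ u₀) hSd
  have hSapp : ∀ u, h u = (u.1, G u) := fun u => congrFun hhS u
  set Ψ : V × Z → C(I, Z) := fun p => (h.symm (p, 0)).2 with hΨ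
  have hGu₀ : G u₀ = 0 := by simp [hG, hu₀]
  have hSu₀ : h u₀ = ((0, z₀), 0) := by rw [hSapp, hGu₀]
  have hopt : IsOpen {p : V × Z | (p, (0 : C(I, Z))) ∈ h.target} :=
    h.open_target.preimage (by fun_prop)
  have hΨs : ContDiffOn ℝ ∞ Ψ {p : V × Z | (p, (0 : C(I, Z))) ∈ h.target} := by
    refine contDiff_snd.comp_contDiffOn (hsym.comp (ContDiff.contDiffOn ?_) fun p hp => hp)
    exact contDiff_id.prodMk contDiff_const
  have hΨu : ∀ p γ, (p, γ) ∈ h.source → G (p, γ) = 0 → Ψ p = γ := by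
    intro p γ hs hγ
    have : h (p, γ) = (p, 0) := by rw [hSapp, hγ]
    change (h.symm (p, 0)).2 = γ
    rw [← this, h.left_inv hs]
  have hΨG : ∀ p, (p, (0 : C(I, Z))) ∈ h.target → G (p, Ψ p) = 0 := by
    intro p hp
    have h1 := h.right_inv hp
    rw [hSapp] at h1
    have h2 : (h.symm (p, 0)).1 = p := congrArg Prod.fst h1
    have h3 : G (h.symm (p, 0)) = 0 := congrArg Prod.snd h1
    rw [← h3]; congr 1; exact Prod.ext h2.symm rfl
  have hmem0 : (((0 : V), z₀), (0 : C(I, Z))) ∈ h.target := hSu₀ ▸ h.map_source hu₀s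
  have hΨ0 : Ψ (0, z₀) = constCLM Z z₀ := hΨu _ _ hu₀s hGu₀
  obtain ⟨r, hr, hrb⟩ := Metric.isOpen_iff.1 h.open_source u₀ hu₀s
  have hΨc : ContinuousAt Ψ (0, z₀) := (hΨs.continuousOn.continuousAt (hopt.mem_nhds hmem0))
  have hev : ∀ᶠ p : V × Z in 𝓝 (0, z₀), (p, (0 : C(I, Z))) ∈ h.target ∧
      Ψ p ∈ ball (constCLM Z z₀) r ∧ p ∈ ball ((0 : V), z₀) r := by
    refine (hopt.eventually_mem hmem0).and (Filter.Eventually.and ?_ (ball_mem_nhds _ hr))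
    exact hΨc.eventually (by rw [hΨ0]; exact ball_mem_nhds _ hr)
  obtain ⟨ε, hε, hεb⟩ := Metric.mem_nhds_iff.1 hev
  refine ⟨fun p => Ψ p ⟨1, h1I⟩, ε, hε, ?_, ?_⟩
  · rw [ball_prod_same]
    refine ContDiff.comp_contDiffOn
      (g := fun γ : C(I, Z) => γ ⟨1, h1I⟩) ?_ (hΨs.mono fun p hp => (hεb hp).1)
    exact ContinuousLinearMap.contDiff (E := C(I, Z)) (F := Z)
      (ContinuousMap.evalCLM ℝ (⟨1, h1I⟩ : I))
  · intro v hv z hz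
    have hpb : ((v, z) : V × Z) ∈ ball ((0 : V), z₀) ε := by
      rw [← ball_prod_same]; exact ⟨hv, hz⟩
    obtain ⟨ht, hball, hpr⟩ := hεb hpb
    set γ := Ψ (v, z) with hγ
    have hsol : ∀ s : I, γ s = z + ∫ r in (0 : ℝ)..s, A (IccExtend zero_le_one γ r) v := by
      intro s
      have := DFunLike.congr_fun (hΨG _ ht) s
      rwa [hGapp, ContinuousMap.zero_apply, sub_eq_zero] at this
    -- The path t ↦ γ(st) solves the integral equation for sv, and local uniqueness identifies it
    -- with the solution for sv. Hence the endpoint for sv is the value of γ at time s.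
    have key : ∀ s (hs : s ∈ I), Ψ (s • v, z) ⟨1, h1I⟩ = γ ⟨s, hs⟩ := by
      intro s hs
      set γs : C(I, Z) := ⟨fun t => γ ⟨s * t, mul_nonneg hs.1 t.2.1,
        mul_le_one₀ hs.2 t.2.1 t.2.2⟩, by fun_prop⟩ with hγs
      have hsp : ((s • v, z), γs) ∈ h.source := by
        apply hrb
        rw [hu₀, ← ball_prod_same]
        refine ⟨?_, ?_⟩
        · rw [← ball_prod_same] at hpr ⊢
          refine ⟨?_, hpr.2⟩
          have := hpr.1
          rw [mem_ball_zero_iff] at this ⊢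
          rw [norm_smul, Real.norm_of_nonneg hs.1]
          exact lt_of_le_of_lt (mul_le_of_le_one_left (norm_nonneg _) hs.2) this
        · rw [mem_ball, ContinuousMap.dist_lt_iff hr] at hball ⊢
          intro t
          exact hball _
      have hGs0 : G ((s • v, z), γs) = 0 := by
        ext t
        rw [hGapp, ContinuousMap.zero_apply, sub_eq_zero]
        have h1 : γs t = _ := hsol ⟨s * t, mul_nonneg hs.1 t.2.1, mul_le_one₀ hs.2 t.2.1 t.2.2⟩
        rw [h1]
        congr 1
        have h2 := intervalIntegral.smul_integral_comp_mul_left (a := (0 : ℝ)) (b := (t : ℝ))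
          (fun r => A (IccExtend zero_le_one γ r) v) s
        rw [mul_zero] at h2
        rw [← h2, ← intervalIntegral.integral_smul]
        refine intervalIntegral.integral_congr fun r hr' => ?_
        rw [uIcc_of_le t.2.1] at hr'
        have hrI : r ∈ I := ⟨hr'.1, hr'.2.trans t.2.2⟩
        have hsrI : s * r ∈ I := ⟨mul_nonneg hs.1 hrI.1, mul_le_one₀ hs.2 hrI.1 hrI.2⟩
        rw [IccExtend_of_mem _ _ hrI, IccExtend_of_mem _ _ hsrI]
        simp [hγs]
      rw [hΨu _ _ hsp hGs0]
      simp [hγs]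
    intro s hs
    beta_reduce
    rw [key s hs, hsol ⟨s, hs⟩]
    congr 1
    refine intervalIntegral.integral_congr fun r hr' => ?_
    rw [uIcc_of_le hs.1] at hr'
    have hrI : r ∈ I := ⟨hr'.1, hr'.2.trans hs.2⟩
    rw [key r hrI, IccExtend_of_mem _ _ hrI]

/-- A solution of the radial part of an integrable total differential equation solves it. -/
theorem fderiv_eq_of_radial {A : Z → V →L[ℝ] Z} {O : Set Z} (hO : IsOpen O)
    (hA : ContDiffOn ℝ 1 A O)
    (hint : ∀ z ∈ O, ∀ v w, fderiv ℝ A z (A z v) w = fderiv ℝ A z (A z w) v)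
    {f : V → Z} {ε : ℝ} (hf : ContDiffOn ℝ 2 f (ball 0 ε)) (hfO : ∀ v ∈ ball (0 : V) ε, f v ∈ O)
    (hrad : ∀ v ∈ ball (0 : V) ε, fderiv ℝ f v v = A (f v) v) :
    ∀ v ∈ ball (0 : V) ε, fderiv ℝ f v = A (f v) := by
  intro v hv
  ext w
  have hAd : ∀ z ∈ O, HasFDerivAt A (fderiv ℝ A z) z := fun z hz =>
    ((hA.contDiffAt (hO.mem_nhds hz)).differentiableAt one_ne_zero).hasFDerivAt
  have hfat : ∀ u ∈ ball (0 : V) ε, ContDiffAt ℝ 2 f u := fun u hu =>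
    hf.contDiffAt (isOpen_ball.mem_nhds hu)
  have hfd : ∀ u ∈ ball (0 : V) ε, HasFDerivAt f (fderiv ℝ f u) u := fun u hu =>
    ((hfat u hu).differentiableAt two_ne_zero).hasFDerivAt
  have hfdd : ∀ u ∈ ball (0 : V) ε, HasFDerivAt (fderiv ℝ f) (fderiv ℝ (fderiv ℝ f) u) u :=
    fun u hu => (((hfat u hu).fderiv_right (m := 1) (by norm_num)).differentiableAt
      one_ne_zero).hasFDerivAt
  have hball : ∀ s ∈ Icc (0 : ℝ) 1, s • v ∈ ball (0 : V) ε := by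
    intro s hs
    rw [mem_ball_zero_iff] at hv ⊢
    rw [norm_smul, Real.norm_of_nonneg hs.1]
    exact lt_of_le_of_lt (mul_le_of_le_one_left (norm_nonneg _) hs.2) hv
  -- The radial equation is differentiated in the direction w, with the symmetry of the second
  -- derivative of f.
  have hvar : ∀ u ∈ ball (0 : V) ε, fderiv ℝ (fderiv ℝ f) u u w + fderiv ℝ f u w =
      fderiv ℝ A (f u) (fderiv ℝ f u w) u + A (f u) w := by
    intro u hu
    have h1 : HasFDerivAt (fun u => fderiv ℝ f u u) _ u := (hfdd u hu).clm_apply (hasFDerivAt_id u)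
    have h2 : HasFDerivAt (fun u => A (f u) u) _ u :=
      ((hAd _ (hfO u hu)).comp u (hfd u hu)).clm_apply (hasFDerivAt_id u)
    have h3 := (h1.congr_of_eventuallyEq (f₁ := fun u => A (f u) u)
      (by filter_upwards [isOpen_ball.mem_nhds hu] with u' hu' using (hrad u' hu').symm)).unique h2
    have h4 := DFunLike.congr_fun h3 w
    have hsym : fderiv ℝ (fderiv ℝ f) u u w = fderiv ℝ (fderiv ℝ f) u w u :=
      ((hfat u hu).isSymmSndFDerivAt (by simp)).eq u w
    rw [hsym]
    simp only [add_apply, ContinuousLinearMap.comp_apply,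
      ContinuousLinearMap.flip_apply, ContinuousLinearMap.id_apply] at h4
    rw [add_comm, h4, add_comm]; rfl
  have hline : ∀ s : ℝ, HasDerivAt (fun s : ℝ => s • v) v s := fun s => by
    simpa using (hasDerivAt_id s).smul_const v
  -- The error along the ray, times s. Integrability turns its derivative into a linear expression
  -- in y itself, and the factor s supplies the zero initial value.
  set y : ℝ → Z := fun s => s • (fderiv ℝ f (s • v) w - A (f (s • v)) w) with hy
  have hode : ∀ s ∈ Icc (0 : ℝ) 1,
      HasDerivAt y ((fderiv ℝ A (f (s • v))).flip v (y s)) s := by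
    intro s hs
    have hb := hball s hs
    have h1 : HasDerivAt (fun s : ℝ => fderiv ℝ f (s • v) w)
        (fderiv ℝ (fderiv ℝ f) (s • v) v w) s := by
      have := ((hfdd _ hb).comp_hasDerivAt s (hline s))
      exact (ContinuousLinearMap.apply ℝ Z w).hasFDerivAt.comp_hasDerivAt s this
    have h2 : HasDerivAt (fun s : ℝ => A (f (s • v)) w)
        (fderiv ℝ A (f (s • v)) (fderiv ℝ f (s • v) v) w) s := by
      have := (hAd _ (hfO _ hb)).comp_hasDerivAt s ((hfd _ hb).comp_hasDerivAt s (hline s))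
      exact (ContinuousLinearMap.apply ℝ Z w).hasFDerivAt.comp_hasDerivAt s this
    have h3 := (hasDerivAt_id s).smul (h1.sub h2)
    refine h3.congr_deriv ?_
    simp only [ContinuousLinearMap.flip_apply, hy, id, one_smul, Pi.sub_apply]
    -- For s ≠ 0 the radial equation at sv can be divided by s; at s = 0 the differentiated equation
    -- gives the claim directly.
    by_cases hs0 : s = 0
    · subst hs0
      have h4 := hvar 0 (by simpa using hb)
      simp only [map_zero, zero_apply, zero_add, zero_smul] at h4 ⊢
      rw [h4, sub_self]
    have hrad' : fderiv ℝ f (s • v) v = A (f (s • v)) v := by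
      have := hrad _ hb
      rw [map_smul, map_smul] at this
      exact smul_right_injective Z hs0 this
    have h4 := hvar _ hb
    rw [hrad', hint _ (hfO _ hb)]
    simp only [map_smul, map_sub, smul_apply, sub_apply,
      smul_sub] at h4 ⊢
    rw [← sub_eq_zero] at h4 ⊢
    rw [← h4]
    abel
  have hBc : ContinuousOn (fun s : ℝ => (fderiv ℝ A (f (s • v))).flip v) (Icc 0 1) := by
    have h1 : ContinuousOn (fun s : ℝ => fderiv ℝ A (f (s • v))) (Icc 0 1) := by
      refine (hA.continuousOn_fderiv_of_isOpen hO le_rfl).comp ?_ fun s hs => hfO _ (hball s hs)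
      exact hf.continuousOn.comp (by fun_prop) fun s hs => hball s hs
    have : Continuous fun B : Z →L[ℝ] V →L[ℝ] Z => B.flip v :=
      ((ContinuousLinearMap.apply ℝ (Z →L[ℝ] Z) v).comp
        (ContinuousLinearMap.flipₗᵢ ℝ Z V Z).toContinuousLinearEquiv.toContinuousLinearMap).continuous
    exact this.comp_continuousOn h1
  have := eq_zero_of_linear_ode hBc hode (by simp [hy]) 1 (by simp)
  simpa [hy, sub_eq_zero] using this

/-- The **Frobenius theorem** for total differential equations `dz = A(z)`. -/
theorem exists_frobenius_solution [CompleteSpace V] [FiniteDimensional ℝ Z] {A : Z → V →L[ℝ] Z}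
    {O : Set Z} (hO : IsOpen O) (hA : ContDiffOn ℝ ∞ A O)
    (hint : ∀ z ∈ O, ∀ v w, fderiv ℝ A z (A z v) w = fderiv ℝ A z (A z w) v)
    {z₀ : Z} (hz₀ : z₀ ∈ O) :
    ∃ Φ : V × Z → Z, ∃ ε > 0, ContDiffOn ℝ ∞ Φ (ball 0 ε ×ˢ ball z₀ ε) ∧
      (∀ z ∈ ball z₀ ε, Φ (0, z) = z) ∧
      ∀ v ∈ ball (0 : V) ε, ∀ z ∈ ball z₀ ε, Φ (v, z) ∈ O ∧
        ∀ w, fderiv ℝ Φ (v, z) (w, 0) = A (Φ (v, z)) w := by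
  have : CompleteSpace Z := FiniteDimensional.complete ℝ Z
  obtain ⟨r, hr, hrO⟩ := Metric.isOpen_iff.1 hO z₀ hz₀
  -- The radial problem is solved for coefficients smooth on the whole space; the cut-off leaves A
  -- unchanged on the ball of radius r/3, where the solutions stay.
  let ρ : ContDiffBump z₀ := ⟨r / 3, r / 2, by positivity, by linarith⟩
  set A' : Z → V →L[ℝ] Z := fun z => ρ z • A z with hA'
  have hA's : ContDiff ℝ ∞ A' := by
    rw [contDiff_iff_contDiffAt]
    intro z
    by_cases hz : z ∈ ball z₀ r
    · exact ρ.contDiff.contDiffAt.smul (hA.contDiffAt (hO.mem_nhds (hrO hz)))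
    · have hz' : z ∈ (closedBall z₀ (r / 2))ᶜ := by
        simp only [mem_ball, not_lt, mem_compl_iff, mem_closedBall, not_le] at hz ⊢
        linarith
      have : A' =ᶠ[𝓝 z] fun _ => 0 := by
        filter_upwards [isClosed_closedBall.isOpen_compl.mem_nhds hz'] with y hy
        have : ρ y = 0 := ρ.zero_of_le_dist (by
          simp only [mem_compl_iff, mem_closedBall, not_le] at hy; exact hy.le)
        simp [hA', this]
      exact contDiffAt_const.congr_of_eventuallyEq this
  have hAA' : ∀ z ∈ ball z₀ (r / 3), A' z = A z := by
    intro z hz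
    simp [hA', ρ.one_of_mem_closedBall (ball_subset_closedBall hz)]
  have hsub : ball z₀ (r / 3) ⊆ O := (ball_subset_ball (by linarith)).trans hrO
  obtain ⟨Φ, ε₀, hε₀, hΦs, hΦ⟩ := exists_radial_solution hA's z₀
  have hzero : ∀ z ∈ ball z₀ ε₀, Φ (0, z) = z := by
    intro z hz
    simpa using hΦ 0 (mem_ball_self hε₀) z hz 0 (by simp)
  have hopen : IsOpen (ball (0 : V) ε₀ ×ˢ ball z₀ ε₀) := isOpen_ball.prod isOpen_ball
  have hat : ∀ v ∈ ball (0 : V) ε₀, ∀ z ∈ ball z₀ ε₀, ContDiffAt ℝ ∞ Φ (v, z) :=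
    fun v hv z hz => hΦs.contDiffAt (hopen.mem_nhds ⟨hv, hz⟩)
  have hev : ∀ᶠ p : V × Z in 𝓝 (0, z₀), Φ p ∈ ball z₀ (r / 3) := by
    refine (hat 0 (mem_ball_self hε₀) z₀ (mem_ball_self hε₀)).continuousAt.eventually ?_
    rw [hzero z₀ (mem_ball_self hε₀)]
    exact ball_mem_nhds _ (by positivity)
  obtain ⟨ε₁, hε₁, hεb⟩ := Metric.mem_nhds_iff.1 hev
  set ε := min (ε₀ / 2) ε₁ with hε
  have hεpos : 0 < ε := by positivity
  have hε0 : ε ≤ ε₀ := (min_le_left _ _).trans (by linarith)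
  have hmem : ∀ v ∈ ball (0 : V) ε, ∀ z ∈ ball z₀ ε, Φ (v, z) ∈ ball z₀ (r / 3) := by
    intro v hv z hz
    apply hεb
    rw [← ball_prod_same]
    exact ⟨ball_subset_ball (min_le_right _ _) hv, ball_subset_ball (min_le_right _ _) hz⟩
  refine ⟨Φ, ε, hεpos, hΦs.mono (prod_mono (ball_subset_ball hε0) (ball_subset_ball hε0)),
    fun z hz => hzero z (ball_subset_ball hε0 hz), fun v hv z hz => ⟨hsub (hmem v hv z hz), ?_⟩⟩
  have hz' := ball_subset_ball hε0 hz
  have hcomp : ∀ u ∈ ball (0 : V) ε₀, HasFDerivAt (fun u => Φ (u, z))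
      ((fderiv ℝ Φ (u, z)).comp (ContinuousLinearMap.inl ℝ V Z)) u := by
    intro u hu
    exact HasFDerivAt.comp u ((hat u hu z hz').differentiableAt (by simp)).hasFDerivAt
      (hasFDerivAt_prodMk_left u z)
  -- The integral equation for 2u is differentiated at the interior time 1/2, where the path passes
  -- through u. This avoids a one-sided derivative at time 1 and is the reason for ε ≤ ε₀/2.
  have hrad : ∀ u ∈ ball (0 : V) ε, fderiv ℝ (fun u => Φ (u, z)) u u = A (Φ (u, z)) u := by
    intro u hu
    have hu2 : (2 : ℝ) • u ∈ ball (0 : V) ε₀ := by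
      rw [mem_ball_zero_iff] at hu ⊢
      rw [norm_smul, Real.norm_of_nonneg zero_le_two]
      have : ε ≤ ε₀ / 2 := min_le_left _ _
      linarith
    have hu1 := ball_subset_ball hε0 hu
    have hhalf : (1 / 2 : ℝ) • (2 : ℝ) • u = u := by rw [smul_smul]; norm_num
    have h1 : HasDerivAt (fun s : ℝ => Φ (s • (2 : ℝ) • u, z))
        (fderiv ℝ (fun u => Φ (u, z)) u ((2 : ℝ) • u)) (1 / 2) := by
      have hl : HasDerivAt (fun s : ℝ => s • (2 : ℝ) • u) ((2 : ℝ) • u) (1 / 2) := by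
        simpa using (hasDerivAt_id (1 / 2 : ℝ)).smul_const ((2 : ℝ) • u)
      have h0 := hcomp u hu1
      rw [← h0.fderiv] at h0
      exact HasFDerivAt.comp_hasDerivAt_of_eq (1 / 2 : ℝ) h0 hl hhalf.symm
    have hcont : ContinuousOn (fun s : ℝ => A' (Φ (s • (2 : ℝ) • u, z)) ((2 : ℝ) • u))
        (Icc 0 1) := by
      have : ContinuousOn (fun s : ℝ => Φ (s • (2 : ℝ) • u, z)) (Icc 0 1) := by
        refine hΦs.continuousOn.comp (by fun_prop) fun s hs => ⟨?_, hz'⟩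
        rw [mem_ball_zero_iff] at hu2 ⊢
        rw [norm_smul s, Real.norm_of_nonneg hs.1]
        exact lt_of_le_of_lt (mul_le_of_le_one_left (norm_nonneg _) hs.2) hu2
      exact (hA's.continuous.comp_continuousOn this).clm_apply continuousOn_const
    have h2 : HasDerivAt (fun s : ℝ => Φ (s • (2 : ℝ) • u, z))
        (A' (Φ (u, z)) ((2 : ℝ) • u)) (1 / 2) := by
      have hnh : Icc (0 : ℝ) 1 ∈ 𝓝 (1 / 2 : ℝ) := Icc_mem_nhds (by norm_num) (by norm_num)
      have h3 : HasDerivAt (fun s : ℝ => z + ∫ r in (0 : ℝ)..s,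
          A' (Φ (r • (2 : ℝ) • u, z)) ((2 : ℝ) • u)) (A' (Φ (u, z)) ((2 : ℝ) • u)) (1 / 2) := by
        refine HasDerivAt.const_add _ ?_
        have := intervalIntegral.integral_hasDerivAt_right (a := (0 : ℝ)) (b := 1 / 2)
          (f := fun r => A' (Φ (r • (2 : ℝ) • u, z)) ((2 : ℝ) • u))
          (ContinuousOn.intervalIntegrable (hcont.mono (by
            rw [uIcc_of_le (by norm_num)]; exact Icc_subset_Icc le_rfl (by norm_num))))
          (hcont.stronglyMeasurableAtFilter_nhdsWithin measurableSet_Icc (1 / 2) |>.filter_mono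
            (nhdsWithin_eq_nhds.2 hnh).ge) (hcont.continuousAt hnh)
        simpa only [hhalf] using this
      refine h3.congr_of_eventuallyEq ?_
      filter_upwards [hnh] with s hs
      exact hΦ _ hu2 z hz' s hs
    have h4 := h1.unique h2
    rw [hAA' _ (hmem u hu z hz), map_smul, map_smul] at h4
    exact smul_right_injective Z two_ne_zero h4
  have hfs : ContDiffOn ℝ 2 (fun u => Φ (u, z)) (ball 0 ε) := by
    intro u hu
    refine ContDiffAt.contDiffWithinAt ?_
    exact ContDiffAt.comp u ((hat u (ball_subset_ball hε0 hu) z hz').of_le (by norm_cast)) (contDiffAt_id.prodMk contDiffAt_const)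
  intro w
  have := fderiv_eq_of_radial hO (hA.of_le (by norm_cast)) hint hfs
    (fun u hu => hsub (hmem u hu z hz)) hrad v hv
  rw [← this, (hcomp v (ball_subset_ball hε0 hv)).fderiv]
  rfl

end Frobenius

/-! ### Levi-Civita connections on open subsets of a normed space -/

section Algebra

variable {E : Type*}

/-- A trilinear form that is symmetric in the first and skew in the last two arguments is zero. -/
theorem eq_zero_of_symm_of_skew {S : E → E → E → ℝ} (h1 : ∀ u v w, S u v w = S v u w)
    (h2 : ∀ u v w, S u v w = -S u w v) (u v w : E) : S u v w = 0 := by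
  have e1 := h1 u v w
  have e2 := h2 v u w
  have e3 := h1 v w u
  have e4 := h2 w v u
  have e5 := h1 w u v
  have e6 := h2 u w v
  linarith

/-- The pair symmetry of algebraic curvature tensors. -/
theorem pair_symm_of_bianchi {S : E → E → E → E → ℝ} (h1 : ∀ u v w z, S u v w z = -S v u w z)
    (h2 : ∀ u v w z, S u v w z = -S u v z w)
    (h3 : ∀ u v w z, S u v w z + S v w u z + S w u v z = 0) (u v w z : E) :
    S u v w z = S w z u v := by
  have b1 := h3 u v w z
  have b2 := h3 v w z u
  have b3 := h3 w z u v
  have b4 := h3 z u v w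
  have a1 := h2 v w u z
  have a2 := h2 w u v z
  have a3 := h1 w u v z
  have a4 := h2 u v w z
  have a5 := h1 u v w z
  have c1 := h2 w z v u
  have c2 := h1 z v w u
  have c3 := h2 v z w u
  have c4 := h2 z u w v
  have c5 := h1 z u w v
  have c6 := h2 u z w v
  have c7 := h1 u v z w
  have c8 := h2 z u v w
  have c9 := h2 u w z v
  have d1 := h2 z v w u
  have d2 := h1 w z u v
  have d3 := h1 u w z v
  have d4 := h1 v z u w
  have d5 := h2 v z u w
  have d6 := h2 u w v z
  linarith

end Algebra

section LeviCivita

variable {E : Type*} [NormedAddCommGroup E] [NormedSpace ℝ E]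

theorem minSmoothness_two_le_infty : minSmoothness ℝ 2 ≤ (∞ : WithTop ℕ∞) := by
  simp only [minSmoothness_of_isRCLikeNormedField]
  norm_cast

/-- The curvature `R(u, v) w` of the connection with Christoffel symbols `Γ`. -/
def curvature (Γ : E → E →L[ℝ] E →L[ℝ] E) (x u v w : E) : E :=
  fderiv ℝ Γ x u v w - fderiv ℝ Γ x v u w + Γ x u (Γ x v w) - Γ x v (Γ x u w)

/-- The covariant derivative `∇_u K`. -/
def covariantDeriv (Γ : E → E →L[ℝ] E →L[ℝ] E) (K : E → E) (x u : E) : E :=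
  fderiv ℝ K x u + Γ x u (K x)

/-- `Γ` is the Levi-Civita connection of the metric `g` on the open set `U`. -/
structure IsLeviCivitaOn (g : E → E →L[ℝ] E →L[ℝ] ℝ) (Γ : E → E →L[ℝ] E →L[ℝ] E)
    (U : Set E) : Prop where
  isOpen : IsOpen U
  smooth_metric : ContDiffOn ℝ ∞ g U
  smooth_conn : ContDiffOn ℝ ∞ Γ U
  symm : ∀ x ∈ U, ∀ u v, g x u v = g x v u
  nondeg : ∀ x ∈ U, ∀ u, (∀ v, g x u v = 0) → u = 0
  torsion : ∀ x ∈ U, ∀ u v, Γ x u v = Γ x v u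
  compat : ∀ x ∈ U, ∀ u v w, fderiv ℝ g x u v w = g x (Γ x u v) w + g x v (Γ x u w)

theorem HasFDerivAt.clm_apply_const {F G : Type*} [NormedAddCommGroup F] [NormedSpace ℝ F]
    [NormedAddCommGroup G] [NormedSpace ℝ G] {f : E → F →L[ℝ] G} {f' : E →L[ℝ] F →L[ℝ] G} {x : E}
    (h : HasFDerivAt f f' x) (v : F) : HasFDerivAt (fun y => f y v) (f'.flip v) x := by
  have := h.clm_apply (hasFDerivAt_const v x)
  refine this.congr_fderiv ?_
  ext; simp

theorem fderiv_apply_const {F G : Type*} [NormedAddCommGroup F] [NormedSpace ℝ F]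
    [NormedAddCommGroup G] [NormedSpace ℝ G] {f : E → F →L[ℝ] G} {x : E}
    (h : DifferentiableAt ℝ f x) (v : F) (u : E) :
    fderiv ℝ (fun y => f y v) x u = fderiv ℝ f x u v := by
  rw [(h.hasFDerivAt.clm_apply_const v).fderiv]; rfl

namespace IsLeviCivitaOn

variable {g : E → E →L[ℝ] E →L[ℝ] ℝ} {Γ : E → E →L[ℝ] E →L[ℝ] E} {U : Set E} {x : E}

theorem hasFDerivAt_metric (h : IsLeviCivitaOn g Γ U) (hx : x ∈ U) :
    HasFDerivAt g (fderiv ℝ g x) x :=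
  ((h.smooth_metric.contDiffAt (h.isOpen.mem_nhds hx)).differentiableAt (by simp)).hasFDerivAt

theorem hasFDerivAt_conn (h : IsLeviCivitaOn g Γ U) (hx : x ∈ U) :
    HasFDerivAt Γ (fderiv ℝ Γ x) x :=
  ((h.smooth_conn.contDiffAt (h.isOpen.mem_nhds hx)).differentiableAt (by simp)).hasFDerivAt

theorem mono (h : IsLeviCivitaOn g Γ U) {U' : Set E} (hU' : IsOpen U') (hsub : U' ⊆ U) :
    IsLeviCivitaOn g Γ U' :=
  ⟨hU', h.smooth_metric.mono hsub, h.smooth_conn.mono hsub, fun x hx => h.symm x (hsub hx),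
    fun x hx => h.nondeg x (hsub hx), fun x hx => h.torsion x (hsub hx),
    fun x hx => h.compat x (hsub hx)⟩

theorem fderiv_conn_symm (h : IsLeviCivitaOn g Γ U) (hx : x ∈ U) (u v w : E) :
    fderiv ℝ Γ x u v w = fderiv ℝ Γ x u w v := by
  have h1 := ((h.hasFDerivAt_conn hx).clm_apply_const v).clm_apply_const w
  have h2 := ((h.hasFDerivAt_conn hx).clm_apply_const w).clm_apply_const v
  have h3 := h1.unique (h2.congr_of_eventuallyEq (by
    filter_upwards [h.isOpen.mem_nhds hx] with y hy using h.torsion y hy v w))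
  exact DFunLike.congr_fun h3 u

theorem ext_inner (h : IsLeviCivitaOn g Γ U) (hx : x ∈ U) {u v : E}
    (huv : ∀ w, g x u w = g x v w) : u = v := by
  rw [← sub_eq_zero]
  exact h.nondeg x hx _ fun w => by simp [huv w]

theorem curvature_swap (u v w : E) : curvature Γ x u v w = -curvature Γ x v u w := by
  simp only [curvature]; abel

theorem bianchi (h : IsLeviCivitaOn g Γ U) (hx : x ∈ U) (u v w : E) :
    curvature Γ x u v w + curvature Γ x v w u + curvature Γ x w u v = 0 := by
  simp only [curvature]
  rw [h.fderiv_conn_symm hx u v w, h.fderiv_conn_symm hx v w u, h.fderiv_conn_symm hx w u v,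
    h.torsion x hx u v, h.torsion x hx v w, h.torsion x hx w u]
  abel

/-- Differentiating metric compatibility once more expresses the second derivative of g through Γ.
Its antisymmetric part in u, v is zero, and what remains is the symmetric part of R(u, v). -/
theorem curvature_skew (h : IsLeviCivitaOn g Γ U) (hx : x ∈ U) (u v w z : E) :
    g x (curvature Γ x u v w) z = -g x (curvature Γ x u v z) w := by
  have hg2 : ContDiffAt ℝ ∞ g x := h.smooth_metric.contDiffAt (h.isOpen.mem_nhds hx)
  have hdd : HasFDerivAt (fderiv ℝ g) (fderiv ℝ (fderiv ℝ g) x) x :=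
    ((hg2.fderiv_right (m := 1) (by norm_cast)).differentiableAt one_ne_zero).hasFDerivAt
  have key : ∀ a b, fderiv ℝ (fderiv ℝ g) x a b w z =
      fderiv ℝ g x a (Γ x b w) z + g x (fderiv ℝ Γ x a b w) z + fderiv ℝ g x a w (Γ x b z)
        + g x w (fderiv ℝ Γ x a b z) := by
    intro a b
    have h1 := ((hdd.clm_apply_const b).clm_apply_const w).clm_apply_const z
    have hG := h.hasFDerivAt_conn hx
    have h2 := (((h.hasFDerivAt_metric hx).clm_apply
      ((hG.clm_apply_const b).clm_apply_const w)).clm_apply_const z).add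
      (((h.hasFDerivAt_metric hx).clm_apply_const w).clm_apply
        ((hG.clm_apply_const b).clm_apply_const z))
    have h3 := h1.unique (h2.congr_of_eventuallyEq (by
      filter_upwards [h.isOpen.mem_nhds hx] with y hy using h.compat y hy b w z))
    have h4 := DFunLike.congr_fun h3 a
    simp only [ContinuousLinearMap.flip_apply, add_apply, ContinuousLinearMap.comp_apply] at h4
    rw [h4]
    ring
  have hsym : fderiv ℝ (fderiv ℝ g) x u v w z = fderiv ℝ (fderiv ℝ g) x v u w z := by
    rw [(hg2.isSymmSndFDerivAt minSmoothness_two_le_infty).eq u v]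
  rw [key, key, h.compat x hx, h.compat x hx, h.compat x hx, h.compat x hx] at hsym
  simp only [curvature, map_add, map_sub, add_apply, sub_apply]
  rw [h.symm x hx _ w, h.symm x hx _ w, h.symm x hx _ w, h.symm x hx _ w]
  linarith

theorem curvature_pair_symm (h : IsLeviCivitaOn g Γ U) (hx : x ∈ U) (u v w z : E) :
    g x (curvature Γ x u v w) z = g x (curvature Γ x w z u) v := by
  refine pair_symm_of_bianchi (S := fun u v w z => g x (curvature Γ x u v w) z) ?_
    (fun u v w z => h.curvature_skew hx u v w z) ?_ u v w z
  · intro u v w z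
    rw [curvature_swap]; simp
  · intro u v w z
    simp only [← add_apply, ← map_add]
    rw [h.bianchi hx]; simp

end IsLeviCivitaOn

/-! ### Change of coordinates -/

section Transformation

variable {g g' : E → E →L[ℝ] E →L[ℝ] ℝ} {Γ Γ' : E → E →L[ℝ] E →L[ℝ] E} {U U' : Set E}
  {φ : E → E}

/-- `φ` maps the metric `g` on `U` to the metric `g'` on `U'`. -/
structure IsLocalIsometryOn (g g' : E → E →L[ℝ] E →L[ℝ] ℝ) (φ : E → E) (U U' : Set E) :
    Prop where
  smooth : ContDiffOn ℝ ∞ φ U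
  mapsTo : MapsTo φ U U'
  surj : ∀ x ∈ U, Function.Surjective (fderiv ℝ φ x)
  metric : ∀ x ∈ U, ∀ u v, g x u v = g' (φ x) (fderiv ℝ φ x u) (fderiv ℝ φ x v)

variable (hg : IsLeviCivitaOn g Γ U) (hg' : IsLeviCivitaOn g' Γ' U')
  (hφ : IsLocalIsometryOn g g' φ U U')
include hg hg' hφ

/-- The difference of the two sides, lowered with g', is symmetric in its first two arguments
because both connections are torsion free, and skew in the last two because both are metric. Such a
form vanishes, and surjectivity of dφ makes this enough. -/
theorem IsLocalIsometryOn.fderiv_conn {x : E} (hx : x ∈ U) (u v : E) :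
    fderiv ℝ φ x (Γ x u v) =
      Γ' (φ x) (fderiv ℝ φ x u) (fderiv ℝ φ x v) + fderiv ℝ (fderiv ℝ φ) x u v := by
  have hφx : ContDiffAt ℝ ∞ φ x := hφ.smooth.contDiffAt (hg.isOpen.mem_nhds hx)
  have hd : HasFDerivAt φ (fderiv ℝ φ x) x := (hφx.differentiableAt (by simp)).hasFDerivAt
  have hdd : HasFDerivAt (fderiv ℝ φ) (fderiv ℝ (fderiv ℝ φ) x) x :=
    ((hφx.fderiv_right (m := 1) (by norm_cast)).differentiableAt one_ne_zero).hasFDerivAt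
  have hsymm : ∀ a b, fderiv ℝ (fderiv ℝ φ) x a b = fderiv ℝ (fderiv ℝ φ) x b a := fun a b =>
    (hφx.isSymmSndFDerivAt minSmoothness_two_le_infty).eq a b
  have hφU := hφ.mapsTo hx
  set D := fderiv ℝ φ x
  have key : ∀ a b c, g x (Γ x a b) c + g x b (Γ x a c) =
      g' (φ x) (Γ' (φ x) (D a) (D b)) (D c) + g' (φ x) (D b) (Γ' (φ x) (D a) (D c))
      + g' (φ x) (fderiv ℝ (fderiv ℝ φ) x a b) (D c)
      + g' (φ x) (D b) (fderiv ℝ (fderiv ℝ φ) x a c) := by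
    intro a b c
    have h1 := ((hg.hasFDerivAt_metric hx).clm_apply_const b).clm_apply_const c
    have h0 : HasFDerivAt (fun y => g' (φ y)) _ x := (hg'.hasFDerivAt_metric hφU).comp x hd
    have h2 := (h0.clm_apply (hdd.clm_apply_const b)).clm_apply (hdd.clm_apply_const c)
    have h3 := h1.unique (h2.congr_of_eventuallyEq (by
      filter_upwards [hg.isOpen.mem_nhds hx] with y hy using hφ.metric y hy b c))
    have h4 := DFunLike.congr_fun h3 a
    simp only [ContinuousLinearMap.flip_apply, add_apply, ContinuousLinearMap.comp_apply] at h4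
    rw [← hg.compat x hx, h4, hg'.compat _ hφU]
    ring
  set T : E → E → E := fun a b => D (Γ x a b) - Γ' (φ x) (D a) (D b)
    - fderiv ℝ (fderiv ℝ φ) x a b with hT
  have hS := eq_zero_of_symm_of_skew (S := fun a b c => g' (φ x) (T a b) (D c)) (by
    intro a b c
    simp only [hT]
    rw [hg.torsion x hx a b, hg'.torsion _ hφU (D a) (D b), hsymm a b]) (by
    intro a b c
    have := key a b c
    rw [hφ.metric x hx, hφ.metric x hx] at this
    simp only [hT, map_sub, sub_apply]
    rw [hg'.symm _ hφU (D (Γ x a c)), hg'.symm _ hφU (Γ' _ _ (D c)),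
      hg'.symm _ hφU (fderiv ℝ (fderiv ℝ φ) x a c)]
    linarith)
  have h0 : T u v = 0 := by
    refine hg'.nondeg _ hφU _ fun w => ?_
    obtain ⟨c, rfl⟩ := hφ.surj x hx w
    exact hS u v c
  rw [← sub_eq_zero, ← h0]
  simp only [hT]; abel

/-- The transformation law of the connection is differentiated and antisymmetrised; third
derivatives of φ cancel, and the terms with second derivatives are absorbed by the quadratic part of
the curvature. -/
theorem IsLocalIsometryOn.fderiv_curvature {x : E} (hx : x ∈ U) (u v w : E) :
    fderiv ℝ φ x (curvature Γ x u v w) =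
      curvature Γ' (φ x) (fderiv ℝ φ x u) (fderiv ℝ φ x v) (fderiv ℝ φ x w) := by
  have hφx : ContDiffAt ℝ ∞ φ x := hφ.smooth.contDiffAt (hg.isOpen.mem_nhds hx)
  have hd : HasFDerivAt φ (fderiv ℝ φ x) x := (hφx.differentiableAt (by simp)).hasFDerivAt
  have hφ2 : ContDiffAt ℝ ∞ (fderiv ℝ φ) x := hφx.fderiv_right (m := ∞) (by norm_cast)
  have hdd : HasFDerivAt (fderiv ℝ φ) (fderiv ℝ (fderiv ℝ φ) x) x :=
    (hφ2.differentiableAt (by simp)).hasFDerivAt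
  have hddd : HasFDerivAt (fderiv ℝ (fderiv ℝ φ)) (fderiv ℝ (fderiv ℝ (fderiv ℝ φ)) x) x :=
    ((hφ2.fderiv_right (m := 1) (by norm_cast)).differentiableAt one_ne_zero).hasFDerivAt
  have hφU := hφ.mapsTo hx
  set D := fderiv ℝ φ x
  have key : ∀ a b c, D (fderiv ℝ Γ x a b c) + fderiv ℝ (fderiv ℝ φ) x a (Γ x b c) =
      fderiv ℝ Γ' (φ x) (D a) (D b) (D c) + Γ' (φ x) (fderiv ℝ (fderiv ℝ φ) x a b) (D c)
      + Γ' (φ x) (D b) (fderiv ℝ (fderiv ℝ φ) x a c)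
      + fderiv ℝ (fderiv ℝ (fderiv ℝ φ)) x a b c := by
    intro a b c
    have h1 := hdd.clm_apply (((hg.hasFDerivAt_conn hx).clm_apply_const b).clm_apply_const c)
    have h0 : HasFDerivAt (fun y => Γ' (φ y)) _ x := (hg'.hasFDerivAt_conn hφU).comp x hd
    have h2 := ((h0.clm_apply (hdd.clm_apply_const b)).clm_apply (hdd.clm_apply_const c)).add
      ((hddd.clm_apply_const b).clm_apply_const c)
    have h3 := h1.unique (h2.congr_of_eventuallyEq (by
      filter_upwards [hg.isOpen.mem_nhds hx] with y hy using
        hφ.fderiv_conn hg hg' hy b c))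
    have h4 := DFunLike.congr_fun h3 a
    simp only [ContinuousLinearMap.flip_apply, add_apply, ContinuousLinearMap.comp_apply] at h4
    rw [h4]
    abel
  have hsymm : ∀ a b, fderiv ℝ (fderiv ℝ φ) x a b = fderiv ℝ (fderiv ℝ φ) x b a := fun a b =>
    (hφx.isSymmSndFDerivAt minSmoothness_two_le_infty).eq a b
  have hsymm3 : fderiv ℝ (fderiv ℝ (fderiv ℝ φ)) x u v w =
      fderiv ℝ (fderiv ℝ (fderiv ℝ φ)) x v u w := by
    rw [(hφ2.isSymmSndFDerivAt minSmoothness_two_le_infty).eq u v]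
  have hconn : ∀ a b, D (Γ x a b) = Γ' (φ x) (D a) (D b) + fderiv ℝ (fderiv ℝ φ) x a b :=
    fun a b => hφ.fderiv_conn hg hg' hx a b
  have k1 := eq_sub_of_add_eq (key u v w)
  have k2 := eq_sub_of_add_eq (key v u w)
  simp only [curvature, map_add, map_sub]
  rw [k1, k2, hconn u (Γ x v w), hconn v (Γ x u w), hconn v w, hconn u w, hsymm v u, hsymm3]
  simp only [map_add]
  abel

/-- The second derivative of φ from differentiating dφ(K) cancels the inhomogeneous term in the law
for the connection. -/
theorem IsLocalIsometryOn.fderiv_covariantDeriv {K K' : E → E} (hK : DifferentiableOn ℝ K U)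
    (hK' : DifferentiableOn ℝ K' U') (hKK' : ∀ x ∈ U, K' (φ x) = fderiv ℝ φ x (K x))
    {x : E} (hx : x ∈ U) (u : E) :
    fderiv ℝ φ x (covariantDeriv Γ K x u) = covariantDeriv Γ' K' (φ x) (fderiv ℝ φ x u) := by
  have hφx : ContDiffAt ℝ ∞ φ x := hφ.smooth.contDiffAt (hg.isOpen.mem_nhds hx)
  have hd : HasFDerivAt φ (fderiv ℝ φ x) x := (hφx.differentiableAt (by simp)).hasFDerivAt
  have hdd : HasFDerivAt (fderiv ℝ φ) (fderiv ℝ (fderiv ℝ φ) x) x :=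
    ((hφx.fderiv_right (m := 1) (by norm_cast)).differentiableAt one_ne_zero).hasFDerivAt
  have hφU := hφ.mapsTo hx
  have h1 := ((hK'.differentiableAt (hg'.isOpen.mem_nhds hφU)).hasFDerivAt).comp x hd
  have h2 := hdd.clm_apply (hK.differentiableAt (hg.isOpen.mem_nhds hx)).hasFDerivAt
  have h3 := h1.unique (h2.congr_of_eventuallyEq (by
      filter_upwards [hg.isOpen.mem_nhds hx] with y hy using hKK' y hy))
  have h4 := DFunLike.congr_fun h3 u
  simp only [ContinuousLinearMap.flip_apply, add_apply, ContinuousLinearMap.comp_apply] at h4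
  simp only [covariantDeriv, map_add]
  rw [h4, hφ.fderiv_conn hg hg' hx, hKK' x hx]
  abel

end Transformation

end LeviCivita

/-! ### Null frames -/

section NullFrames

open Coordinates

variable {n : ℕ}

/-- `B` is a Lorentzian scalar product. -/
def IsLorentzForm (B : (Fin n → ℝ) →L[ℝ] (Fin n → ℝ) →L[ℝ] ℝ) : Prop :=
  ∃ P : (Fin n → ℝ) ≃L[ℝ] (Fin n → ℝ), ∀ u v, B (P u) (P v) = u ⬝ᵥ (minkowski n *ᵥ v)

theorem minkowski_form (u v : Fin n → ℝ) :
    u ⬝ᵥ (minkowski n *ᵥ v) = ∑ a, (if a.val = 0 then -1 else 1) * (u a * v a) := by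
  simp only [dotProduct, minkowski, Matrix.mulVec_diagonal]
  exact Finset.sum_congr rfl fun a _ => by ring

theorem minkowski_form_eq (hn : 0 < n) (u v : Fin n → ℝ) :
    u ⬝ᵥ (minkowski n *ᵥ v) = ∑ a, u a * v a - 2 * (u ⟨0, hn⟩ * v ⟨0, hn⟩) := by
  rw [minkowski_form, ← Finset.add_sum_erase _ _ (Finset.mem_univ (⟨0, hn⟩ : Fin n)),
    ← Finset.add_sum_erase _ (fun a => u a * v a) (Finset.mem_univ (⟨0, hn⟩ : Fin n))]
  have : ∀ a ∈ Finset.univ.erase (⟨0, hn⟩ : Fin n),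
      (if a.val = 0 then (-1 : ℝ) else 1) * (u a * v a) = u a * v a := by
    intro a ha
    rw [if_neg, one_mul]
    exact fun h => (Finset.ne_of_mem_erase ha) (Fin.ext h)
  rw [Finset.sum_congr rfl this]
  simp only [if_true]
  ring

theorem IsLorentzForm.symm {B : (Fin n → ℝ) →L[ℝ] (Fin n → ℝ) →L[ℝ] ℝ} (h : IsLorentzForm B)
    (u v : Fin n → ℝ) : B u v = B v u := by
  obtain ⟨P, hP⟩ := h
  have h1 := hP (P.symm u) (P.symm v)
  have h2 := hP (P.symm v) (P.symm u)
  simp only [ContinuousLinearEquiv.apply_symm_apply] at h1 h2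
  rw [h1, h2, minkowski_form, minkowski_form]
  exact Finset.sum_congr rfl fun a _ => by ring

theorem IsLorentzForm.nondeg {B : (Fin n → ℝ) →L[ℝ] (Fin n → ℝ) →L[ℝ] ℝ} (h : IsLorentzForm B)
    {u : Fin n → ℝ} (hu : ∀ v, B u v = 0) : u = 0 := by
  obtain ⟨P, hP⟩ := h
  have h1 : P.symm u = 0 := by
    funext a
    have := hP (P.symm u) (Pi.single a 1)
    rw [ContinuousLinearEquiv.apply_symm_apply, hu, minkowski_form,
      Finset.sum_eq_single a (by intro b _ hb; simp [hb]) (by simp)] at this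
    split_ifs at this <;> simpa using this.symm
  simpa using h1

/-- The Euclidean complement of two vectors has dimension at least n - 2. Vectors without a time
component have the same products for the Minkowski form, so this serves as a screen. -/
theorem exists_orthonormal_orthogonal_pair (o : Fin n) (k : Fin n → ℝ) :
    ∃ m : Fin (n - 2) → (Fin n → ℝ), (∀ i, m i o = 0) ∧ (∀ i, ∑ a, k a * m i a = 0) ∧
      ∀ i j, ∑ a, m i a * m j a = if i = j then 1 else 0 := by
  set W : Submodule ℝ (EuclideanSpace ℝ (Fin n)) :=
    Submodule.span ℝ ({WithLp.toLp 2 (Pi.single o 1), WithLp.toLp 2 k} : Set _) with hW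
  have hWfin : Module.finrank ℝ W ≤ 2 := by
    have := finrank_span_finset_le_card (R := ℝ)
      ({WithLp.toLp 2 (Pi.single o 1), WithLp.toLp 2 k} : Finset (EuclideanSpace ℝ (Fin n)))
    rw [Finset.coe_insert, Finset.coe_singleton] at this
    exact this.trans Finset.card_le_two
  have hdim : n - 2 ≤ Module.finrank ℝ Wᗮ := by
    have := W.finrank_add_finrank_orthogonal
    rw [finrank_euclideanSpace_fin] at this
    omega
  have hinner : ∀ u v : EuclideanSpace ℝ (Fin n), inner ℝ u v = ∑ a, u a * v a := fun u v => by
    rw [PiLp.inner_apply]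
    exact Finset.sum_congr rfl fun a _ => by simp [mul_comm]
  obtain ⟨b, hb⟩ : ∃ b : Fin (n - 2) → Wᗮ, Orthonormal ℝ b :=
    ⟨_, (stdOrthonormalBasis ℝ Wᗮ).orthonormal.comp _ (Fin.castLE_injective hdim)⟩
  refine ⟨fun i => (b i : EuclideanSpace ℝ (Fin n)), fun i => ?_, fun i => ?_, fun i j => ?_⟩
  · have := (Submodule.mem_orthogonal W _).1 (b i).2 _ (Submodule.subset_span (mem_insert _ _))
    rw [hinner] at this
    simpa [Pi.single_apply] using this
  · have := (Submodule.mem_orthogonal W _).1 (b i).2 _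
      (Submodule.subset_span (mem_insert_of_mem _ (mem_singleton _)))
    rwa [hinner] at this
  · have := orthonormal_iff_ite.1 hb i j
    rwa [Submodule.coe_inner, hinner] at this

theorem euclidean_frame (hn : 2 ≤ n) {k : Fin n → ℝ} (hk : k ≠ 0)
    (hnull : k ⬝ᵥ (minkowski n *ᵥ k) = 0) :
    ∃ E : Fin 2 ⊕ Fin (n - 2) → (Fin n → ℝ), E (.inl 0) = k ∧
      ∀ s t, E s ⬝ᵥ (minkowski n *ᵥ E t) = nullGram s t := by
  have hn0 : 0 < n := by omega
  set o : Fin n := ⟨0, hn0⟩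
  have hform : ∀ u v : Fin n → ℝ, u ⬝ᵥ (minkowski n *ᵥ v) = ∑ a, u a * v a - 2 * (u o * v o) :=
    minkowski_form_eq hn0
  have hsq : ∑ a, k a * k a = 2 * (k o * k o) := by
    have := hform k k; rw [hnull] at this; linarith
  have ha : k o ≠ 0 := by
    intro h0
    apply hk
    rw [h0, mul_zero, mul_zero, Finset.sum_eq_zero_iff_of_nonneg
      (fun a _ => mul_self_nonneg (k a))] at hsq
    funext a
    simpa using hsq a (Finset.mem_univ a)
  obtain ⟨m, hmo, hmk, hmm⟩ := exists_orthonormal_orthogonal_pair o k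
  -- The second null vector is k with its time component reversed, divided by 2(k⁰)² so that its
  -- product with k is 1.
  set N : Fin n → ℝ := fun a => (k a - if a = o then 2 * k o else 0) / (2 * (k o * k o)) with hN
  have hNsum : ∀ v : Fin n → ℝ, ∑ a, N a * v a =
      (∑ a, k a * v a - 2 * k o * v o) / (2 * (k o * k o)) := by
    intro v
    have : ∀ a, N a * v a = (k a * v a - if a = o then 2 * k o * v o else 0) /
        (2 * (k o * k o)) := by
      intro a
      simp only [hN]
      split_ifs with h
      · subst h; ring
      · ring
    rw [Finset.sum_congr rfl fun a _ => this a, ← Finset.sum_div, Finset.sum_sub_distrib]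
    simp
  have hNo : N o = -1 / (2 * k o) := by simp only [hN, if_true]; field_simp; ring
  have hcomm : ∀ u v : Fin n → ℝ, ∑ a, u a * v a = ∑ a, v a * u a := fun u v =>
    Finset.sum_congr rfl fun a _ => mul_comm _ _
  have hkN : ∑ a, k a * N a - 2 * (k o * N o) = 1 := by
    rw [hcomm, hNsum, hsq, hNo]; field_simp; ring
  have hNN : ∑ a, N a * N a - 2 * (N o * N o) = 0 := by
    rw [hNsum, hcomm k N, hNsum, hsq, hNo]; field_simp; ring
  have hNm : ∀ i, ∑ a, N a * m i a = 0 := by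
    intro i; rw [hNsum, hmk, hmo]; simp
  refine ⟨Sum.elim ![k, N] m, rfl, ?_⟩
  rintro (s | i) (t | j)
  · fin_cases s <;> fin_cases t <;> simp only [hform]
    · simp [nullGram, hsq]
    · simp [nullGram, hkN]
    · have := hkN
      rw [hcomm, mul_comm (k o)] at this
      simp [nullGram, this]
    · simp [nullGram, hNN]
  · fin_cases s <;> simp only [hform]
    · simp [nullGram, hmk, hmo]
    · simp [nullGram, hNm, hmo]
  · fin_cases t <;> simp only [hform]
    · simp [nullGram, hcomm (m i) k, hmk, hmo]
    · simp [nullGram, hcomm (m i) N, hNm, hmo]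
  · simp only [hform, Sum.elim_inr, hmm, hmo, nullGram]
    simp

variable {B : (Fin n → ℝ) →L[ℝ] (Fin n → ℝ) →L[ℝ] ℝ}

/-- A nonzero null vector is the first vector of a null frame. -/
theorem IsLorentzForm.exists_nullFrame (h : IsLorentzForm B) (hn : 2 ≤ n) {k : Fin n → ℝ}
    (hk : k ≠ 0) (hnull : B k k = 0) :
    ∃ E : Fin 2 ⊕ Fin (n - 2) → (Fin n → ℝ), E (.inl 0) = k ∧
      ∀ s t, B (E s) (E t) = nullGram s t := by
  obtain ⟨P, hP⟩ := h
  obtain ⟨E, hE0, hE⟩ := euclidean_frame hn (k := P.symm k) (by simpa using hk) (by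
    rw [← hP]; simpa using hnull)
  exact ⟨fun s => P (E s), by simp [hE0], fun s t => by rw [hP, hE]⟩

section Frame

variable {E : Fin 2 ⊕ Fin (n - 2) → (Fin n → ℝ)} (hE : ∀ s t, B (E s) (E t) = nullGram s t)
include hE

theorem nullFrame_coeff (c : Fin 2 ⊕ Fin (n - 2) → ℝ) :
    B (E (.inl 1)) (∑ s, c s • E s) = c (.inl 0) ∧ B (E (.inl 0)) (∑ s, c s • E s) = c (.inl 1) ∧
      ∀ i, B (E (.inr i)) (∑ s, c s • E s) = c (.inr i) := by
  simp [hE, nullGram, Fintype.sum_sum_type]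

/-- Pairing with the second null vector reads off the coefficient of the first and conversely, so
the frame is independent; it spans because 2 + (n - 2) = n. -/
theorem nullFrame_expansion (hn : 2 ≤ n) (v : Fin n → ℝ) :
    v = B (E (.inl 1)) v • E (.inl 0) + B (E (.inl 0)) v • E (.inl 1) +
      ∑ i, B (E (.inr i)) v • E (.inr i) := by
  have hinj : Function.Injective (Fintype.linearCombination ℝ E) := by
    rw [← LinearMap.ker_eq_bot, LinearMap.ker_eq_bot']
    intro c hc
    rw [Fintype.linearCombination_apply] at hc
    obtain ⟨h0, h1, hi⟩ := nullFrame_coeff hE c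
    rw [hc] at h0 h1 hi
    simp only [map_zero] at h0 h1 hi
    funext s
    rcases s with s | i
    · fin_cases s
      · exact h0.symm
      · exact h1.symm
    · exact (hi i).symm
  have hsurj : Function.Surjective (Fintype.linearCombination ℝ E) := by
    refine (LinearMap.injective_iff_surjective_of_finrank_eq_finrank ?_).1 hinj
    simp only [Module.finrank_fintype_fun_eq_card, Fintype.card_sum, Fintype.card_fin]
    omega
  obtain ⟨c, rfl⟩ := hsurj v
  rw [Fintype.linearCombination_apply]
  obtain ⟨h0, h1, hi⟩ := nullFrame_coeff hE c
  rw [h0, h1]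
  simp only [hi]
  simp [Fintype.sum_sum_type]

/-- The trace of an endomorphism in terms of a null frame. -/
theorem nullFrame_trace (hn : 2 ≤ n) (T : (Fin n → ℝ) →L[ℝ] (Fin n → ℝ)) :
    ∑ a, T (Pi.single a 1) a = B (E (.inl 1)) (T (E (.inl 0))) + B (E (.inl 0)) (T (E (.inl 1))) +
      ∑ i, B (E (.inr i)) (T (E (.inr i))) := by
  have h1 : ∀ a, T (Pi.single a 1) a = (B (E (.inl 1)) (Pi.single a 1) * T (E (.inl 0)) a +
      B (E (.inl 0)) (Pi.single a 1) * T (E (.inl 1)) a +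
      ∑ i, B (E (.inr i)) (Pi.single a 1) * T (E (.inr i)) a) := by
    intro a
    conv_lhs => rw [nullFrame_expansion hE hn (Pi.single a 1)]
    simp [Finset.sum_apply]
  have h2 : ∀ (f : (Fin n → ℝ) →L[ℝ] ℝ) (v : Fin n → ℝ), ∑ a, f (Pi.single a 1) * v a = f v := by
    intro f v
    conv_rhs => rw [pi_eq_sum_univ' v]
    simp [mul_comm]
  rw [Finset.sum_congr rfl fun a _ => h1 a, Finset.sum_add_distrib, Finset.sum_add_distrib,
    Finset.sum_comm, h2, h2]
  simp only [h2]

end Frame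

/-- A vector orthogonal to the first vector of a null frame is spacelike or proportional to it. -/
theorem IsLorentzForm.form_nonneg (h : IsLorentzForm B) (hn : 2 ≤ n) {k v : Fin n → ℝ}
    (hk : k ≠ 0) (hnull : B k k = 0) (hv : B k v = 0) :
    0 ≤ B v v ∧ (B v v = 0 → ∃ c : ℝ, v = c • k) := by
  obtain ⟨E, hE0, hE⟩ := h.exists_nullFrame hn hk hnull
  have hexp := nullFrame_expansion hE hn v
  rw [hE0, hv, zero_smul, add_zero] at hexp
  have hsq : B v v = ∑ i, B (E (.inr i)) v ^ 2 := by
    conv_lhs => enter [2]; rw [hexp]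
    rw [map_add, map_smul, h.symm v k, hv, smul_zero, zero_add, map_sum]
    refine Finset.sum_congr rfl fun i _ => ?_
    rw [map_smul, h.symm v, smul_eq_mul, sq]
  refine ⟨hsq ▸ Finset.sum_nonneg fun i _ => sq_nonneg _, fun h0 => ⟨B (E (.inl 1)) v, ?_⟩⟩
  rw [hsq, Finset.sum_eq_zero_iff_of_nonneg fun i _ => sq_nonneg _] at h0
  conv_lhs => rw [hexp]
  rw [Finset.sum_eq_zero fun i hi => ?_, add_zero]
  rw [pow_eq_zero_iff two_ne_zero |>.1 (h0 i hi), zero_smul]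

/-- A vector orthogonal to everything orthogonal to `k` is a multiple of `k`. -/
theorem IsLorentzForm.exists_smul_of_orthogonal (h : IsLorentzForm B) (hn : 2 ≤ n)
    {k v : Fin n → ℝ} (hk : k ≠ 0) (hnull : B k k = 0) (hv : ∀ w, B k w = 0 → B v w = 0) :
    ∃ c : ℝ, v = c • k := by
  have h1 : B k v = 0 := by rw [h.symm]; exact hv k hnull
  exact (h.form_nonneg hn hk hnull h1).2 (hv v h1)

/-- `k` and the vectors of a screen span the orthogonal complement of `k`. -/
theorem IsLorentzForm.screen_span (h : IsLorentzForm B) (hn : 2 ≤ n) {k : Fin n → ℝ}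
    (hk : k ≠ 0) (hnull : B k k = 0) {m : Fin (n - 2) → (Fin n → ℝ)}
    (hkm : ∀ i, B k (m i) = 0) (hm : ∀ i j, B (m i) (m j) = if i = j then 1 else 0)
    {v : Fin n → ℝ} (hv : B k v = 0) : ∃ (c : ℝ) (d : Fin (n - 2) → ℝ),
      v = c • k + ∑ i, d i • m i := by
  obtain ⟨E, hE0, hE⟩ := h.exists_nullFrame hn hk hnull
  have hexp : ∀ w, B k w = 0 → w = B (E (.inl 1)) w • k + ∑ i, B (E (.inr i)) w • E (.inr i) := by
    intro w hw
    have := nullFrame_expansion hE hn w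
    rwa [hE0, hw, zero_smul, add_zero] at this
  -- Modulo k, the screen is a linear image of the spacelike part of the frame. As k is null and
  -- orthogonal to both, the matrix of this map is orthogonal and can be inverted by its transpose.
  set O : Matrix (Fin (n - 2)) (Fin (n - 2)) ℝ := Matrix.of fun i j => B (E (.inr j)) (m i) with hO
  have hOO : O * Oᵀ = 1 := by
    ext i j
    rw [Matrix.mul_apply, Matrix.one_apply, ← hm i j]
    conv_rhs => enter [2]; rw [hexp (m j) (hkm j)]
    rw [map_add, map_smul, h.symm (m i) k, hkm, smul_zero, zero_add, map_sum]
    refine Finset.sum_congr rfl fun l _ => ?_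
    rw [map_smul, h.symm (m i), smul_eq_mul, mul_comm]
    rfl
  have hOO' : Oᵀ * O = 1 := mul_eq_one_comm.1 hOO
  refine ⟨B (E (.inl 1)) v - ∑ i, (∑ j, B (E (.inr j)) v * O i j) * B (E (.inl 1)) (m i),
    fun i => ∑ j, B (E (.inr j)) v * O i j, ?_⟩
  have h1 : ∑ i, (∑ j, B (E (.inr j)) v * O i j) • m i =
      (∑ i, (∑ j, B (E (.inr j)) v * O i j) * B (E (.inl 1)) (m i)) • k +
      ∑ l, B (E (.inr l)) v • E (.inr l) := by
    have h2 : ∀ i, (∑ j, B (E (.inr j)) v * O i j) • m i =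
        ((∑ j, B (E (.inr j)) v * O i j) * B (E (.inl 1)) (m i)) • k +
        ∑ l, ((∑ j, B (E (.inr j)) v * O i j) * O i l) • E (.inr l) := by
      intro i
      conv_lhs => rw [hexp (m i) (hkm i)]
      rw [smul_add, smul_smul, Finset.smul_sum]
      simp only [smul_smul]
      rfl
    rw [Finset.sum_congr rfl fun i _ => h2 i, Finset.sum_add_distrib, Finset.sum_smul,
      Finset.sum_comm]
    congr 1
    refine Finset.sum_congr rfl fun l _ => ?_
    rw [← Finset.sum_smul]
    congr 1
    simp only [Finset.sum_mul]
    rw [Finset.sum_comm]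
    have h3 : ∀ j, ∑ i, B (E (.inr j)) v * O i j * O i l =
        B (E (.inr j)) v * (Oᵀ * O) j l := by
      intro j
      simp only [Matrix.mul_apply, Matrix.transpose_apply, Finset.mul_sum, mul_assoc]
    simp only [h3, hOO', Matrix.one_apply]
    simp
  rw [h1]
  conv_lhs => rw [hexp v hv]
  module

end NullFrames

/-! ### The coordinate expressions as multilinear maps -/

section Link

open Coordinates

variable {n : ℕ}

/-- The metric with components `G` as a field of bilinear forms. -/
def metricForm (G : (Fin n → ℝ) → Matrix (Fin n) (Fin n) ℝ) (x : Fin n → ℝ) :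
    (Fin n → ℝ) →L[ℝ] (Fin n → ℝ) →L[ℝ] ℝ :=
  ∑ a, ∑ b, G x a b • (ContinuousLinearMap.proj (R := ℝ) (φ := fun _ : Fin n => ℝ) a).smulRight
    (ContinuousLinearMap.proj (R := ℝ) (φ := fun _ : Fin n => ℝ) b)

/-- The Christoffel symbols of `G` as a field of bilinear maps. -/
def connForm (G : (Fin n → ℝ) → Matrix (Fin n) (Fin n) ℝ) (x : Fin n → ℝ) :
    (Fin n → ℝ) →L[ℝ] (Fin n → ℝ) →L[ℝ] (Fin n → ℝ) :=
  ∑ a, ∑ b, ∑ c, christoffel G a b c x •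
    (ContinuousLinearMap.proj (R := ℝ) (φ := fun _ : Fin n => ℝ) b).smulRight
      ((ContinuousLinearMap.proj (R := ℝ) (φ := fun _ : Fin n => ℝ) c).smulRight
        (Pi.single a 1 : Fin n → ℝ))

theorem metricForm_apply (G : (Fin n → ℝ) → Matrix (Fin n) (Fin n) ℝ) (x u v : Fin n → ℝ) :
    metricForm G x u v = ∑ a, ∑ b, G x a b * (u a * v b) := by
  simp [metricForm, sum_apply]

theorem metricForm_eq_ip (G : (Fin n → ℝ) → Matrix (Fin n) (Fin n) ℝ) (x u v : Fin n → ℝ) :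
    metricForm G x u v = ip G x u v := by
  rw [metricForm_apply, ip, dotProduct]
  refine Finset.sum_congr rfl fun a _ => ?_
  rw [Matrix.mulVec, dotProduct, Finset.mul_sum]
  exact Finset.sum_congr rfl fun b _ => by ring

theorem metricForm_single (G : (Fin n → ℝ) → Matrix (Fin n) (Fin n) ℝ) (x : Fin n → ℝ)
    (a b : Fin n) : metricForm G x (Pi.single a 1) (Pi.single b 1) = G x a b := by
  rw [metricForm_eq_ip, ip]
  simp

theorem connForm_apply (G : (Fin n → ℝ) → Matrix (Fin n) (Fin n) ℝ) (x u v : Fin n → ℝ)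
    (a : Fin n) : connForm G x u v a = ∑ b, ∑ c, christoffel G a b c x * (u b * v c) := by
  simp [connForm, sum_apply, Finset.sum_apply, Pi.single_apply]

theorem connForm_single_left (G : (Fin n → ℝ) → Matrix (Fin n) (Fin n) ℝ) (x v : Fin n → ℝ)
    (a b : Fin n) :
    connForm G x (Pi.single b 1) v a = ∑ c, christoffel G a b c x * v c := by
  rw [connForm_apply, Finset.sum_eq_single b (by intro d _ hd; simp [hd]) (by simp)]
  simp

theorem connForm_single (G : (Fin n → ℝ) → Matrix (Fin n) (Fin n) ℝ) (x : Fin n → ℝ)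
    (a b c : Fin n) :
    connForm G x (Pi.single b 1) (Pi.single c 1) a = christoffel G a b c x := by
  rw [connForm_single_left, Finset.sum_eq_single c (by intro d _ hd; simp [hd]) (by simp)]
  simp

/-- Used repeatedly, one argument at a time, to reduce multilinear identities to identities between
components. -/
theorem eq_of_isLinearMap_of_single {F : Type*} [AddCommGroup F] [Module ℝ F]
    {f g : (Fin n → ℝ) → F} (hf : IsLinearMap ℝ f) (hg : IsLinearMap ℝ g)
    (h : ∀ a, f (Pi.single a 1) = g (Pi.single a 1)) (u : Fin n → ℝ) : f u = g u := by
  have : hf.mk' f = hg.mk' g := by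
    refine LinearMap.pi_ext' fun a => LinearMap.ext_ring ?_
    simpa using h a
  exact DFunLike.congr_fun this u

/-- The components `G` of a Lorentzian metric are smooth on the open set `U`. -/
structure IsLorentzMetricOn (G : (Fin n → ℝ) → Matrix (Fin n) (Fin n) ℝ) (U : Set (Fin n → ℝ)) :
    Prop where
  isOpen : IsOpen U
  smooth : ∀ a b, ContDiffOn ℝ ∞ (fun x => G x a b) U
  lorentz : ∀ x ∈ U, IsLorentzForm (metricForm G x)

namespace IsLorentzMetricOn

variable {G : (Fin n → ℝ) → Matrix (Fin n) (Fin n) ℝ} {U : Set (Fin n → ℝ)} {x : Fin n → ℝ}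

theorem mono (h : IsLorentzMetricOn G U) {U' : Set (Fin n → ℝ)} (hU' : IsOpen U')
    (hsub : U' ⊆ U) : IsLorentzMetricOn G U' :=
  ⟨hU', fun a b => (h.smooth a b).mono hsub, fun x hx => h.lorentz x (hsub hx)⟩

theorem symm (h : IsLorentzMetricOn G U) (hx : x ∈ U) (a b : Fin n) : G x a b = G x b a := by
  rw [← metricForm_single G x a b, (h.lorentz x hx).symm, metricForm_single]

theorem isUnit_det (h : IsLorentzMetricOn G U) (hx : x ∈ U) : IsUnit (G x).det := by
  rw [isUnit_iff_ne_zero]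
  intro h0
  obtain ⟨v, hv, hv0⟩ := Matrix.exists_mulVec_eq_zero_iff.2 h0
  refine hv ((h.lorentz x hx).nondeg fun w => ?_)
  rw [(h.lorentz x hx).symm, metricForm_eq_ip, ip, hv0, dotProduct_zero]

theorem smooth_metricForm (h : IsLorentzMetricOn G U) : ContDiffOn ℝ ∞ (metricForm G) U := by
  unfold metricForm
  exact ContDiffOn.sum fun a _ => ContDiffOn.sum fun b _ => (h.smooth a b).smul contDiffOn_const

theorem smooth_det {ι : Type*} [Fintype ι] [DecidableEq ι] {M : (Fin n → ℝ) → Matrix ι ι ℝ}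
    (hM : ∀ a b, ContDiffOn ℝ ∞ (fun x => M x a b) U) :
    ContDiffOn ℝ ∞ (fun x => (M x).det) U := by
  simp only [Matrix.det_apply']
  exact ContDiffOn.sum fun σ _ => contDiffOn_const.mul (contDiffOn_prod fun i _ => hM _ _)

theorem smooth_inv (h : IsLorentzMetricOn G U) (a b : Fin n) :
    ContDiffOn ℝ ∞ (fun x => (G x)⁻¹ a b) U := by
  simp only [Matrix.inv_def, Matrix.smul_apply, Ring.inverse_eq_inv', smul_eq_mul,
    Matrix.adjugate_apply]
  refine ((smooth_det h.smooth).inv fun x hx => (h.isUnit_det hx).ne_zero).mul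
    (smooth_det fun c d => ?_)
  simp only [Matrix.updateRow_apply]
  split_ifs
  · exact contDiffOn_const
  · exact h.smooth c d

theorem smooth_pderiv (hU : IsOpen U) {f : (Fin n → ℝ) → ℝ} (hf : ContDiffOn ℝ ∞ f U) (a : Fin n) :
    ContDiffOn ℝ ∞ (pderiv a f) U :=
  (hf.fderiv_of_isOpen hU (m := ∞) (by norm_cast)).clm_apply contDiffOn_const

theorem smooth_christoffel (h : IsLorentzMetricOn G U) (a b c : Fin n) :
    ContDiffOn ℝ ∞ (christoffel G a b c) U := by
  unfold christoffel
  exact contDiffOn_const.mul (ContDiffOn.sum fun d _ => (h.smooth_inv a d).mul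
    (((smooth_pderiv h.isOpen (h.smooth _ _) _).add (smooth_pderiv h.isOpen (h.smooth _ _) _)).sub
      (smooth_pderiv h.isOpen (h.smooth _ _) _)))

theorem smooth_connForm (h : IsLorentzMetricOn G U) : ContDiffOn ℝ ∞ (connForm G) U := by
  unfold connForm
  exact ContDiffOn.sum fun a _ => ContDiffOn.sum fun b _ => ContDiffOn.sum fun c _ =>
    (h.smooth_christoffel a b c).smul contDiffOn_const

theorem pderiv_symm (h : IsLorentzMetricOn G U) (hx : x ∈ U) (a b c : Fin n) :
    pderiv c (fun y => G y a b) x = pderiv c (fun y => G y b a) x := by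
  unfold pderiv
  rw [Filter.EventuallyEq.fderiv_eq]
  filter_upwards [h.isOpen.mem_nhds hx] with y hy using h.symm hy a b

theorem christoffel_symm (h : IsLorentzMetricOn G U) (hx : x ∈ U) (a b c : Fin n) :
    christoffel G a b c x = christoffel G a c b x := by
  unfold christoffel
  congr 1
  refine Finset.sum_congr rfl fun d _ => ?_
  rw [h.pderiv_symm hx b c d]
  ring

theorem lower_christoffel (h : IsLorentzMetricOn G U) (hx : x ∈ U) (a b c : Fin n) :
    ∑ d, G x a d * christoffel G d b c x = 1 / 2 * (pderiv b (fun y => G y a c) x +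
      pderiv c (fun y => G y a b) x - pderiv a (fun y => G y b c) x) := by
  unfold christoffel
  have h1 : ∀ d, G x a d * (1 / 2 * ∑ e, (G x)⁻¹ d e * (pderiv b (fun y => G y e c) x +
      pderiv c (fun y => G y e b) x - pderiv e (fun y => G y b c) x)) =
      1 / 2 * ∑ e, (G x a d * (G x)⁻¹ d e) * (pderiv b (fun y => G y e c) x +
      pderiv c (fun y => G y e b) x - pderiv e (fun y => G y b c) x) := by
    intro d
    rw [Finset.mul_sum, Finset.mul_sum, Finset.mul_sum]
    exact Finset.sum_congr rfl fun e _ => by ring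
  rw [Finset.sum_congr rfl fun d _ => h1 d, ← Finset.mul_sum, Finset.sum_comm]
  congr 1
  simp only [← Finset.sum_mul, ← Matrix.mul_apply,
    Matrix.mul_nonsing_inv (G x) (h.isUnit_det hx), Matrix.one_apply]
  simp

theorem fderiv_metricForm (h : IsLorentzMetricOn G U) (hx : x ∈ U) (a b c : Fin n) :
    fderiv ℝ (metricForm G) x (Pi.single c 1) (Pi.single a 1) (Pi.single b 1) =
      pderiv c (fun y => G y a b) x := by
  have hd := (h.smooth_metricForm.contDiffAt (h.isOpen.mem_nhds hx)).differentiableAt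
    (by simp)
  have h1 := (hd.hasFDerivAt.clm_apply_const (Pi.single a 1)).clm_apply_const
    (Pi.single b (1 : ℝ))
  simp only [metricForm_single] at h1
  rw [pderiv, h1.fderiv]
  rfl

/-- The bridge from index formulas to the invariant calculus of connections on open sets; each axiom
is checked on basis vectors. -/
theorem isLeviCivitaOn (h : IsLorentzMetricOn G U) :
    IsLeviCivitaOn (metricForm G) (connForm G) U where
  isOpen := h.isOpen
  smooth_metric := h.smooth_metricForm
  smooth_conn := h.smooth_connForm
  symm x hx u v := (h.lorentz x hx).symm u v
  nondeg x hx u hu := (h.lorentz x hx).nondeg hu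
  torsion x hx u v := by
    funext a
    rw [connForm_apply, connForm_apply, Finset.sum_comm]
    refine Finset.sum_congr rfl fun b _ => Finset.sum_congr rfl fun c _ => ?_
    rw [h.christoffel_symm hx]; ring
  compat x hx u v w := by
    revert u
    refine eq_of_isLinearMap_of_single ⟨fun _ _ => by simp, fun _ _ => by simp⟩
      ⟨fun _ _ => by simp; ring, fun _ _ => by simp; ring⟩ fun c => ?_
    revert v
    refine eq_of_isLinearMap_of_single ⟨fun _ _ => by simp, fun _ _ => by simp⟩
      ⟨fun _ _ => by simp; ring, fun _ _ => by simp; ring⟩ fun a => ?_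
    revert w
    refine eq_of_isLinearMap_of_single ⟨fun _ _ => by simp, fun _ _ => by simp⟩
      ⟨fun _ _ => by simp; ring, fun _ _ => by simp; ring⟩ fun b => ?_
    rw [h.fderiv_metricForm hx]
    have h1 : ∀ a b, metricForm G x (Pi.single a 1) (connForm G x (Pi.single c 1)
        (Pi.single b 1)) = ∑ d, G x a d * christoffel G d c b x := by
      intro a b
      rw [metricForm_eq_ip, ip, single_dotProduct, one_mul, Matrix.mulVec, dotProduct]
      simp only [connForm_single]
    rw [(h.lorentz x hx).symm, h1, h1, h.lower_christoffel hx, h.lower_christoffel hx,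
      h.pderiv_symm hx b a, h.pderiv_symm hx c a, h.pderiv_symm hx b c]
    ring

end IsLorentzMetricOn

end Link

/-! ### Curvature in coordinates and in null frames -/

section CurvatureMap

variable {E : Type*} [NormedAddCommGroup E] [NormedSpace ℝ E]

/-- The curvature as a trilinear map. -/
def curvatureMap (Γ : E → E →L[ℝ] E →L[ℝ] E) (x : E) : E →L[ℝ] E →L[ℝ] E →L[ℝ] E :=
  fderiv ℝ Γ x - (fderiv ℝ Γ x).flip +
    (((ContinuousLinearMap.compL ℝ E (E →L[ℝ] E) (E →L[ℝ] E)).flip (Γ x)).comp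
      ((ContinuousLinearMap.compL ℝ E E E).comp (Γ x)) -
    (((ContinuousLinearMap.compL ℝ E (E →L[ℝ] E) (E →L[ℝ] E)).flip (Γ x)).comp
      ((ContinuousLinearMap.compL ℝ E E E).comp (Γ x))).flip)

theorem curvatureMap_apply (Γ : E → E →L[ℝ] E →L[ℝ] E) (x u v w : E) :
    curvatureMap Γ x u v w = curvature Γ x u v w := by
  simp [curvatureMap, curvature]
  abel

end CurvatureMap

section CoordinateCurvature

open Coordinates

variable {n : ℕ} {G : (Fin n → ℝ) → Matrix (Fin n) (Fin n) ℝ} {U : Set (Fin n → ℝ)}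
  {x : Fin n → ℝ}

namespace IsLorentzMetricOn

theorem fderiv_connForm (h : IsLorentzMetricOn G U) (hx : x ∈ U) (a b c d : Fin n) :
    fderiv ℝ (connForm G) x (Pi.single c 1) (Pi.single b 1) (Pi.single d 1) a =
      pderiv c (christoffel G a b d) x := by
  have h1 := ((h.isLeviCivitaOn.hasFDerivAt_conn hx).clm_apply_const (Pi.single b 1)).clm_apply_const
    (Pi.single d (1 : ℝ))
  have h2 := hasFDerivAt_pi'.1 h1 a
  simp only [connForm_single] at h2
  rw [pderiv, h2.fderiv]
  rfl

/-- This fixes the convention R^a_{bcd} = (R(∂_c, ∂_d)∂_b)^a: the last two lower indices are the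
arguments of the curvature operator. -/
theorem curvature_single (h : IsLorentzMetricOn G U) (hx : x ∈ U) (a b c d : Fin n) :
    curvature (connForm G) x (Pi.single c 1) (Pi.single d 1) (Pi.single b 1) a =
      riemannUp G a b c d x := by
  have hLC := h.isLeviCivitaOn
  rw [curvature, riemannUp, hLC.fderiv_conn_symm hx _ (Pi.single d 1),
    hLC.fderiv_conn_symm hx _ (Pi.single c 1)]
  simp only [Pi.sub_apply, Pi.add_apply]
  rw [h.fderiv_connForm hx, h.fderiv_connForm hx, connForm_single_left, connForm_single_left,
    Finset.sum_sub_distrib]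
  simp only [connForm_single, fun e => h.christoffel_symm hx e d b,
    fun e => h.christoffel_symm hx e c b]
  ring

theorem metricForm_single_left (G : (Fin n → ℝ) → Matrix (Fin n) (Fin n) ℝ) (x v : Fin n → ℝ)
    (a : Fin n) : metricForm G x (Pi.single a 1) v = ∑ b, G x a b * v b := by
  rw [metricForm_eq_ip, ip, single_dotProduct, one_mul, Matrix.mulVec, dotProduct]

theorem riemann_eq (h : IsLorentzMetricOn G U) (hx : x ∈ U) (a b c d : Fin n) :
    riemann G a b c d x = metricForm G x (Pi.single a 1)
      (curvatureMap (connForm G) x (Pi.single c 1) (Pi.single d 1) (Pi.single b 1)) := by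
  rw [metricForm_single_left, riemann]
  simp only [curvatureMap_apply, h.curvature_single hx]

end IsLorentzMetricOn

/-- `R_{ab} = 0` at `x`. -/
def RicciFlatAt (G : (Fin n → ℝ) → Matrix (Fin n) (Fin n) ℝ) (x : Fin n → ℝ) : Prop :=
  ∀ a b, ricci G a b x = 0

theorem clm_eq_sum {F : Type*} [NormedAddCommGroup F] [NormedSpace ℝ F]
    (L : (Fin n → ℝ) →L[ℝ] F) (v : Fin n → ℝ) : L v = ∑ a, v a • L (Pi.single a 1) := by
  conv_lhs => rw [pi_eq_sum_univ' v]
  simp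

namespace IsLorentzMetricOn

theorem sum_curvature (h : IsLorentzMetricOn G U) (hx : x ∈ U) (hR : RicciFlatAt G x)
    (u v : Fin n → ℝ) : ∑ a, curvature (connForm G) x (Pi.single a 1) u v a = 0 := by
  simp only [← curvatureMap_apply]
  revert u
  refine eq_of_isLinearMap_of_single ⟨fun _ _ => by simp [Finset.sum_add_distrib],
    fun _ _ => by simp [Finset.mul_sum]⟩ ⟨fun _ _ => by simp, fun _ _ => by simp⟩ fun d => ?_
  revert v
  refine eq_of_isLinearMap_of_single ⟨fun _ _ => by simp [Finset.sum_add_distrib],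
    fun _ _ => by simp [Finset.mul_sum]⟩ ⟨fun _ _ => by simp, fun _ _ => by simp⟩ fun b => ?_
  simp only [curvatureMap_apply, h.curvature_single hx]
  exact hR b d

theorem weyl_eq_riemann (hR : RicciFlatAt G x) (a b c d : Fin n) :
    weyl G a b c d x = riemann G a b c d x := by
  have hs : scalarCurv G x = 0 := by
    unfold scalarCurv
    simp [hR _ _]
  simp [weyl, hR _ _, hs]

/-- In vacuum the trace terms drop out and the Weyl tensor is the Riemann tensor. The slots are
reordered: the last pair feeds the operator, the first slot is paired by the metric. -/
theorem weylFrame_eq (h : IsLorentzMetricOn G U) (hx : x ∈ U) (hR : RicciFlatAt G x)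
    (E : Fin 2 ⊕ Fin (n - 2) → (Fin n → ℝ)) (s t u v : Fin 2 ⊕ Fin (n - 2)) :
    weylFrame G x E s t u v =
      metricForm G x (curvature (connForm G) x (E u) (E v) (E t)) (E s) := by
  rw [(h.lorentz x hx).symm, ← curvatureMap_apply, weylFrame]
  simp only [weyl_eq_riemann hR, h.riemann_eq hx]
  set g := metricForm G x
  set C := curvatureMap (connForm G) x
  have e1 := clm_eq_sum (g.flip (C (E u) (E v) (E t))) (E s)
  have e2 := fun a => clm_eq_sum ((g (Pi.single a 1)).comp (C (E u) (E v))) (E t)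
  have e3 := fun a b => clm_eq_sum
    ((g (Pi.single a 1)).comp ((C.flip (E v)).flip (Pi.single b 1))) (E u)
  have e4 := fun a b c => clm_eq_sum
    ((g (Pi.single a 1)).comp ((C (Pi.single c 1)).flip (Pi.single b 1))) (E v)
  simp only [ContinuousLinearMap.flip_apply, ContinuousLinearMap.comp_apply, smul_eq_mul]
    at e1 e2 e3 e4
  rw [e1]
  simp only [e2, e3, e4, Finset.mul_sum]
  refine Finset.sum_congr rfl fun a _ => Finset.sum_congr rfl fun b _ =>
    Finset.sum_congr rfl fun c _ => Finset.sum_congr rfl fun d _ => ?_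
  ring

theorem weylVanishes_iff (h : IsLorentzMetricOn G U) (hx : x ∈ U) (hR : RicciFlatAt G x) :
    WeylVanishes G x ↔ ∀ u v w, curvature (connForm G) x u v w = 0 := by
  constructor
  · intro hW u v w
    have hz : ∀ c d b, curvatureMap (connForm G) x (Pi.single c 1) (Pi.single d 1)
        (Pi.single b 1) = 0 := by
      intro c d b
      refine (h.lorentz x hx).nondeg fun z => ?_
      rw [(h.lorentz x hx).symm, ← ContinuousLinearMap.flip_apply, clm_eq_sum]
      refine Finset.sum_eq_zero fun a _ => ?_
      rw [ContinuousLinearMap.flip_apply, ← h.riemann_eq hx, ← weyl_eq_riemann hR, hW, smul_zero]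
    rw [← curvatureMap_apply, clm_eq_sum (curvatureMap (connForm G) x) u]
    simp only [sum_apply, smul_apply]
    refine Finset.sum_eq_zero fun c _ => ?_
    rw [clm_eq_sum (curvatureMap (connForm G) x (Pi.single c 1)) v]
    simp only [sum_apply, smul_apply]
    rw [Finset.sum_eq_zero fun d _ => ?_, smul_zero]
    rw [clm_eq_sum _ w, Finset.sum_eq_zero fun b _ => ?_, smul_zero]
    rw [hz, smul_zero]
  · intro hz a b c d
    rw [weyl_eq_riemann hR, h.riemann_eq hx, curvatureMap_apply, hz]; simp

end IsLorentzMetricOn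

/-- The curvature along the distribution orthogonal to `k` vanishes at `x`. -/
def LeafFlatAt (G : (Fin n → ℝ) → Matrix (Fin n) (Fin n) ℝ) (k x : Fin n → ℝ) : Prop :=
  ∀ u v, metricForm G x k u = 0 → metricForm G x k v = 0 →
    ∀ w, curvature (connForm G) x u v w = 0

/-- In vacuum, a metric whose curvature vanishes along the leaves of `k` is of type N. -/
theorem LeafFlatAt.weylFrame_eq_zero (h : IsLorentzMetricOn G U) (hx : x ∈ U)
    (hR : RicciFlatAt G x) (hn : 2 ≤ n) {E : Fin 2 ⊕ Fin (n - 2) → (Fin n → ℝ)}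
    (hE : IsNullFrame G x E) (hflat : LeafFlatAt G (E (.inl 0)) x) (s t u v : Fin 2 ⊕ Fin (n - 2))
    (hw : -2 < boostWeight s + boostWeight t + boostWeight u + boostWeight v) :
    weylFrame G x E s t u v = 0 := by
  have hE' : ∀ s t, metricForm G x (E s) (E t) = nullGram s t := fun s t => by
    rw [metricForm_eq_ip]; exact hE s t
  have hLC := h.isLeviCivitaOn
  set R : Fin 2 ⊕ Fin (n - 2) → Fin 2 ⊕ Fin (n - 2) → Fin 2 ⊕ Fin (n - 2) →
    Fin 2 ⊕ Fin (n - 2) → ℝ := fun u v t s =>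
      metricForm G x (curvature (connForm G) x (E u) (E v) (E t)) (E s) with hRdef
  have hperp : ∀ s, s ≠ .inl 1 → metricForm G x (E (.inl 0)) (E s) = 0 := by
    intro s hs
    rw [hE']
    rcases s with s | i
    · fin_cases s
      · simp [nullGram]
      · exact absurd rfl hs
    · rfl
  have hzero : ∀ u v t s, u ≠ .inl 1 → v ≠ .inl 1 → R u v t s = 0 := by
    intro u v t s hu hv
    simp only [hRdef, hflat _ _ (hperp u hu) (hperp v hv), map_zero, zero_apply]
  have hpair : ∀ u v t s, R u v t s = R t s u v := fun u v t s =>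
    hLC.curvature_pair_symm hx _ _ _ _
  have hsw : ∀ u v t s, R u v t s = -R v u t s := by
    intro u v t s
    simp only [hRdef]
    rw [IsLeviCivitaOn.curvature_swap]; simp
  have hsw' : ∀ u v t s, R u v t s = -R u v s t := fun u v t s => hLC.curvature_skew hx _ _ _ _
  -- In the null-frame trace for Ric(b, n), every term except the one with n as a curvature argument
  -- is a curvature along the leaf, hence zero; vacuum then kills the surviving term.
  have hric : ∀ b, b ≠ .inl 1 → R (.inl 1) b (.inl 1) (.inl 0) = 0 := by
    intro b hb
    have h1 := h.sum_curvature hx hR (E b) (E (.inl 1))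
    have h2 := nullFrame_trace hE' hn
      (((curvatureMap (connForm G) x).flip (E b)).flip (E (.inl 1)))
    simp only [ContinuousLinearMap.flip_apply, curvatureMap_apply, h1] at h2
    rw [hflat _ _ (hperp (.inl 0) (by simp)) (hperp b hb)] at h2
    have h3 : ∀ i, curvature (connForm G) x (E (.inr i)) (E b) (E (.inl 1)) = 0 := fun i =>
      hflat _ _ (hperp (.inr i) (by simp)) (hperp b hb) _
    simp only [h3, map_zero, Finset.sum_const_zero, add_zero, zero_add] at h2
    simp only [hRdef]
    rw [(h.lorentz x hx).symm, ← h2]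
  -- With a, b ≠ n, positive total weight forces one of them to be ℓ, which is the previous case up
  -- to pair symmetry.
  have hkey : ∀ a b, a ≠ .inl 1 → b ≠ .inl 1 → 0 < boostWeight a + boostWeight b →
      R (.inl 1) a (.inl 1) b = 0 := by
    intro a b ha hb hab
    have hcase : a = .inl 0 ∨ b = .inl 0 := by
      rcases a with a | i
      · fin_cases a
        · exact Or.inl rfl
        · exact absurd rfl ha
      · rcases b with b | j
        · fin_cases b
          · exact Or.inr rfl
          · exact absurd rfl hb
        · simp [boostWeight] at hab
    rcases hcase with rfl | rfl
    · rw [hpair]; exact hric b hb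
    · exact hric a ha
  rw [h.weylFrame_eq hx hR]
  change R u v t s = 0
  have hb1 : boostWeight (.inl 1 : Fin 2 ⊕ Fin (n - 2)) = -1 := by simp [boostWeight]
  -- A component can be nonzero only if each antisymmetric pair contains n exactly once. These are
  -- the components R(n, a, n, b), and weight above -2 means positive weight of a, b.
  by_cases hu : u = .inl 1 <;> by_cases hv : v = .inl 1
  · subst hu hv
    linarith [hsw (.inl 1) (.inl 1) t s]
  · subst hu
    by_cases ht : t = .inl 1 <;> by_cases hs : s = .inl 1
    · subst ht hs; linarith [hsw' (.inl 1) v (.inl 1) (.inl 1)]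
    · subst ht; exact hkey v s hv hs (by rw [hb1] at hw; linarith)
    · subst hs; rw [hsw', hkey v t hv ht (by rw [hb1] at hw; linarith), neg_zero]
    · rw [hpair]; exact hzero _ _ _ _ ht hs
  · subst hv
    rw [hsw]
    by_cases ht : t = .inl 1 <;> by_cases hs : s = .inl 1
    · subst ht hs; linarith [hsw' (.inl 1) u (.inl 1) (.inl 1)]
    · subst ht; rw [hkey u s hu hs (by rw [hb1] at hw; linarith), neg_zero]
    · subst hs; rw [hsw', hkey u t hu ht (by rw [hb1] at hw; linarith), neg_zero, neg_zero]
    · rw [hpair, hzero _ _ _ _ ht hs, neg_zero]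
  · exact hzero _ _ _ _ hu hv

/-- If the curvature is of type N and `k` is a null vector such that `R(u, v)k` is proportional to
`k` for `u` and `v` orthogonal to `k`, then the curvature along the leaves of `k` vanishes. -/
theorem leafFlatAt_of_typeN (h : IsLorentzMetricOn G U) (hx : x ∈ U)
    (hR : RicciFlatAt G x) (hn : 2 ≤ n) {E : Fin 2 ⊕ Fin (n - 2) → (Fin n → ℝ)}
    (hE : IsNullFrame G x E)
    (hN : ∀ s t u v, -2 < boostWeight s + boostWeight t + boostWeight u + boostWeight v →
      weylFrame G x E s t u v = 0) {k : Fin n → ℝ} (hk : k ≠ 0) (hnull : metricForm G x k k = 0)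
    (hprop : ∀ u v, metricForm G x k u = 0 → metricForm G x k v = 0 →
      ∃ c : ℝ, curvature (connForm G) x u v k = c • k) :
    LeafFlatAt G k x := by
  have hE' : ∀ s t, metricForm G x (E s) (E t) = nullGram s t := fun s t => by
    rw [metricForm_eq_ip]; exact hE s t
  have hLC := h.isLeviCivitaOn
  have hlor := h.lorentz x hx
  have hfsymm := hlor.symm
  set g := metricForm G x with hg
  set C := curvatureMap (connForm G) x with hC
  have hCa : ∀ u v w, curvature (connForm G) x u v w = C u v w := fun u v w =>
    (curvatureMap_apply _ _ _ _ _).symm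
  have hpair : ∀ u v w z, g (C u v w) z = g (C w z u) v := fun u v w z => by
    rw [← hCa, ← hCa]; exact hLC.curvature_pair_symm hx _ _ _ _
  have hsw : ∀ u v, C u v = -C v u := fun u v => by
    ext1 w
    rw [neg_apply, ← hCa, ← hCa, IsLeviCivitaOn.curvature_swap]
  have hsw' : ∀ u v w z, g (C u v w) z = -g (C u v z) w := fun u v w z => by
    rw [← hCa, ← hCa]; exact hLC.curvature_skew hx _ _ _ _
  have hcomp : ∀ u v t s, -2 < boostWeight s + boostWeight t + boostWeight u + boostWeight v →
      g (C (E u) (E v) (E t)) (E s) = 0 := by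
    intro u v t s hw
    rw [← hCa, ← h.weylFrame_eq hx hR]
    exact hN _ _ _ _ hw
  have hbw : ∀ s : Fin 2 ⊕ Fin (n - 2), s ≠ .inl 1 → 0 ≤ boostWeight s := by
    intro s hs
    rcases s with s | i
    · fin_cases s
      · simp [boostWeight]
      · exact absurd rfl hs
    · simp [boostWeight]
  have hbw' : ∀ s : Fin 2 ⊕ Fin (n - 2), -1 ≤ boostWeight s := by
    intro s
    by_cases hs : s = .inl 1
    · rw [hs]; simp [boostWeight]
    · linarith [hbw s hs]
  have hb1 : boostWeight (.inl 1 : Fin 2 ⊕ Fin (n - 2)) = -1 := by simp [boostWeight]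
  have hb0 : boostWeight (.inl 0 : Fin 2 ⊕ Fin (n - 2)) = 1 := by simp [boostWeight]
  have hvec : ∀ z : Fin n → ℝ, (∀ s, g z (E s) = 0) → z = 0 := by
    intro z hz
    rw [nullFrame_expansion hE' hn z]
    simp [hfsymm _ z, hz]
  have hmap : ∀ u v, (∀ t s, g (C u v (E t)) (E s) = 0) → C u v = 0 := by
    intro u v huv
    ext1 w
    rw [nullFrame_expansion hE' hn w]
    simp [fun t => hvec _ (huv t)]
  -- With u, v of weight at least 0, the total weight is at least -1 unless t = s = n, and that
  -- component vanishes by skewness.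
  have hleaf : ∀ u v, u ≠ .inl 1 → v ≠ .inl 1 → C (E u) (E v) = 0 := by
    intro u v hu hv
    refine hmap _ _ fun t s => ?_
    by_cases hts : t = .inl 1 ∧ s = .inl 1
    · rw [hts.1, hts.2]; linarith [hsw' (E u) (E v) (E (.inl 1)) (E (.inl 1))]
    · apply hcomp
      have h1 := hbw u hu
      have h2 := hbw v hv
      by_cases ht : t = .inl 1
      · have h3 := hbw s fun hs => hts ⟨ht, hs⟩
        have h4 := hbw' t
        linarith
      · have h3 := hbw t ht
        have h4 := hbw' s
        linarith
  have hnl : C (E (.inl 1)) (E (.inl 0)) = 0 := by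
    refine hmap _ _ fun t s => ?_
    by_cases ht : t = .inl 1
    · by_cases hs : s = .inl 1
      · rw [ht, hs]; linarith [hsw' (E (.inl 1)) (E (.inl 0)) (E (.inl 1)) (E (.inl 1))]
      · apply hcomp
        have := hbw s hs
        rw [ht, hb1, hb0]; linarith
    · by_cases hs : s = .inl 1
      · apply hcomp
        have := hbw t ht
        rw [hs, hb1, hb0]; linarith
      · rw [hpair, hleaf t s ht hs]; simp
  have hexp := nullFrame_expansion hE' hn
  have hleaf' : ∀ u v, g (E (.inl 0)) u = 0 → g (E (.inl 0)) v = 0 → C u v = 0 := by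
    intro u v hu hv
    rw [hexp u, hexp v, hu, hv]
    simp [hleaf]
  -- Orthogonal null vectors are proportional, so in the first case k spans the direction ℓ of the
  -- frame. In the second case k is transverse to ℓ, and the whole curvature is shown to vanish.
  by_cases hα : g (E (.inl 0)) k = 0
  · have hl0 : E (.inl 0) ≠ 0 := by
      intro h0
      have := hE' (.inl 0) (.inl 1)
      rw [h0] at this
      simp [nullGram] at this
    obtain ⟨c, hc⟩ := (hlor.form_nonneg hn hl0 (by rw [hE']; simp [nullGram]) hα).2 hnull
    have hc0 : c ≠ 0 := by rintro rfl; exact hk (by rw [hc, zero_smul])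
    intro u v hu hv w
    have : ∀ u, g k u = 0 → g (E (.inl 0)) u = 0 := by
      intro u hu
      rw [hc, map_smul, smul_apply, smul_eq_mul] at hu
      exact (mul_eq_zero.1 hu).resolve_left hc0
    rw [hCa, hleaf' u v (this u hu) (this v hv)]; rfl
  · set α := g (E (.inl 0)) k
    -- The screen vectors shifted along ℓ so as to be orthogonal to k as well as to ℓ.
    set Y : Fin (n - 2) → (Fin n → ℝ) := fun i =>
      E (.inr i) - (g k (E (.inr i)) / α) • E (.inl 0) with hY
    have hkl : g k (E (.inl 0)) = α := hfsymm _ _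
    have hYk : ∀ i, g k (Y i) = 0 := by
      intro i
      simp only [hY, map_sub, map_smul, hkl, smul_eq_mul]
      field_simp; ring
    have hYl : ∀ i, g (E (.inl 0)) (Y i) = 0 := by
      intro i
      simp [hY, hE', nullGram]
    have hCk : ∀ i, C k (Y i) = α • C (E (.inl 1)) (E (.inr i)) := by
      intro i
      have h1 : C (k - α • E (.inl 1)) (Y i) = 0 := by
        apply hleaf' _ _ _ (hYl i)
        simp [hE', nullGram, α]
      rw [map_sub C, sub_apply, sub_eq_zero, map_smul, smul_apply] at h1
      rw [h1]
      simp [hY, hnl]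
    -- The only components that type N leaves free. Proportionality of R(k, Y_i)k to k gives g(R(k,
    -- Y_i)k, Y_j) = 0, and this number is α² times the component.
    have hΩ : ∀ i j, g (C (E (.inl 1)) (E (.inr i)) (E (.inl 1))) (E (.inr j)) = 0 := by
      intro i j
      obtain ⟨c, hc⟩ := hprop k (Y i) hnull (hYk i)
      have h1 : g (C k (Y i) k) (Y j) = 0 := by
        rw [← hCa, hc, map_smul, smul_apply, hYk, smul_zero]
      rw [hCk, smul_apply, map_smul, smul_apply, hpair, hCk, smul_apply, map_smul, smul_apply,
        smul_eq_mul, smul_eq_mul, hpair] at h1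
      simpa [hα] using h1
    have hnm : ∀ i, C (E (.inl 1)) (E (.inr i)) = 0 := by
      intro i
      refine hmap _ _ fun t s => ?_
      rcases t with t | j <;> rcases s with s | l
      · fin_cases t <;> fin_cases s
        · rw [hpair]; change g (C (E (.inl 0)) (E (.inl 0)) _) _ = 0
          rw [hleaf' _ _ (by simp [hE', nullGram]) (by simp [hE', nullGram])]; simp
        · rw [hpair]; change g (C (E (.inl 0)) (E (.inl 1)) _) _ = 0
          rw [hsw, hnl]; simp
        · rw [hpair]; change g (C (E (.inl 1)) (E (.inl 0)) _) _ = 0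
          rw [hnl]; simp
        · rw [hpair]; change g (C (E (.inl 1)) (E (.inl 1)) _) _ = 0
          have := hsw' (E (.inl 1)) (E (.inr i)) (E (.inl 1)) (E (.inl 1))
          rw [hpair] at this; linarith
      · fin_cases t
        · rw [hpair]; change g (C (E (.inl 0)) (E (.inr l)) _) _ = 0
          rw [hleaf _ _ (by simp) (by simp)]; simp
        · exact hΩ i l
      · fin_cases s
        · rw [hpair]; change g (C (E (.inr j)) (E (.inl 0)) _) _ = 0
          rw [hleaf _ _ (by simp) (by simp)]; simp
        · rw [hsw']; exact neg_eq_zero.2 (hΩ i j)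
      · rw [hpair, hleaf _ _ (by simp) (by simp)]; simp
    intro u v _ _ w
    have hl : ∀ v, g (E (.inl 0)) v = 0 → C (E (.inl 1)) v = 0 := by
      intro v hv
      rw [hexp v, hv]
      simp [hnl, hnm]
    have hperp : ∀ u, g (E (.inl 0)) (u - g (E (.inl 0)) u • E (.inl 1)) = 0 := by
      intro u; simp [hE', nullGram]
    have hself : C (E (.inl 1)) (E (.inl 1)) = 0 := by
      have := hsw (E (.inl 1)) (E (.inl 1))
      rwa [eq_neg_iff_add_eq_zero, ← two_smul ℝ, smul_eq_zero_iff_right two_ne_zero] at this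
    have h1 : ∀ v, C (E (.inl 1)) v = 0 := by
      intro v
      have := hl _ (hperp v)
      rw [map_sub, map_smul, hself, smul_zero, sub_zero] at this
      exact this
    have h2 : C u v = 0 := by
      have e := hleaf' _ _ (hperp u) (hperp v)
      have e2 : C (u - g (E (.inl 0)) u • E (.inl 1)) (E (.inl 1)) = 0 := by
        rw [hsw, h1, neg_zero]
      rw [map_sub, map_smul, e2, smul_zero, sub_zero, map_sub, map_smul, sub_apply, smul_apply,
        h1, smul_zero, sub_zero] at e
      exact e
    rw [hCa, h2]; rfl

end CoordinateCurvature

/-! ### Covariant derivatives and the Kundt condition -/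

section CovariantDeriv

variable {E : Type*} [NormedAddCommGroup E] [NormedSpace ℝ E]

/-- The covariant derivative `u ↦ ∇_u K` as a linear map. -/
def covDerivMap (Γ : E → E →L[ℝ] E →L[ℝ] E) (K : E → E) (x : E) : E →L[ℝ] E :=
  fderiv ℝ K x + (Γ x).flip (K x)

theorem covDerivMap_apply (Γ : E → E →L[ℝ] E →L[ℝ] E) (K : E → E) (x u : E) :
    covDerivMap Γ K x u = covariantDeriv Γ K x u := by
  simp [covDerivMap, covariantDeriv]

theorem IsLeviCivitaOn.inner_covariantDeriv {g : E → E →L[ℝ] E →L[ℝ] ℝ}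
    {Γ : E → E →L[ℝ] E →L[ℝ] E} {U : Set E} {x : E} (h : IsLeviCivitaOn g Γ U) (hx : x ∈ U)
    {K : E → E} (hK : DifferentiableAt ℝ K x) (hnull : ∀ y ∈ U, g y (K y) (K y) = 0) (u : E) :
    g x (K x) (covariantDeriv Γ K x u) = 0 := by
  have h1 := ((h.hasFDerivAt_metric hx).clm_apply hK.hasFDerivAt).clm_apply hK.hasFDerivAt
  have h2 : HasFDerivAt (fun y => g y (K y) (K y)) (0 : E →L[ℝ] ℝ) x :=
    (hasFDerivAt_const (0 : ℝ) x).congr_of_eventuallyEq (by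
      filter_upwards [h.isOpen.mem_nhds hx] with y hy using hnull y hy)
  have h3 := DFunLike.congr_fun (h1.unique h2) u
  simp only [add_apply, ContinuousLinearMap.coe_comp, Function.comp_apply,
    ContinuousLinearMap.flip_apply, zero_apply, h.compat x hx] at h3
  rw [covariantDeriv, map_add]
  have e1 := h.symm x hx (K x) (fderiv ℝ K x u)
  have e2 := h.symm x hx (K x) (Γ x u (K x))
  linarith

end CovariantDeriv

section Kundt

open Coordinates

variable {n : ℕ} {G : (Fin n → ℝ) → Matrix (Fin n) (Fin n) ℝ} {U : Set (Fin n → ℝ)}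
  {K : (Fin n → ℝ) → (Fin n → ℝ)} {x : Fin n → ℝ}

theorem covDeriv_eq (hK : DifferentiableAt ℝ K x) (a b : Fin n) :
    covDeriv G K a b x = covDerivMap (connForm G) K x (Pi.single b 1) a := by
  rw [covDeriv, covDerivMap_apply, covariantDeriv, Pi.add_apply, connForm_single_left, pderiv,
    (hasFDerivAt_pi'.1 hK.hasFDerivAt a).fderiv]
  rfl

theorem optical_eq (hK : DifferentiableAt ℝ K x) (m : Fin (n - 2) → (Fin n → ℝ))
    (i j : Fin (n - 2)) :
    optical G K x m i j = metricForm G x (m i) (covDerivMap (connForm G) K x (m j)) := by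
  rw [clm_eq_sum (covDerivMap (connForm G) K x) (m j), metricForm_apply, optical]
  refine Finset.sum_congr rfl fun a _ => ?_
  simp only [covDerivLow, covDeriv_eq hK, Finset.sum_apply, Pi.smul_apply, smul_eq_mul,
    Finset.sum_mul, Finset.mul_sum]
  rw [Finset.sum_comm]
  exact Finset.sum_congr rfl fun c _ => Finset.sum_congr rfl fun b _ => by ring

theorem isGeodeticAt_iff (hK : DifferentiableAt ℝ K x) :
    IsGeodeticAt G K x ↔ ∃ c : ℝ, covDerivMap (connForm G) K x (K x) = c • K x := by
  rw [clm_eq_sum (covDerivMap (connForm G) K x) (K x)]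
  simp only [IsGeodeticAt, funext_iff, covDeriv_eq hK, Finset.sum_apply, Pi.smul_apply, smul_eq_mul]

theorem isScreen_iff (m : Fin (n - 2) → (Fin n → ℝ)) :
    IsScreen G K x m ↔ (∀ i, metricForm G x (K x) (m i) = 0) ∧
      ∀ i j, metricForm G x (m i) (m j) = if i = j then 1 else 0 := by
  simp only [IsScreen, metricForm_eq_ip]

/-- The frame-independent form of the Kundt condition: `K` is recurrent along its orthogonal
complement. -/
def IsKundtAt (G : (Fin n → ℝ) → Matrix (Fin n) (Fin n) ℝ) (K : (Fin n → ℝ) → (Fin n → ℝ))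
    (x : Fin n → ℝ) : Prop :=
  ∀ u, metricForm G x (K x) u = 0 → ∃ c : ℝ, covDerivMap (connForm G) K x u = c • K x

theorem IsKundtAt.optical_eq_zero (hL : IsLorentzForm (metricForm G x))
    (hK : DifferentiableAt ℝ K x)
    (h : IsKundtAt G K x) {m : Fin (n - 2) → (Fin n → ℝ)} (hm : IsScreen G K x m)
    (i j : Fin (n - 2)) : optical G K x m i j = 0 := by
  rw [isScreen_iff] at hm
  obtain ⟨c, hc⟩ := h (m j) (hm.1 j)
  rw [optical_eq hK, hc, map_smul, hL.symm, hm.1, smul_zero]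

theorem exists_isScreen (hL : IsLorentzForm (metricForm G x)) (hn : 2 ≤ n) (h0 : K x ≠ 0)
    (hnull : metricForm G x (K x) (K x) = 0) : ∃ m, IsScreen G K x m := by
  obtain ⟨E, hE0, hE⟩ := hL.exists_nullFrame hn h0 hnull
  refine ⟨fun i => E (.inr i), (isScreen_iff _).2 ⟨fun i => ?_, fun i j => ?_⟩⟩
  · rw [← hE0, hE]; rfl
  · rw [hE]; rfl

/-- Vanishing expansion, shear and twist are vanishing sums of squares, so the optical matrix is
zero. As ∇K is orthogonal to K, ∇K along a screen vector is orthogonal to all of the complement of K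
and so a multiple of K; the geodetic condition supplies the direction K itself. Conversely,
multiples of K pair to zero with a screen. -/
theorem kundt_iff (hG : IsLorentzMetricOn G U) (hx : x ∈ U) (hn : 2 ≤ n)
    (hK : DifferentiableAt ℝ K x) (h0 : K x ≠ 0)
    (hnull : ∀ y ∈ U, metricForm G y (K y) (K y) = 0) :
    (IsGeodeticAt G K x ∧ ∀ m, IsScreen G K x m →
      expansion G K x m = 0 ∧ shearSq G K x m = 0 ∧ twistSq G K x m = 0) ↔ IsKundtAt G K x := by
  have hL := hG.lorentz x hx
  constructor
  · rintro ⟨hgeo, hopt⟩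
    obtain ⟨c₀, hc₀⟩ := (isGeodeticAt_iff hK).1 hgeo
    obtain ⟨m, hm⟩ := exists_isScreen hL hn h0 (hnull x hx)
    obtain ⟨hexp, hsh, htw⟩ := hopt m hm
    have hzero : ∀ i j, optical G K x m i j = 0 := by
      rw [shearSq, hexp] at hsh
      rw [twistSq] at htw
      have h1 : ∀ f : Fin (n - 2) → Fin (n - 2) → ℝ, ∑ i, ∑ j, f i j ^ 2 = 0 → ∀ i j, f i j = 0 := by
        intro f hf i j
        rw [Finset.sum_eq_zero_iff_of_nonneg
          (fun i _ => Finset.sum_nonneg fun j _ => sq_nonneg _)] at hf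
        have := hf i (Finset.mem_univ _)
        rw [Finset.sum_eq_zero_iff_of_nonneg (fun j _ => sq_nonneg _)] at this
        exact pow_eq_zero_iff two_ne_zero |>.1 (this j (Finset.mem_univ _))
      intro i j
      have e1 := h1 (fun i j => (optical G K x m i j + optical G K x m j i) / 2)
        (by simpa using hsh) i j
      have e2 := h1 (fun i j => (optical G K x m i j - optical G K x m j i) / 2) htw i j
      linarith
    rw [isScreen_iff] at hm
    have hperp : ∀ u, metricForm G x (K x) (covDerivMap (connForm G) K x u) = 0 := fun u => by
      rw [covDerivMap_apply]
      exact hG.isLeviCivitaOn.inner_covariantDeriv hx hK hnull u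
    have hmj : ∀ j, ∃ c : ℝ, covDerivMap (connForm G) K x (m j) = c • K x := by
      intro j
      refine hL.exists_smul_of_orthogonal hn h0 (hnull x hx) fun z hz => ?_
      obtain ⟨c, d, rfl⟩ := hL.screen_span hn h0 (hnull x hx) hm.1 hm.2 hz
      rw [hL.symm, map_add, map_smul, map_sum, add_apply, smul_apply, hperp, smul_zero, zero_add,
        sum_apply]
      refine Finset.sum_eq_zero fun i _ => ?_
      rw [map_smul, smul_apply, ← optical_eq hK, hzero, smul_zero]
    choose c hc using hmj
    intro u hu
    obtain ⟨a, d, rfl⟩ := hL.screen_span hn h0 (hnull x hx) hm.1 hm.2 hu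
    refine ⟨a * c₀ + ∑ i, d i * c i, ?_⟩
    rw [map_add, map_smul, map_sum, hc₀, add_smul, Finset.sum_smul, smul_smul]
    simp only [map_smul, hc, smul_smul]
  · intro h
    refine ⟨(isGeodeticAt_iff hK).2 (h _ (hnull x hx)), fun m hm => ?_⟩
    simp [expansion, shearSq, twistSq, h.optical_eq_zero hL hK hm]

end Kundt

/-! ### Charts of a Lorentzian manifold -/

section Charts

open Coordinates IsManifold

variable {n : ℕ} {M : Type*} [TopologicalSpace M] [ChartedSpace (Fin n → ℝ) M]
  {e e' : OpenPartialHomeomorph M (Fin n → ℝ)}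

theorem mdifferentiable_of_mem_maximalAtlas (he : e ∈ maximalAtlas 𝓘(ℝ, Fin n → ℝ) ∞ M) :
    e.MDifferentiable 𝓘(ℝ, Fin n → ℝ) 𝓘(ℝ, Fin n → ℝ) :=
  ⟨(contMDiffOn_of_mem_maximalAtlas he).mdifferentiableOn (by simp),
    (contMDiffOn_symm_of_mem_maximalAtlas he).mdifferentiableOn (by simp)⟩

theorem mfderiv_mfderiv_symm (he : e ∈ maximalAtlas 𝓘(ℝ, Fin n → ℝ) ∞ M) {x : Fin n → ℝ}
    (hx : x ∈ e.target) (u : Fin n → ℝ) :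
    (mfderiv 𝓘(ℝ, Fin n → ℝ) 𝓘(ℝ, Fin n → ℝ) e (e.symm x)
      (mfderiv 𝓘(ℝ, Fin n → ℝ) 𝓘(ℝ, Fin n → ℝ) e.symm x u) : Fin n → ℝ) = u :=
  DFunLike.congr_fun ((mdifferentiable_of_mem_maximalAtlas he).comp_symm_deriv hx) u

theorem mfderiv_symm_mfderiv (he : e ∈ maximalAtlas 𝓘(ℝ, Fin n → ℝ) ∞ M) {x : Fin n → ℝ}
    (hx : x ∈ e.target) (u : TangentSpace 𝓘(ℝ, Fin n → ℝ) (e.symm x)) :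
    mfderiv 𝓘(ℝ, Fin n → ℝ) 𝓘(ℝ, Fin n → ℝ) e.symm x
      (mfderiv 𝓘(ℝ, Fin n → ℝ) 𝓘(ℝ, Fin n → ℝ) e (e.symm x) u) = u := by
  have := DFunLike.congr_fun ((mdifferentiable_of_mem_maximalAtlas he).symm_comp_deriv
    (e.map_target hx)) u
  rw [ContinuousLinearMap.comp_apply] at this
  rw [e.right_inv hx] at this
  exact this

/-- The tangent vector `u` at `x` in the chart `e`, as a tangent vector of `M`. -/
def chartVector (e : OpenPartialHomeomorph M (Fin n → ℝ)) (x u : Fin n → ℝ) :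
    TangentSpace 𝓘(ℝ, Fin n → ℝ) (e.symm x) :=
  mfderiv 𝓘(ℝ, Fin n → ℝ) 𝓘(ℝ, Fin n → ℝ) e.symm x u

theorem chartVector_add (e : OpenPartialHomeomorph M (Fin n → ℝ)) (x u v : Fin n → ℝ) :
    chartVector e x (u + v) = chartVector e x u + chartVector e x v :=
  map_add (mfderiv 𝓘(ℝ, Fin n → ℝ) 𝓘(ℝ, Fin n → ℝ) e.symm x) u v

theorem chartVector_smul (e : OpenPartialHomeomorph M (Fin n → ℝ)) (x : Fin n → ℝ) (c : ℝ)
    (u : Fin n → ℝ) : chartVector e x (c • u) = c • chartVector e x u :=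
  map_smul (mfderiv 𝓘(ℝ, Fin n → ℝ) 𝓘(ℝ, Fin n → ℝ) e.symm x) c u

namespace LorentzMetric

theorem metricForm_inChart (g : LorentzMetric n M) (e : OpenPartialHomeomorph M (Fin n → ℝ))
    (x u v : Fin n → ℝ) :
    metricForm (g.inChart e) x u v = g.val (e.symm x) (chartVector e x u) (chartVector e x v) := by
  revert u
  refine eq_of_isLinearMap_of_single ⟨fun _ _ => by simp, fun _ _ => by simp⟩
    ⟨fun _ _ => by simp [chartVector_add], fun _ _ => by simp [chartVector_smul]⟩ fun a => ?_
  revert v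
  refine eq_of_isLinearMap_of_single ⟨fun _ _ => by simp, fun _ _ => by simp⟩
    ⟨fun _ _ => by simp [chartVector_add], fun _ _ => by simp [chartVector_smul]⟩ fun b => ?_
  rw [metricForm_single]
  rfl

theorem isLorentzMetricOn (g : LorentzMetric n M) (he : e ∈ maximalAtlas 𝓘(ℝ, Fin n → ℝ) ∞ M) :
    IsLorentzMetricOn (g.inChart e) e.target where
  isOpen := e.open_target
  smooth a b := g.smooth e he a b
  lorentz x hx := by
    obtain ⟨b, hb⟩ := g.signature (e.symm x)
    let D : TangentSpace 𝓘(ℝ, Fin n → ℝ) (e.symm x) ≃ₗ[ℝ] (Fin n → ℝ) :=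
      { toFun := fun u => (mfderiv 𝓘(ℝ, Fin n → ℝ) 𝓘(ℝ, Fin n → ℝ) e (e.symm x) u :)
        map_add' := fun u v => map_add _ u v
        map_smul' := fun c u => map_smul _ c u
        invFun := fun u => chartVector e x u
        left_inv := fun u => mfderiv_symm_mfderiv he hx u
        right_inv := fun u => mfderiv_mfderiv_symm he hx u }
    refine ⟨(b.equivFun.symm.trans D).toContinuousLinearEquiv, fun u v => ?_⟩
    rw [g.metricForm_inChart]
    have hD : ∀ u, chartVector e x ((b.equivFun.symm.trans D).toContinuousLinearEquiv u) =
        ∑ i, u i • b i := fun u => by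
      rw [← b.equivFun_symm_apply]
      exact D.left_inv _
    rw [hD, hD, dotProduct]
    simp only [map_sum, map_smul, LinearMap.sum_apply, LinearMap.smul_apply, hb, smul_eq_mul,
      Matrix.mulVec, dotProduct, Finset.mul_sum]
    rw [Finset.sum_comm]
    exact Finset.sum_congr rfl fun _ _ => Finset.sum_congr rfl fun _ _ => by ring

end LorentzMetric

/-- The domain of the change of coordinates from `e` to `e'`. -/
def overlap (e e' : OpenPartialHomeomorph M (Fin n → ℝ)) : Set (Fin n → ℝ) :=
  e.target ∩ e.symm ⁻¹' e'.source

omit [ChartedSpace (Fin n → ℝ) M] in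
theorem isOpen_overlap (e e' : OpenPartialHomeomorph M (Fin n → ℝ)) : IsOpen (overlap e e') :=
  e.isOpen_inter_preimage_symm e'.open_source

omit [ChartedSpace (Fin n → ℝ) M] in
theorem mem_overlap {p : M} (hp : p ∈ e.source) (hp' : p ∈ e'.source) : e p ∈ overlap e e' :=
  ⟨e.map_source hp, by simpa [e.left_inv hp] using hp'⟩

section Transition

variable (he : e ∈ maximalAtlas 𝓘(ℝ, Fin n → ℝ) ∞ M)
  (he' : e' ∈ maximalAtlas 𝓘(ℝ, Fin n → ℝ) ∞ M)
include he he'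

theorem contDiffOn_transition : ContDiffOn ℝ ∞ (e' ∘ e.symm) (overlap e e') := by
  rw [← contMDiffOn_iff_contDiffOn]
  exact ((contMDiffOn_of_mem_maximalAtlas he').comp
    ((contMDiffOn_symm_of_mem_maximalAtlas he).mono inter_subset_left) fun x hx => hx.2)

theorem fderiv_transition {x : Fin n → ℝ} (hx : x ∈ overlap e e') (u : Fin n → ℝ) :
    fderiv ℝ (e' ∘ e.symm) x u =
      (mfderiv 𝓘(ℝ, Fin n → ℝ) 𝓘(ℝ, Fin n → ℝ) e' (e.symm x) (chartVector e x u) :) := by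
  rw [← mfderiv_eq_fderiv, mfderiv_comp x
    ((mdifferentiable_of_mem_maximalAtlas he').mdifferentiableAt hx.2)
    ((mdifferentiable_of_mem_maximalAtlas he).mdifferentiableAt_symm hx.1)]
  rfl

theorem vectorInChart_transition (k : ∀ p : M, TangentSpace 𝓘(ℝ, Fin n → ℝ) p) {x : Fin n → ℝ}
    (hx : x ∈ overlap e e') :
    vectorInChart k e' ((e' ∘ e.symm) x) = fderiv ℝ (e' ∘ e.symm) x (vectorInChart k e x) := by
  rw [fderiv_transition he he' hx, chartVector, vectorInChart, vectorInChart,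
    mfderiv_symm_mfderiv he hx.1, Function.comp_apply, e'.left_inv hx.2]

theorem fderiv_transition_transition {x : Fin n → ℝ} (hx : x ∈ overlap e e') (u : Fin n → ℝ) :
    fderiv ℝ (e' ∘ e.symm) x (fderiv ℝ (e ∘ e'.symm) ((e' ∘ e.symm) x) u) = u := by
  have h1 : (e' ∘ e.symm) x ∈ overlap e' e :=
    ⟨e'.map_source hx.2, by simpa [e'.left_inv hx.2] using e.map_target hx.1⟩
  have hd1 := ((contDiffOn_transition he' he).contDiffAt
    ((isOpen_overlap e' e).mem_nhds h1)).differentiableAt (by simp)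
  have hxx : (e ∘ e'.symm) ((e' ∘ e.symm) x) = x := by
    simp [e'.left_inv hx.2, e.right_inv hx.1]
  have hd2 := ((contDiffOn_transition he he').contDiffAt
    ((isOpen_overlap e e').mem_nhds hx)).differentiableAt (by simp)
  rw [← hxx] at hd2
  have h2 := hd2.hasFDerivAt.comp _ hd1.hasFDerivAt
  have h3 : HasFDerivAt ((e' ∘ e.symm) ∘ (e ∘ e'.symm)) (ContinuousLinearMap.id ℝ (Fin n → ℝ))
      ((e' ∘ e.symm) x) :=
    (hasFDerivAt_id _).congr_of_eventuallyEq (by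
      filter_upwards [(isOpen_overlap e' e).mem_nhds h1] with y hy
      simp [e.left_inv hy.2, e'.right_inv hy.1])
  have h4 := DFunLike.congr_fun (h2.unique h3) u
  rw [hxx] at h4
  exact h4

theorem LorentzMetric.isLocalIsometryOn (g : LorentzMetric n M) :
    IsLocalIsometryOn (metricForm (g.inChart e)) (metricForm (g.inChart e')) (e' ∘ e.symm)
      (overlap e e') e'.target where
  smooth := contDiffOn_transition he he'
  mapsTo x hx := e'.map_source hx.2
  surj x hx u := ⟨_, fderiv_transition_transition he he' hx u⟩
  metric x hx u v := by
    rw [g.metricForm_inChart, g.metricForm_inChart]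
    -- The two base points are equal only propositionally, so the bilinear forms live on different
    -- tangent spaces; this transports them, reading the vectors as elements of the common model
    -- space.
    have key : ∀ (p q : M) (_ : p = q) (u v : Fin n → ℝ) (u' v' : Fin n → ℝ), u = u' → v = v' →
        g.val p u v = g.val q u' v' := by
      rintro p q rfl u v u' v' rfl rfl
      rfl
    have hD : ∀ u, (chartVector e x u : Fin n → ℝ) =
        chartVector e' ((e' ∘ e.symm) x) (fderiv ℝ (e' ∘ e.symm) x u) := by
      intro u
      rw [fderiv_transition he he' hx]
      have := DFunLike.congr_fun ((mdifferentiable_of_mem_maximalAtlas he').symm_comp_deriv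
        hx.2) (chartVector e x u)
      exact this.symm
    exact key _ _ (by simp [e'.left_inv hx.2]) _ _ _ _ (hD u) (hD v)

end Transition

/-- Composing a chart with a diffeomorphism of open sets of `ℝⁿ` yields a chart. -/
theorem trans_mem_maximalAtlas [IsManifold 𝓘(ℝ, Fin n → ℝ) ∞ M]
    (he : e ∈ maximalAtlas 𝓘(ℝ, Fin n → ℝ) ∞ M)
    {h : OpenPartialHomeomorph (Fin n → ℝ) (Fin n → ℝ)} (hh : ContDiffOn ℝ ∞ h h.source)
    (hh' : ContDiffOn ℝ ∞ h.symm h.target) :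
    e.trans h ∈ maximalAtlas 𝓘(ℝ, Fin n → ℝ) ∞ M := by
  refine OpenPartialHomeomorph.mem_maximalAtlas_of_contMDiffOn _ ?_ ?_
  · exact (contMDiffOn_iff_contDiffOn.2 hh).comp
      ((contMDiffOn_of_mem_maximalAtlas he).mono fun x hx => hx.1) fun x hx => hx.2
  · exact (contMDiffOn_symm_of_mem_maximalAtlas he).comp
      ((contMDiffOn_iff_contDiffOn.2 hh').mono fun x hx => hx.1) fun x hx => hx.2

end Charts

/-! ### The Ricci identity and the curvature of a recurrent null field -/

section CurvatureOfField

variable {E : Type*} [NormedAddCommGroup E] [NormedSpace ℝ E]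
  {g : E → E →L[ℝ] E →L[ℝ] ℝ} {Γ : E → E →L[ℝ] E →L[ℝ] E} {U : Set E} {x : E} {K : E → E}

namespace IsLeviCivitaOn

theorem differentiableAt_covDerivMap (h : IsLeviCivitaOn g Γ U) (hx : x ∈ U)
    (hK : ContDiffOn ℝ ∞ K U) : DifferentiableAt ℝ (covDerivMap Γ K) x := by
  have hKx := hK.contDiffAt (h.isOpen.mem_nhds hx)
  have h1 : DifferentiableAt ℝ (fderiv ℝ K) x :=
    (hKx.fderiv_right (m := 1) (by norm_cast)).differentiableAt one_ne_zero
  have h2 : DifferentiableAt ℝ (fun y => (Γ y).flip) x :=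
    (ContinuousLinearMap.flipₗᵢ ℝ E E E).toContinuousLinearEquiv.differentiableAt.comp x
      (h.hasFDerivAt_conn hx).differentiableAt
  exact h1.add (h2.clm_apply (hKx.differentiableAt (by simp)))

/-- The Ricci identity. -/
theorem curvature_field (h : IsLeviCivitaOn g Γ U) (hx : x ∈ U) (hK : ContDiffOn ℝ ∞ K U)
    (u v : E) : curvature Γ x u v (K x) =
      fderiv ℝ (covDerivMap Γ K) x u v + Γ x u (covDerivMap Γ K x v)
      - (fderiv ℝ (covDerivMap Γ K) x v u + Γ x v (covDerivMap Γ K x u)) := by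
  have hKx := hK.contDiffAt (h.isOpen.mem_nhds hx)
  have hdd : HasFDerivAt (fderiv ℝ K) (fderiv ℝ (fderiv ℝ K) x) x :=
    ((hKx.fderiv_right (m := 1) (by norm_cast)).differentiableAt one_ne_zero).hasFDerivAt
  have hd := (hKx.differentiableAt (by simp)).hasFDerivAt
  have key : ∀ u v, fderiv ℝ (covDerivMap Γ K) x u v =
      fderiv ℝ (fderiv ℝ K) x u v + fderiv ℝ Γ x u v (K x) + Γ x v (fderiv ℝ K x u) := by
    intro u v
    have h1 := (h.differentiableAt_covDerivMap hx hK).hasFDerivAt.clm_apply_const v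
    have h2 := (hdd.clm_apply_const v).add (((h.hasFDerivAt_conn hx).clm_apply_const v).clm_apply hd)
    have h3 : (fun y => covDerivMap Γ K y v) = fun y => fderiv ℝ K y v + Γ y v (K y) := by
      funext y
      simp [covDerivMap]
    rw [h3] at h1
    have h4 := DFunLike.congr_fun (h1.unique h2) u
    simp only [ContinuousLinearMap.flip_apply, add_apply, ContinuousLinearMap.coe_comp,
      Function.comp_apply] at h4
    rw [h4]
    abel
  have hsymm : fderiv ℝ (fderiv ℝ K) x u v = fderiv ℝ (fderiv ℝ K) x v u :=
    (hKx.isSymmSndFDerivAt minSmoothness_two_le_infty).eq u v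
  rw [key, key, hsymm]
  simp only [covDerivMap, curvature, add_apply, ContinuousLinearMap.flip_apply, map_add]
  abel

/-- The derivative of the 1-form g(K, ·) splits into a term symmetric in u, v by vanishing torsion
and the covariant derivative; integrability statements only see the second. -/
theorem hasFDerivAt_lower (h : IsLeviCivitaOn g Γ U) (hx : x ∈ U)
    (hK : ContDiffOn ℝ ∞ K U) : ∃ κ' : E →L[ℝ] E →L[ℝ] ℝ, HasFDerivAt (fun y => g y (K y)) κ' x ∧
      ∀ u v, κ' u v = g x (K x) (Γ x u v) + g x (covDerivMap Γ K x u) v := by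
  have hd := ((hK.contDiffAt (h.isOpen.mem_nhds hx)).differentiableAt (by simp)).hasFDerivAt
  refine ⟨_, (h.hasFDerivAt_metric hx).clm_apply hd, fun u v => ?_⟩
  simp only [add_apply, ContinuousLinearMap.coe_comp, Function.comp_apply,
    ContinuousLinearMap.flip_apply, h.compat x hx, covDerivMap, map_add]
  ring

/-- If `K` is recurrent along `K^⊥`, then `R(u, v) K` is a multiple of `K` for `u, v ⊥ K`. -/
theorem curvature_inner_eq_zero (h : IsLeviCivitaOn g Γ U) (hx : x ∈ U) (hK : ContDiffOn ℝ ∞ K U)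
    (h0 : K x ≠ 0)
    (hkundt : ∀ y ∈ U, ∀ u, g y (K y) u = 0 → ∃ c : ℝ, covDerivMap Γ K y u = c • K y)
    {u v z : E} (hu : g x (K x) u = 0) (hv : g x (K x) v = 0) (hz : g x (K x) z = 0) :
    g x (curvature Γ x u v (K x)) z = 0 := by
  obtain ⟨κ', hκ', hκ'eq⟩ := h.hasFDerivAt_lower hx hK
  obtain ⟨e, he⟩ : ∃ e, g x (K x) e ≠ 0 := by
    by_contra! hcon
    exact h0 (h.nondeg x hx _ hcon)
  have hcont : ∀ᶠ y in 𝓝 x, g y (K y) e ≠ 0 :=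
    (hκ'.clm_apply_const e).continuousAt.eventually_ne he
  -- extension of a vector of `K^⊥` to a section of `K^⊥`
  have hext : ∀ w, g x (K x) w = 0 → ∃ W : E → E, ∃ W' : E →L[ℝ] E, HasFDerivAt W W' x ∧ W x = w ∧
      (∀ᶠ y in 𝓝 x, g y (K y) (W y) = 0) ∧
      ∀ a, g x (K x) a = 0 → g x (K x) (W' a) = - g x (K x) (Γ x a w) := by
    intro w hw
    have hq : DifferentiableAt ℝ (fun y => g y (K y) w / g y (K y) e) x := by
      simp only [div_eq_mul_inv]
      exact (hκ'.clm_apply_const w).differentiableAt.mul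
        ((hκ'.clm_apply_const e).differentiableAt.inv he)
    have hWd : DifferentiableAt ℝ (fun y => w - (g y (K y) w / g y (K y) e) • e) x :=
      (hq.smul_const e).const_sub w
    have hW0 : (fun y => w - (g y (K y) w / g y (K y) e) • e) x = w := by simp [hw]
    have hker : ∀ᶠ y in 𝓝 x, g y (K y) (w - (g y (K y) w / g y (K y) e) • e) = 0 := by
      filter_upwards [hcont] with y hy
      rw [map_sub, map_smul, smul_eq_mul, div_mul_cancel₀ _ hy, sub_self]
    refine ⟨_, _, hWd.hasFDerivAt, hW0, hker, fun a ha => ?_⟩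
    have h1 := hκ'.clm_apply hWd.hasFDerivAt
    have h2 := DFunLike.congr_fun (h1.unique ((hasFDerivAt_const (0 : ℝ) x).congr_of_eventuallyEq
      hker)) a
    simp only [add_apply, ContinuousLinearMap.coe_comp, Function.comp_apply,
      ContinuousLinearMap.flip_apply, zero_apply] at h2
    rw [hκ'eq] at h2
    obtain ⟨c, hc⟩ := hkundt x hx a ha
    simp only [hw, zero_div, zero_smul, sub_zero, hc, map_smul, smul_apply, smul_zero,
      add_zero] at h2
    linarith
  obtain ⟨Z, Z', hZ, hZx, hZker, hZ'⟩ := hext z hz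
  have hA := (h.differentiableAt_covDerivMap hx hK).hasFDerivAt
  -- Here b' is the derivative along a of an extension of b within the complement of K.
  -- Differentiating g(∇_W K, Z) = 0 along a, with W and Z such extensions of b and z, gives the
  -- formula.
  have main : ∀ a b, g x (K x) a = 0 → g x (K x) b = 0 → ∃ b' : E,
      g x (K x) b' = - g x (K x) (Γ x a b) ∧
      g x (fderiv ℝ (covDerivMap Γ K) x a b + Γ x a (covDerivMap Γ K x b)) z =
        - g x (covDerivMap Γ K x b') z := by
    intro a b ha hb
    obtain ⟨W, W', hW, hWx, hWker, hW'⟩ := hext b hb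
    refine ⟨W' a, hW' a ha, ?_⟩
    have h1 := ((h.hasFDerivAt_metric hx).clm_apply (hA.clm_apply hW)).clm_apply hZ
    have h2 : HasFDerivAt (fun y => g y (covDerivMap Γ K y (W y)) (Z y)) (0 : E →L[ℝ] ℝ) x :=
      (hasFDerivAt_const (0 : ℝ) x).congr_of_eventuallyEq (by
        filter_upwards [hWker, hZker, h.isOpen.mem_nhds hx] with y hy hy' hyU
        obtain ⟨c, hc⟩ := hkundt y hyU _ hy
        rw [hc, map_smul, smul_apply, hy', smul_zero])
    have h3 := DFunLike.congr_fun (h1.unique h2) a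
    obtain ⟨c, hc⟩ := hkundt x hx b hb
    simp only [add_apply, ContinuousLinearMap.coe_comp, Function.comp_apply,
      ContinuousLinearMap.flip_apply, zero_apply, h.compat x hx, hWx, hZx, map_add] at h3
    have h4 : g x (covDerivMap Γ K x b) (Z' a) = - g x (covDerivMap Γ K x b) (Γ x a z) := by
      rw [hc, map_smul, smul_apply, smul_apply, hZ' a ha, smul_neg]
    rw [map_add, add_apply]
    linarith
  obtain ⟨b₁, hb₁, e₁⟩ := main u v hu hv
  obtain ⟨b₂, hb₂, e₂⟩ := main v u hv hu
  rw [h.curvature_field hx hK, map_sub, sub_apply, e₁, e₂]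
  -- Absence of torsion puts b₁ - b₂ in the complement of K, where ∇K is a multiple of K and pairs
  -- to zero with z.
  obtain ⟨c, hc⟩ := hkundt x hx (b₁ - b₂) (by
    rw [map_sub, hb₁, hb₂, h.torsion x hx u v, sub_self])
  have h5 : g x (covDerivMap Γ K x (b₁ - b₂)) z = 0 := by
    rw [hc, map_smul, smul_apply, hz, smul_zero]
  rw [map_sub, map_sub, sub_apply] at h5
  linarith

end IsLeviCivitaOn

end CurvatureOfField

/-! ### Independence of the chart for the Kundt, leaf-flat and Weyl conditions -/

section Invariance

open Coordinates IsManifold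

variable {n : ℕ} {M : Type*} [TopologicalSpace M] [ChartedSpace (Fin n → ℝ) M]
  {e e' : OpenPartialHomeomorph M (Fin n → ℝ)} {g : LorentzMetric n M}
  {k : ∀ p : M, TangentSpace 𝓘(ℝ, Fin n → ℝ) p}

namespace LorentzMetric

theorem IsNullCongruence.inChart (hk : g.IsNullCongruence k)
    (he : e ∈ maximalAtlas 𝓘(ℝ, Fin n → ℝ) ∞ M) {x : Fin n → ℝ} (hx : x ∈ e.target) :
    vectorInChart k e x ≠ 0 ∧
      metricForm (g.inChart e) x (vectorInChart k e x) (vectorInChart k e x) = 0 := by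
  have h1 : chartVector e x (vectorInChart k e x) = k (e.symm x) := mfderiv_symm_mfderiv he hx _
  obtain ⟨h2, h3⟩ := hk.2 (e.symm x)
  refine ⟨fun h0 => h2 ?_, ?_⟩
  · rw [← h1, h0]
    exact map_zero (mfderiv 𝓘(ℝ, Fin n → ℝ) 𝓘(ℝ, Fin n → ℝ) e.symm x)
  · rw [g.metricForm_inChart, h1, h3]

theorem IsVacuum.ricciFlatAt (hvac : g.IsVacuum) (he : e ∈ maximalAtlas 𝓘(ℝ, Fin n → ℝ) ∞ M)
    {x : Fin n → ℝ} (hx : x ∈ e.target) : RicciFlatAt (g.inChart e) x := hvac e he x hx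

theorem isKundtCongruence_iff (hn : 2 ≤ n) : g.IsKundtCongruence k ↔ g.IsNullCongruence k ∧
    ∀ e ∈ maximalAtlas 𝓘(ℝ, Fin n → ℝ) ∞ M, ∀ x ∈ e.target,
      IsKundtAt (g.inChart e) (vectorInChart k e) x := by
  refine and_congr_right fun hk => forall_congr' fun e => forall_congr' fun he =>
    forall_congr' fun x => forall_congr' fun hx => ?_
  exact kundt_iff (g.isLorentzMetricOn he) hx hn
    (((hk.1 e he).contDiffAt (e.open_target.mem_nhds hx)).differentiableAt (by simp))
    (hk.inChart he hx).1 fun y hy => (hk.inChart he hy).2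

theorem IsKundtCongruence.isNonexpanding (hn : 2 ≤ n) (h : g.IsKundtCongruence k) :
    g.IsNonexpanding k := by
  intro e he x hx
  obtain ⟨m, hm⟩ := exists_isScreen ((g.isLorentzMetricOn he).lorentz x hx) hn
    (h.1.inChart he hx).1 (h.1.inChart he hx).2
  exact ⟨m, hm, ((h.2 e he x hx).2 m hm).1⟩

section Transition

variable (he : e ∈ maximalAtlas 𝓘(ℝ, Fin n → ℝ) ∞ M)
  (he' : e' ∈ maximalAtlas 𝓘(ℝ, Fin n → ℝ) ∞ M)
include he he'

theorem isKundtAt_transition (hk : g.IsNullCongruence k) {x : Fin n → ℝ} (hx : x ∈ overlap e e')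
    (h : IsKundtAt (g.inChart e) (vectorInChart k e) x) :
    IsKundtAt (g.inChart e') (vectorInChart k e') ((e' ∘ e.symm) x) := by
  have hiso := isLocalIsometryOn he he' g
  intro u hu
  obtain ⟨w, rfl⟩ := hiso.surj x hx u
  rw [vectorInChart_transition he he' k hx, ← hiso.metric x hx] at hu
  obtain ⟨c, hc⟩ := h w hu
  refine ⟨c, ?_⟩
  rw [covDerivMap_apply, ← hiso.fderiv_covariantDeriv
    ((g.isLorentzMetricOn he).isLeviCivitaOn.mono (isOpen_overlap e e') inter_subset_left)
    (g.isLorentzMetricOn he').isLeviCivitaOn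
    (((hk.1 e he).differentiableOn (by simp)).mono inter_subset_left)
    ((hk.1 e' he').differentiableOn (by simp))
    (fun y hy => vectorInChart_transition he he' k hy) hx, ← covDerivMap_apply, hc, map_smul,
    vectorInChart_transition he he' k hx]

theorem curvature_transition (g : LorentzMetric n M) {x : Fin n → ℝ} (hx : x ∈ overlap e e')
    (u v w : Fin n → ℝ) :
    fderiv ℝ (e' ∘ e.symm) x (curvature (connForm (g.inChart e)) x u v w) =
      curvature (connForm (g.inChart e')) ((e' ∘ e.symm) x) (fderiv ℝ (e' ∘ e.symm) x u)
        (fderiv ℝ (e' ∘ e.symm) x v) (fderiv ℝ (e' ∘ e.symm) x w) :=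
  (isLocalIsometryOn he he' g).fderiv_curvature
    ((g.isLorentzMetricOn he).isLeviCivitaOn.mono (isOpen_overlap e e') inter_subset_left)
    (g.isLorentzMetricOn he').isLeviCivitaOn hx u v w

theorem leafFlatAt_transition {x : Fin n → ℝ} (hx : x ∈ overlap e e')
    (h : LeafFlatAt (g.inChart e) (vectorInChart k e x) x) :
    LeafFlatAt (g.inChart e') (vectorInChart k e' ((e' ∘ e.symm) x)) ((e' ∘ e.symm) x) := by
  have hiso := isLocalIsometryOn he he' g
  intro u v hu hv w
  obtain ⟨u, rfl⟩ := hiso.surj x hx u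
  obtain ⟨v, rfl⟩ := hiso.surj x hx v
  obtain ⟨w, rfl⟩ := hiso.surj x hx w
  rw [vectorInChart_transition he he' k hx, ← hiso.metric x hx] at hu hv
  rw [← curvature_transition he he' g hx, h u v hu hv, map_zero]

theorem weylVanishes_transition (hvac : g.IsVacuum) {x : Fin n → ℝ} (hx : x ∈ overlap e e')
    (h : WeylVanishes (g.inChart e) x) : WeylVanishes (g.inChart e') ((e' ∘ e.symm) x) := by
  have hiso := isLocalIsometryOn he he' g
  have hx' := hiso.mapsTo hx
  rw [(g.isLorentzMetricOn he).weylVanishes_iff hx.1 (hvac.ricciFlatAt he hx.1)] at h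
  rw [(g.isLorentzMetricOn he').weylVanishes_iff hx' (hvac.ricciFlatAt he' hx')]
  intro u v w
  obtain ⟨u, rfl⟩ := hiso.surj x hx u
  obtain ⟨v, rfl⟩ := hiso.surj x hx v
  obtain ⟨w, rfl⟩ := hiso.surj x hx w
  rw [← curvature_transition he he' g hx, h, map_zero]

end Transition

/-- In vacuum the condition is the vanishing of the curvature operator, which transition maps
preserve, so one chart suffices. -/
theorem weylVanishesAt_iff (hvac : g.IsVacuum) (he : e ∈ maximalAtlas 𝓘(ℝ, Fin n → ℝ) ∞ M) {p : M}
    (hp : p ∈ e.source) : g.WeylVanishesAt p ↔ WeylVanishes (g.inChart e) (e p) := by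
  refine ⟨fun h => h e he hp, fun h e' he' hp' => ?_⟩
  have := weylVanishes_transition he he' hvac (mem_overlap hp hp') h
  rwa [Function.comp_apply, e.left_inv hp] at this

/-- In vacuum, leafwise flatness makes the Weyl tensor type N wherever it does not vanish. -/
theorem isWeylTypeN_of_leafFlatAt (hn : 2 ≤ n) (hvac : g.IsVacuum) (hk : g.IsNullCongruence k)
    (h : ∀ p : M, ∃ e ∈ maximalAtlas 𝓘(ℝ, Fin n → ℝ) ∞ M, p ∈ e.source ∧
      LeafFlatAt (g.inChart e) (vectorInChart k e (e p)) (e p)) : g.IsWeylTypeN := by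
  intro p hp e' he' hp'
  obtain ⟨e, he, hpe, hflat⟩ := h p
  have hflat' := leafFlatAt_transition he he' (mem_overlap hpe hp') hflat
  rw [Function.comp_apply, e.left_inv hpe] at hflat'
  have hx := e'.map_source hp'
  have hG := g.isLorentzMetricOn he'
  refine ⟨fun hW => hp ((weylVanishesAt_iff hvac he' hp').2 hW), ?_⟩
  obtain ⟨E, hE0, hE⟩ := (hG.lorentz _ hx).exists_nullFrame hn (hk.inChart he' hx).1
    (hk.inChart he' hx).2
  have hE' : IsNullFrame (g.inChart e') (e' p) E := fun s t => by rw [← metricForm_eq_ip, hE]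
  refine ⟨E, hE', ?_⟩
  rw [← hE0] at hflat'
  exact hflat'.weylFrame_eq_zero hG hx (hvac.ricciFlatAt he' hx) hn hE'

/-- A vacuum Kundt congruence is leafwise flat if the Weyl tensor is of type N. -/
theorem IsKundtCongruence.leafFlatAt (hn : 2 ≤ n) (hvac : g.IsVacuum) (hk : g.IsKundtCongruence k)
    (hN : g.IsWeylTypeN) (he : e ∈ maximalAtlas 𝓘(ℝ, Fin n → ℝ) ∞ M) {x : Fin n → ℝ}
    (hx : x ∈ e.target) : LeafFlatAt (g.inChart e) (vectorInChart k e x) x := by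
  have hG := g.isLorentzMetricOn he
  have hR := hvac.ricciFlatAt he hx
  have hkn := hk.1
  have hkundt := ((isKundtCongruence_iff hn).1 hk).2 e he
  by_cases hW : g.WeylVanishesAt (e.symm x)
  · have h1 := hW e he (e.map_target hx)
    rw [e.right_inv hx, hG.weylVanishes_iff hx hR] at h1
    exact fun u v _ _ w => h1 u v w
  · obtain ⟨-, E, hE, hEN⟩ := hN _ hW e he (e.map_target hx)
    rw [e.right_inv hx] at hE hEN
    refine leafFlatAt_of_typeN hG hx hR hn hE hEN (hkn.inChart he hx).1 (hkn.inChart he hx).2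
      fun u v hu hv => ?_
    exact (hG.lorentz x hx).exists_smul_of_orthogonal hn (hkn.inChart he hx).1
      (hkn.inChart he hx).2 fun z hz => hG.isLeviCivitaOn.curvature_inner_eq_zero hx (hkn.1 e he)
        (hkn.inChart he hx).1 hkundt hu hv hz

end LorentzMetric

end Invariance

/-! ### Kerr-Schild metrics -/

section KerrSchild

open Coordinates

/-- Lets a guessed expression be identified with the Levi-Civita connection by verifying symmetry
and compatibility, without inverting the metric. -/
theorem IsLeviCivitaOn.conn_unique {E : Type*} [NormedAddCommGroup E] [NormedSpace ℝ E]
    {g : E → E →L[ℝ] E →L[ℝ] ℝ} {Γ : E → E →L[ℝ] E →L[ℝ] E} {U : Set E} {x : E}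
    (h : IsLeviCivitaOn g Γ U) (hx : x ∈ U) {C : E → E → E} (hsymm : ∀ u v, C u v = C v u)
    (hcompat : ∀ u v w, fderiv ℝ g x u v w = g x (C u v) w + g x v (C u w)) (u v : E) :
    Γ x u v = C u v := by
  refine h.ext_inner hx fun w => ?_
  have := eq_zero_of_symm_of_skew (S := fun u v w => g x (Γ x u v) w - g x (C u v) w)
    (fun u v w => by rw [h.torsion x hx, hsymm]) (fun u v w => by
      have h1 := h.compat x hx u v w
      have h2 := hcompat u v w
      rw [h.symm x hx v] at h1 h2
      linarith) u v w
  linarith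

variable {n : ℕ}

/-- The Minkowski form. -/
def minkForm (n : ℕ) : (Fin n → ℝ) →L[ℝ] (Fin n → ℝ) →L[ℝ] ℝ :=
  metricForm (fun _ => minkowski n) 0

theorem minkForm_apply (u v : Fin n → ℝ) :
    minkForm n u v = u ⬝ᵥ (minkowski n *ᵥ v) := by
  rw [minkForm, metricForm_eq_ip, ip]

theorem isLorentzForm_minkForm (n : ℕ) : IsLorentzForm (minkForm n) :=
  ⟨ContinuousLinearEquiv.refl ℝ _, fun u v => minkForm_apply u v⟩

theorem minkForm_comm (u v : Fin n → ℝ) : minkForm n u v = minkForm n v u :=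
  (isLorentzForm_minkForm n).symm u v

theorem minkForm_single (u : Fin n → ℝ) (a : Fin n) :
    minkForm n u (Pi.single a 1) = (if a.val = 0 then -1 else 1) * u a := by
  rw [minkForm_apply, minkowski_form, Finset.sum_eq_single a (by intro b _ hb; simp [hb]) (by simp)]
  simp

/-- The vector `η⁻¹ α`. -/
def minkSharp (n : ℕ) : ((Fin n → ℝ) →L[ℝ] ℝ) →L[ℝ] (Fin n → ℝ) :=
  ContinuousLinearMap.pi fun a =>
    (if a.val = 0 then -1 else 1 : ℝ) • ContinuousLinearMap.apply ℝ ℝ (Pi.single a 1)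

theorem minkForm_minkSharp (α : (Fin n → ℝ) →L[ℝ] ℝ) (v : Fin n → ℝ) :
    minkForm n (minkSharp n α) v = α v := by
  rw [clm_eq_sum α v, clm_eq_sum (minkForm n (minkSharp n α)) v]
  refine Finset.sum_congr rfl fun a _ => ?_
  rw [minkForm_single]
  simp only [minkSharp, ContinuousLinearMap.coe_pi', smul_apply, ContinuousLinearMap.apply_apply,
    smul_eq_mul]
  split_ifs <;> ring

theorem minkForm_minkSharp_right (α : (Fin n → ℝ) →L[ℝ] ℝ) (v : Fin n → ℝ) :
    minkForm n v (minkSharp n α) = α v := by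
  rw [minkForm_comm, minkForm_minkSharp]

theorem eq_of_minkForm {u v : Fin n → ℝ} (h : ∀ w, minkForm n u w = minkForm n v w) : u = v := by
  rw [← sub_eq_zero]
  exact (isLorentzForm_minkForm n).nondeg fun w => by rw [map_sub, sub_apply, h, sub_self]

/-- `G = η - 2 H ℓ ⊗ ℓ` on `U` for a smooth null vector field `l` with `l⁰ = 1`, where
`ℓ = η(l, ·)`. -/
structure IsKerrSchildOn (G : (Fin n → ℝ) → Matrix (Fin n) (Fin n) ℝ) (H : (Fin n → ℝ) → ℝ)
    (l : (Fin n → ℝ) → (Fin n → ℝ)) (o : Fin n) (U : Set (Fin n → ℝ)) : Prop where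
  lorentz : IsLorentzMetricOn G U
  smooth_H : ContDiffOn ℝ ∞ H U
  smooth_l : ContDiffOn ℝ ∞ l U
  null : ∀ x ∈ U, minkForm n (l x) (l x) = 0
  zeroth : o.val = 0
  normalized : ∀ x ∈ U, l x o = 1
  metric : ∀ x ∈ U, ∀ u v, metricForm G x u v =
    minkForm n u v - 2 * H x * minkForm n (l x) u * minkForm n (l x) v

/-- The Christoffel symbols of the metric `η - 2 H ℓ ⊗ ℓ`. -/
def kerrSchildConn (H : (Fin n → ℝ) → ℝ) (l : (Fin n → ℝ) → (Fin n → ℝ)) (x u v : Fin n → ℝ) :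
    Fin n → ℝ :=
  -(fderiv ℝ H x u * minkForm n (l x) v + H x * minkForm n (fderiv ℝ l x u) v) • l x
    - (fderiv ℝ H x v * minkForm n (l x) u + H x * minkForm n (fderiv ℝ l x v) u) • l x
    - (H x * minkForm n (l x) v) • fderiv ℝ l x u - (H x * minkForm n (l x) u) • fderiv ℝ l x v
    + (minkForm n (l x) u * minkForm n (l x) v) • minkSharp n (fderiv ℝ H x)
    + (H x * minkForm n (l x) v) • minkSharp n ((minkForm n).flip u ∘L fderiv ℝ l x)
    + (H x * minkForm n (l x) u) • minkSharp n ((minkForm n).flip v ∘L fderiv ℝ l x)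
    + (2 * H x * (fderiv ℝ H x (l x) * minkForm n (l x) u * minkForm n (l x) v
      + H x * minkForm n (fderiv ℝ l x (l x)) u * minkForm n (l x) v
      + H x * minkForm n (l x) u * minkForm n (fderiv ℝ l x (l x)) v)) • l x

namespace IsKerrSchildOn

variable {G : (Fin n → ℝ) → Matrix (Fin n) (Fin n) ℝ} {H : (Fin n → ℝ) → ℝ}
  {l : (Fin n → ℝ) → (Fin n → ℝ)} {o : Fin n} {U : Set (Fin n → ℝ)} {x : Fin n → ℝ}

theorem isOpen (h : IsKerrSchildOn G H l o U) : IsOpen U := h.lorentz.isOpen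

theorem hasFDerivAt_H (h : IsKerrSchildOn G H l o U) (hx : x ∈ U) :
    HasFDerivAt H (fderiv ℝ H x) x :=
  ((h.smooth_H.contDiffAt (h.isOpen.mem_nhds hx)).differentiableAt (by simp)).hasFDerivAt

theorem hasFDerivAt_l (h : IsKerrSchildOn G H l o U) (hx : x ∈ U) :
    HasFDerivAt l (fderiv ℝ l x) x :=
  ((h.smooth_l.contDiffAt (h.isOpen.mem_nhds hx)).differentiableAt (by simp)).hasFDerivAt

theorem hasFDerivAt_form (h : IsKerrSchildOn G H l o U) (hx : x ∈ U) (v : Fin n → ℝ) :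
    HasFDerivAt (fun y => minkForm n (l y) v) ((minkForm n).flip v ∘L fderiv ℝ l x) x :=
  ((minkForm n).flip v).hasFDerivAt.comp x (h.hasFDerivAt_l hx)

theorem l_ne_zero (h : IsKerrSchildOn G H l o U) (hx : x ∈ U) : l x ≠ 0 := by
  intro h0
  have := h.normalized x hx
  rw [h0] at this
  simp at this

theorem form_fderiv (h : IsKerrSchildOn G H l o U) (hx : x ∈ U) (u : Fin n → ℝ) :
    minkForm n (l x) (fderiv ℝ l x u) = 0 := by
  have h1 := ((minkForm n).hasFDerivAt.comp x (h.hasFDerivAt_l hx)).clm_apply (h.hasFDerivAt_l hx)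
  have h2 := DFunLike.congr_fun (h1.unique ((hasFDerivAt_const (0 : ℝ) x).congr_of_eventuallyEq (by
    filter_upwards [h.isOpen.mem_nhds hx] with y hy using h.null y hy))) u
  simp only [add_apply, ContinuousLinearMap.coe_comp, Function.comp_apply,
    ContinuousLinearMap.flip_apply, zero_apply] at h2
  have := minkForm_comm (l x) (fderiv ℝ l x u)
  linarith

theorem form_single (h : IsKerrSchildOn G H l o U) (hx : x ∈ U) :
    minkForm n (l x) (Pi.single o 1) = -1 := by
  rw [minkForm_single, if_pos h.zeroth, h.normalized x hx]
  ring

theorem fderiv_zeroth (h : IsKerrSchildOn G H l o U) (hx : x ∈ U) (u : Fin n → ℝ) :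
    fderiv ℝ l x u o = 0 := by
  have h1 := hasFDerivAt_pi'.1 (h.hasFDerivAt_l hx) o
  exact DFunLike.congr_fun (h1.unique ((hasFDerivAt_const (1 : ℝ) x).congr_of_eventuallyEq (by
    filter_upwards [h.isOpen.mem_nhds hx] with y hy using h.normalized y hy))) u

/-- Vectors of `l^⊥` whose `0`-component vanishes are spacelike. -/
theorem form_nonneg (h : IsKerrSchildOn G H l o U) (hx : x ∈ U) (hn : 2 ≤ n) {v : Fin n → ℝ}
    (hv : minkForm n (l x) v = 0) : 0 ≤ minkForm n v v ∧ (minkForm n v v = 0 → ∃ c : ℝ, v = c • l x) :=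
  (isLorentzForm_minkForm n).form_nonneg hn (h.l_ne_zero hx) (h.null x hx) hv

/-- The purpose of the normalisation l⁰ = 1: the vector dl(u) is orthogonal to l and has no time
component, so if it is null it is a multiple of l, and the multiple is zero. -/
theorem eq_zero_of_form (h : IsKerrSchildOn G H l o U) (hx : x ∈ U) (hn : 2 ≤ n) {u : Fin n → ℝ}
    (hu : minkForm n (fderiv ℝ l x u) (fderiv ℝ l x u) = 0) : fderiv ℝ l x u = 0 := by
  obtain ⟨c, hc⟩ := (h.form_nonneg hx hn (h.form_fderiv hx u)).2 hu
  have h1 := h.fderiv_zeroth hx u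
  rw [hc, Pi.smul_apply, h.normalized x hx, smul_eq_mul, mul_one] at h1
  rw [hc, h1, zero_smul]

theorem metric_l (h : IsKerrSchildOn G H l o U) (hx : x ∈ U) (v : Fin n → ℝ) :
    metricForm G x (l x) v = minkForm n (l x) v := by
  rw [h.metric x hx, h.null x hx]
  ring

/-- The Levi-Civita connection of a Kerr-Schild metric. -/
theorem connForm_eq (h : IsKerrSchildOn G H l o U) (hx : x ∈ U) (u v : Fin n → ℝ) :
    connForm G x u v = kerrSchildConn H l x u v := by
  have hder : ∀ u v w, fderiv ℝ (metricForm G) x u v w =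
      -2 * (fderiv ℝ H x u * minkForm n (l x) v * minkForm n (l x) w
        + H x * minkForm n (fderiv ℝ l x u) v * minkForm n (l x) w
        + H x * minkForm n (l x) v * minkForm n (fderiv ℝ l x u) w) := by
    intro u v w
    have h1 := ((h.lorentz.isLeviCivitaOn.hasFDerivAt_metric hx).clm_apply_const v).clm_apply_const w
    have h2 := ((((h.hasFDerivAt_H hx).mul (h.hasFDerivAt_form hx v)).mul
      (h.hasFDerivAt_form hx w)).const_mul (-2)).const_add (minkForm n v w)
    have h3 := DFunLike.congr_fun (h1.unique (h2.congr_of_eventuallyEq (by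
      filter_upwards [h.isOpen.mem_nhds hx] with y hy
      rw [h.metric y hy]
      simp only [Pi.mul_apply]
      ring))) u
    simp only [add_apply, ContinuousLinearMap.coe_comp, Function.comp_apply, smul_apply,
      ContinuousLinearMap.flip_apply, smul_eq_mul, Pi.mul_apply] at h3
    rw [h3]
    ring
  refine h.lorentz.isLeviCivitaOn.conn_unique hx (C := kerrSchildConn H l x) (fun u v => ?_)
    (fun u v w => ?_) u v
  · simp only [kerrSchildConn]
    module
  · rw [hder, h.metric x hx, h.metric x hx]
    simp only [kerrSchildConn, map_add, map_sub, map_smul, add_apply, sub_apply, smul_apply,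
      smul_eq_mul, minkForm_minkSharp, minkForm_minkSharp_right, h.null x hx, h.form_fderiv hx,
      ContinuousLinearMap.coe_comp, Function.comp_apply, ContinuousLinearMap.flip_apply]
    rw [minkForm_comm v (l x), minkForm_comm v (fderiv ℝ l x u),
      minkForm_comm v (fderiv ℝ l x w)]
    ring

end IsKerrSchildOn

end KerrSchild

/-! ### Vacuum equations for Kerr-Schild metrics -/

section KerrSchildVacuum

open Coordinates

variable {n : ℕ}

/-- The trace of an endomorphism of `ℝⁿ`. -/
def traceL (n : ℕ) : ((Fin n → ℝ) →L[ℝ] (Fin n → ℝ)) →L[ℝ] ℝ :=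
  ∑ a, (ContinuousLinearMap.proj (R := ℝ) (φ := fun _ : Fin n => ℝ) a).comp
    (ContinuousLinearMap.apply ℝ (Fin n → ℝ) (Pi.single a 1))

theorem traceL_apply (T : (Fin n → ℝ) →L[ℝ] (Fin n → ℝ)) :
    traceL n T = ∑ a, T (Pi.single a 1) a := by
  simp [traceL, sum_apply]

theorem traceL_smulRight (α : (Fin n → ℝ) →L[ℝ] ℝ) (w : Fin n → ℝ) :
    traceL n (α.smulRight w) = α w := by
  rw [traceL_apply, clm_eq_sum α w]
  exact Finset.sum_congr rfl fun a _ => by simp [mul_comm]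

theorem minkSharp_minkForm (v : Fin n → ℝ) : minkSharp n (minkForm n v) = v :=
  eq_of_minkForm fun w => minkForm_minkSharp _ w

namespace IsKerrSchildOn

variable {G : (Fin n → ℝ) → Matrix (Fin n) (Fin n) ℝ} {H : (Fin n → ℝ) → ℝ}
  {l : (Fin n → ℝ) → (Fin n → ℝ)} {o : Fin n} {U : Set (Fin n → ℝ)} {x : Fin n → ℝ}

theorem hasFDerivAt_fderiv_l (h : IsKerrSchildOn G H l o U) (hx : x ∈ U) :
    HasFDerivAt (fderiv ℝ l) (fderiv ℝ (fderiv ℝ l) x) x :=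
  (((h.smooth_l.contDiffAt (h.isOpen.mem_nhds hx)).fderiv_right (m := 1)
    (by norm_cast)).differentiableAt one_ne_zero).hasFDerivAt

theorem hasFDerivAt_fderiv_H (h : IsKerrSchildOn G H l o U) (hx : x ∈ U) :
    HasFDerivAt (fderiv ℝ H) (fderiv ℝ (fderiv ℝ H) x) x :=
  (((h.smooth_H.contDiffAt (h.isOpen.mem_nhds hx)).fderiv_right (m := 1)
    (by norm_cast)).differentiableAt one_ne_zero).hasFDerivAt

theorem form_fderiv_right (h : IsKerrSchildOn G H l o U) (hx : x ∈ U) (u : Fin n → ℝ) :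
    minkForm n (fderiv ℝ l x u) (l x) = 0 := by
  rw [minkForm_comm, h.form_fderiv hx]

theorem form_fderiv_fderiv (h : IsKerrSchildOn G H l o U) (hx : x ∈ U) (u v : Fin n → ℝ) :
    minkForm n (fderiv ℝ (fderiv ℝ l) x u v) (l x) =
      - minkForm n (fderiv ℝ l x u) (fderiv ℝ l x v) := by
  have h1 := ((minkForm n).hasFDerivAt.comp x
    ((h.hasFDerivAt_fderiv_l hx).clm_apply_const v)).clm_apply (h.hasFDerivAt_l hx)
  have h2 := DFunLike.congr_fun (h1.unique ((hasFDerivAt_const (0 : ℝ) x).congr_of_eventuallyEq (by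
    filter_upwards [h.isOpen.mem_nhds hx] with y hy using h.form_fderiv_right hy v))) u
  simp only [add_apply, ContinuousLinearMap.coe_comp, Function.comp_apply,
    ContinuousLinearMap.flip_apply, zero_apply] at h2
  rw [minkForm_comm (fderiv ℝ l x u)]
  linarith

/-- As l is null, det(η - 2Hℓ⊗ℓ) is constant, and Γ^a_{ab} is the derivative of the logarithm of its
root. Here the cancellation is carried out term by term. -/
theorem trace_connForm (h : IsKerrSchildOn G H l o U) (hx : x ∈ U) (u : Fin n → ℝ) :
    traceL n (connForm G x u) = 0 := by
  have h1 : ∑ a, minkSharp n ((minkForm n).flip (Pi.single a 1) ∘L fderiv ℝ l x) a =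
      traceL n (fderiv ℝ l x) := by
    rw [traceL_apply]
    refine Finset.sum_congr rfl fun a _ => ?_
    simp only [minkSharp, ContinuousLinearMap.coe_pi', smul_apply,
      ContinuousLinearMap.apply_apply, smul_eq_mul, ContinuousLinearMap.coe_comp,
      Function.comp_apply, ContinuousLinearMap.flip_apply, minkForm_single]
    split_ifs <;> ring
  have h2 : ∀ (α : (Fin n → ℝ) →L[ℝ] ℝ) (w : Fin n → ℝ), ∑ a, α (Pi.single a 1) * w a = α w := by
    intro α w
    rw [← traceL_smulRight, traceL_apply]
    rfl
  have h3 : ∑ a, fderiv ℝ l x (Pi.single a 1) a = traceL n (fderiv ℝ l x) := (traceL_apply _).symm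
  have e1 := h2 (minkForm n (l x)) (l x)
  have e2 := h2 (minkForm n (fderiv ℝ l x u)) (l x)
  have e3 := h2 (fderiv ℝ H x) (l x)
  have e4 := h2 ((minkForm n).flip u ∘L fderiv ℝ l x) (l x)
  have e5 := h2 (minkForm n (l x)) (fderiv ℝ l x u)
  have e6 := h2 (minkForm n (l x)) (minkSharp n (fderiv ℝ H x))
  have e7 := h2 (minkForm n (l x)) (minkSharp n ((minkForm n).flip u ∘L fderiv ℝ l x))
  have e8 := h2 (minkForm n (fderiv ℝ l x (l x))) (l x)
  rw [h.null x hx] at e1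
  rw [h.form_fderiv_right hx] at e2 e8
  rw [h.form_fderiv hx] at e5
  rw [minkForm_minkSharp_right] at e6 e7
  simp only [ContinuousLinearMap.coe_comp, Function.comp_apply,
    ContinuousLinearMap.flip_apply] at e4 e7
  rw [traceL_apply]
  have h4 : ∀ a, connForm G x u (Pi.single a 1) a =
      -fderiv ℝ H x u * (minkForm n (l x) (Pi.single a 1) * l x a)
      - H x * (minkForm n (fderiv ℝ l x u) (Pi.single a 1) * l x a)
      - minkForm n (l x) u * (fderiv ℝ H x (Pi.single a 1) * l x a)
      - H x * (minkForm n (fderiv ℝ l x (Pi.single a 1)) u * l x a)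
      - H x * (minkForm n (l x) (Pi.single a 1) * fderiv ℝ l x u a)
      - H x * minkForm n (l x) u * fderiv ℝ l x (Pi.single a 1) a
      + minkForm n (l x) u * (minkForm n (l x) (Pi.single a 1) * minkSharp n (fderiv ℝ H x) a)
      + H x * (minkForm n (l x) (Pi.single a 1) *
        minkSharp n ((minkForm n).flip u ∘L fderiv ℝ l x) a)
      + H x * minkForm n (l x) u *
        minkSharp n ((minkForm n).flip (Pi.single a 1) ∘L fderiv ℝ l x) a
      + 2 * H x * (fderiv ℝ H x (l x) * minkForm n (l x) u + H x *
        minkForm n (fderiv ℝ l x (l x)) u) * (minkForm n (l x) (Pi.single a 1) * l x a)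
      + 2 * H x * H x * minkForm n (l x) u *
        (minkForm n (fderiv ℝ l x (l x)) (Pi.single a 1) * l x a) := by
    intro a
    rw [h.connForm_eq hx, kerrSchildConn]
    simp only [Pi.add_apply, Pi.sub_apply, Pi.smul_apply, smul_eq_mul]
    ring
  rw [Finset.sum_congr rfl fun a _ => h4 a]
  simp only [Finset.sum_add_distrib, Finset.sum_sub_distrib, ← Finset.mul_sum, e1, e2, e3, e4, e5,
    e6, e7, e8, h1, h3]
  ring

/-- Under the two orthogonality conditions Γ(X) = α⊗l + ℓ⊗b with α(l) = 0 and ℓ(b) = 0. Its square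
is α(b) ℓ⊗l, which is trace free because l is null. -/
theorem trace_connForm_sq (h : IsKerrSchildOn G H l o U) (hx : x ∈ U) {X : Fin n → ℝ}
    (hX : minkForm n (l x) X = 0) (hlX : minkForm n (fderiv ℝ l x (l x)) X = 0) :
    ∑ a, connForm G x X (connForm G x X (Pi.single a 1)) a = 0 := by
  set α : (Fin n → ℝ) →L[ℝ] ℝ := -(fderiv ℝ H x X • minkForm n (l x)) -
    H x • minkForm n (fderiv ℝ l x X) - H x • ((minkForm n).flip X ∘L fderiv ℝ l x) with hα
  set b : Fin n → ℝ := -H x • fderiv ℝ l x X +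
    H x • minkSharp n ((minkForm n).flip X ∘L fderiv ℝ l x) with hb
  have h1 : ∀ v, connForm G x X v = α v • l x + minkForm n (l x) v • b := by
    intro v
    rw [h.connForm_eq hx, kerrSchildConn, hX, hlX, hα, hb]
    simp only [sub_apply, neg_apply, smul_apply, smul_eq_mul, ContinuousLinearMap.coe_comp,
      Function.comp_apply, ContinuousLinearMap.flip_apply]
    module
  have h2 : α (l x) = 0 := by
    simp [hα, h.null x hx, h.form_fderiv_right hx, hlX]
  have h3 : minkForm n (l x) b = 0 := by
    simp [hb, h.form_fderiv hx, minkForm_minkSharp_right, hlX]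
  have h4 : ∀ v, connForm G x X (connForm G x X v) = ((α b) • (minkForm n (l x))).smulRight (l x) v := by
    intro v
    simp only [h1, map_add, map_smul, h2, h3, h.null x hx, smul_eq_mul,
      ContinuousLinearMap.smulRight_apply, smul_apply]
    module
  simp only [h4]
  rw [← traceL_apply, traceL_smulRight, smul_apply, h.null x hx, smul_zero]

/-- This is Ric(X, X) = 0 with all terms but one removed: the terms with Γ^a_{ab} vanish by
`trace_connForm`, the term Γ(X)Γ(X) by `trace_connForm_sq`. What is left is the divergence of the
vector field Γ(X, X) for constant X. -/
theorem ricci_contraction (h : IsKerrSchildOn G H l o U) (hx : x ∈ U) (hR : RicciFlatAt G x)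
    {X : Fin n → ℝ} (hX : minkForm n (l x) X = 0)
    (hlX : minkForm n (fderiv ℝ l x (l x)) X = 0) :
    H x * minkForm n (minkSharp n ((minkForm n).flip X ∘L fderiv ℝ l x))
        (minkSharp n ((minkForm n).flip X ∘L fderiv ℝ l x)) =
      H x * (minkForm n (fderiv ℝ (fderiv ℝ l) x (l x) X) X +
        minkForm n (fderiv ℝ l x (fderiv ℝ l x X)) X) +
      (fderiv ℝ H x (l x) + H x * traceL n (fderiv ℝ l x)) * minkForm n (fderiv ℝ l x X) X := by
  have hLC := h.lorentz.isLeviCivitaOn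
  have hΓ := hLC.hasFDerivAt_conn hx
  have hdl := h.hasFDerivAt_fderiv_l hx
  have hdH := h.hasFDerivAt_fderiv_H hx
  have hl := h.hasFDerivAt_l hx
  have hH := h.hasFDerivAt_H hx
  have hsum := h.lorentz.sum_curvature hx hR X X
  have t2 : ∑ a, fderiv ℝ (connForm G) x X (Pi.single a 1) X a = 0 := by
    have h1 := ((traceL n).hasFDerivAt.comp x (hΓ.clm_apply_const X)).unique
      ((hasFDerivAt_const (0 : ℝ) x).congr_of_eventuallyEq (by
        filter_upwards [h.isOpen.mem_nhds hx] with y hy using h.trace_connForm hy X))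
    have h2 := DFunLike.congr_fun h1 X
    simp only [ContinuousLinearMap.coe_comp, Function.comp_apply, ContinuousLinearMap.flip_apply,
      zero_apply, traceL_apply] at h2
    simpa only [hLC.fderiv_conn_symm hx X X] using h2
  have t3 : ∑ a, connForm G x (Pi.single a 1) (connForm G x X X) a = 0 := by
    simp only [hLC.torsion x hx _ (connForm G x X X)]
    rw [← traceL_apply, h.trace_connForm hx]
  have t4 : ∑ a, connForm G x X (connForm G x (Pi.single a 1) X) a = 0 := by
    simp only [hLC.torsion x hx _ X]
    exact h.trace_connForm_sq hx hX hlX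
  have t1 : ∑ a, fderiv ℝ (connForm G) x (Pi.single a 1) X X a = 0 := by
    simp only [curvature, Pi.add_apply, Pi.sub_apply, Finset.sum_add_distrib,
      Finset.sum_sub_distrib] at hsum
    linarith
  set α := (minkForm n).flip X ∘L fderiv ℝ l x with hα
  have hφ := h.hasFDerivAt_form hx X
  have hB : ∀ (f : (Fin n → ℝ) → (Fin n → ℝ)), DifferentiableAt ℝ f x →
      DifferentiableAt ℝ (fun y => minkForm n (f y) X) x := fun f hf =>
    ((minkForm n).flip X).differentiableAt.comp x hf
  have hP : HasFDerivAt (fun y => -2 * (H y * minkForm n (fderiv ℝ l y X) X))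
      ((-2 : ℝ) • (H x • ((minkForm n).flip X ∘L (fderiv ℝ (fderiv ℝ l) x).flip X) +
        minkForm n (fderiv ℝ l x X) X • fderiv ℝ H x)) x :=
    (hH.mul (((minkForm n).flip X).hasFDerivAt.comp x (hdl.clm_apply_const X))).const_mul (-2)
  -- Near x one has Γ(X, X) = P l + ℓ(X) Q. Since ℓ(X) vanishes at x, only the value of Q there
  -- enters the divergence, and its derivative is never computed.
  set Q : (Fin n → ℝ) → (Fin n → ℝ) := fun y => (-2 * fderiv ℝ H y X) • l y
    - (2 * H y) • fderiv ℝ l y X + minkForm n (l y) X • minkSharp n (fderiv ℝ H y)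
    + (2 * H y) • minkSharp n ((minkForm n).flip X ∘L fderiv ℝ l y)
    + (2 * H y * (fderiv ℝ H y (l y) * minkForm n (l y) X
      + 2 * H y * minkForm n (fderiv ℝ l y (l y)) X)) • l y with hQdef
  have hQ : DifferentiableAt ℝ Q x := by
    have d1 := hl.differentiableAt
    have d2 := hH.differentiableAt
    have d3 := hdl.differentiableAt
    have d4 := hdH.differentiableAt
    have d5 := hB _ d1
    have d6 := hB _ (d3.clm_apply d1)
    have d7 : DifferentiableAt ℝ (fun y => minkSharp n (fderiv ℝ H y)) x :=
      (minkSharp n).differentiableAt.comp x d4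
    have d8 : DifferentiableAt ℝ (fun y => minkSharp n ((minkForm n).flip X ∘L fderiv ℝ l y)) x :=
      (minkSharp n).differentiableAt.comp x
        ((differentiableAt_const ((minkForm n).flip X)).clm_comp d3)
    have d9 : DifferentiableAt ℝ (fun y => fderiv ℝ H y (l y)) x := d4.clm_apply d1
    have d10 : DifferentiableAt ℝ (fun y => fderiv ℝ H y X) x :=
      d4.clm_apply (differentiableAt_const X)
    have d11 : DifferentiableAt ℝ (fun y => fderiv ℝ l y X) x :=
      d3.clm_apply (differentiableAt_const X)
    rw [hQdef]
    exact (((((d10.const_mul (-2)).smul d1).sub ((d2.const_mul 2).smul d11)).add (d5.smul d7)).add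
      ((d2.const_mul 2).smul d8)).add (((d2.const_mul 2).mul ((d9.mul d5).add
        ((d2.const_mul 2).mul d6))).smul d1)
  have hW := (hP.smul hl).add (hφ.smul hQ.hasFDerivAt)
  have hW' := (hΓ.clm_apply_const X).clm_apply_const X
  have heq := hW'.unique (hW.congr_of_eventuallyEq (by
    filter_upwards [h.isOpen.mem_nhds hx] with y hy
    rw [h.connForm_eq hy, kerrSchildConn]
    simp only [hQdef, Pi.add_apply, Pi.smul_apply']
    module))
  have key : traceL n (((fderiv ℝ (connForm G) x).flip X).flip X) = 0 := by
    rw [traceL_apply]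
    exact t1
  rw [heq] at key
  have hQx : minkForm n (fderiv ℝ l x (Q x)) X = -2 * H x * minkForm n (fderiv ℝ l x (fderiv ℝ l x X)) X
      + 2 * H x * minkForm n (minkSharp n α) (minkSharp n α) := by
    rw [minkForm_minkSharp, hα]
    simp only [hQdef, map_add, map_sub, map_smul, add_apply, sub_apply, smul_apply, hX, hlX,
      smul_eq_mul, ContinuousLinearMap.coe_comp, Function.comp_apply,
      ContinuousLinearMap.flip_apply]
    ring
  simp only [map_add, map_smul, traceL_smulRight, add_apply, smul_apply, smul_eq_mul,
    ContinuousLinearMap.coe_comp, Function.comp_apply, ContinuousLinearMap.flip_apply, hX, hQx,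
    zero_mul] at key
  linarith

/-- Where `H ≠ 0`, the congruence of a vacuum Kerr-Schild metric is geodetic. -/
theorem fderiv_l_self (h : IsKerrSchildOn G H l o U) (hn : 2 ≤ n) (hx : x ∈ U)
    (hR : RicciFlatAt G x) (hH : H x ≠ 0) : fderiv ℝ l x (l x) = 0 := by
  -- For X = l the form η(dl ·, l) is zero, and differentiating it turns the second-derivative term
  -- into -|dl(l)|².
  have h1 := h.ricci_contraction hx hR (h.null x hx) (h.form_fderiv_right hx _)
  have h2 : (minkForm n).flip (l x) ∘L fderiv ℝ l x = 0 := by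
    ext v
    simpa using h.form_fderiv_right hx _
  rw [h2, h.form_fderiv_right hx, h.form_fderiv_right hx, h.form_fderiv_fderiv hx, map_zero,
    map_zero, mul_zero, mul_zero, add_zero, add_zero, zero_eq_mul, neg_eq_zero] at h1
  exact h.eq_zero_of_form hx hn (h1.resolve_left hH)

/-- Where `H ≠ 0`, the congruence of a nonexpanding geodetic vacuum Kerr-Schild metric is constant
along its orthogonal complement. -/
theorem fderiv_l_eq_zero (h : IsKerrSchildOn G H l o U) (hn : 2 ≤ n) (hx : x ∈ U)
    (hR : RicciFlatAt G x) (hH : H x ≠ 0) (hgeo : ∀ y ∈ U, fderiv ℝ l y (l y) = 0)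
    {m : Fin (n - 2) → (Fin n → ℝ)} (hlm : ∀ i, minkForm n (l x) (m i) = 0)
    (hm : ∀ i j, minkForm n (m i) (m j) = if i = j then 1 else 0)
    (hθ : ∑ i, minkForm n (fderiv ℝ l x (m i)) (m i) = 0) {Y : Fin n → ℝ}
    (hY : minkForm n (l x) Y = 0) : fderiv ℝ l x Y = 0 := by
  have hL := isLorentzForm_minkForm n
  set α : Fin (n - 2) → ((Fin n → ℝ) →L[ℝ] ℝ) := fun i =>
    (minkForm n).flip (m i) ∘L fderiv ℝ l x with hα
  have hα' : ∀ i v, α i v = minkForm n (fderiv ℝ l x v) (m i) := fun i v => rfl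
  -- Differentiating dl(l) = 0 along m_i and exchanging second derivatives removes the bracket,
  -- leaving the diagonal optical component.
  have hsq : ∀ i, H x * minkForm n (minkSharp n (α i)) (minkSharp n (α i)) =
      (fderiv ℝ H x (l x) + H x * traceL n (fderiv ℝ l x)) *
        minkForm n (fderiv ℝ l x (m i)) (m i) := by
    intro i
    have h1 := h.ricci_contraction hx hR (hlm i) (by rw [hgeo x hx, map_zero, zero_apply])
    have h2 := (h.hasFDerivAt_fderiv_l hx).clm_apply (h.hasFDerivAt_l hx)
    have h3 := DFunLike.congr_fun (h2.unique ((hasFDerivAt_const (0 : Fin n → ℝ) x).congr_of_eventuallyEq (by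
      filter_upwards [h.isOpen.mem_nhds hx] with y hy using hgeo y hy))) (m i)
    simp only [add_apply, ContinuousLinearMap.coe_comp, Function.comp_apply,
      ContinuousLinearMap.flip_apply, zero_apply] at h3
    have h4 : fderiv ℝ (fderiv ℝ l) x (l x) (m i) = fderiv ℝ (fderiv ℝ l) x (m i) (l x) :=
      ((h.smooth_l.contDiffAt (h.isOpen.mem_nhds hx)).isSymmSndFDerivAt
        minSmoothness_two_le_infty).eq _ _
    rw [h1, h4, ← add_apply, ← map_add, add_comm (fderiv ℝ (fderiv ℝ l) x (m i) (l x)), h3,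
      map_zero, zero_apply, mul_zero, zero_add]
  have hperp : ∀ i, minkForm n (l x) (minkSharp n (α i)) = 0 := fun i => by
    rw [minkForm_minkSharp_right, hα', hgeo x hx, map_zero, zero_apply]
  -- Summation produces the expansion, which is zero; each summand is nonnegative because the
  -- vectors lie in the complement of l.
  have hzero : ∀ i, minkForm n (minkSharp n (α i)) (minkSharp n (α i)) = 0 := by
    have h1 : H x * ∑ i, minkForm n (minkSharp n (α i)) (minkSharp n (α i)) = 0 := by
      rw [Finset.mul_sum, Finset.sum_congr rfl fun i _ => hsq i, ← Finset.mul_sum, hθ, mul_zero]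
    have h2 := (mul_eq_zero.1 h1).resolve_left hH
    rw [Finset.sum_eq_zero_iff_of_nonneg fun i _ => (h.form_nonneg hx hn (hperp i)).1] at h2
    exact fun i => h2 i (Finset.mem_univ i)
  have hYm : ∀ i, minkForm n (fderiv ℝ l x Y) (m i) = 0 := by
    intro i
    obtain ⟨c, hc⟩ := (h.form_nonneg hx hn (hperp i)).2 (hzero i)
    rw [← hα', ← minkForm_minkSharp, hc, map_smul, smul_apply, hY, smul_zero]
  refine h.eq_zero_of_form hx hn ?_
  obtain ⟨c, d, hcd⟩ := hL.screen_span hn (h.l_ne_zero hx) (h.null x hx) hlm hm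
    (h.form_fderiv hx Y)
  conv_lhs => enter [2]; rw [hcd]
  rw [map_add, map_smul, h.form_fderiv_right hx, smul_zero, zero_add, map_sum]
  exact Finset.sum_eq_zero fun i _ => by rw [map_smul, hYm, smul_zero]

/-- An equation between continuous functions holds on `U` if it holds where `H ≠ 0`. -/
theorem eq_zero_of_frequently {F : Type*} [NormedAddCommGroup F] (h : IsKerrSchildOn G H l o U)
    (hdense : ∀ x ∈ U, ∃ᶠ y in 𝓝 x, H y ≠ 0) {f : (Fin n → ℝ) → F} (hf : ContinuousOn f U)
    (hz : ∀ x ∈ U, H x ≠ 0 → f x = 0) (hx : x ∈ U) : f x = 0 := by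
  by_contra hne
  have hU := h.isOpen.mem_nhds hx
  have h1 := (hf.continuousAt hU).eventually_ne hne
  obtain ⟨y, hy1, hy2, hy3⟩ := ((hdense x hx).and_eventually (h1.and hU)).exists
  exact hy2 (hz y hy3 hy1)

theorem continuousOn_fderiv_l (h : IsKerrSchildOn G H l o U) : ContinuousOn (fderiv ℝ l) U :=
  h.smooth_l.continuousOn_fderiv_of_isOpen h.isOpen (by norm_cast)

/-- The congruence of a nonexpanding vacuum Kerr-Schild metric is constant along its orthogonal
complement. -/
theorem fderiv_l_eq (h : IsKerrSchildOn G H l o U) (hn : 2 ≤ n)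
    (hR : ∀ x ∈ U, RicciFlatAt G x) (hdense : ∀ x ∈ U, ∃ᶠ y in 𝓝 x, H y ≠ 0)
    (hexp : ∀ x ∈ U, ∃ m, IsScreen G l x m ∧ expansion G l x m = 0)
    (hx : x ∈ U) (v : Fin n → ℝ) :
    fderiv ℝ l x v = minkForm n (l x) v • -fderiv ℝ l x (Pi.single o 1) := by
  -- The geodetic property is needed on a neighbourhood, since it gets differentiated; density of H
  -- ≠ 0 extends it to all of U.
  have hgeo : ∀ y ∈ U, fderiv ℝ l y (l y) = 0 := fun y hy =>
    h.eq_zero_of_frequently hdense (f := fun z => fderiv ℝ l z (l z))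
      (h.continuousOn_fderiv_l.clm_apply h.smooth_l.continuousOn)
      (fun z hz hHz => h.fderiv_l_self hn hz (hR z hz) hHz) hy
  rw [← sub_eq_zero]
  refine h.eq_zero_of_frequently hdense (f := fun x => fderiv ℝ l x v -
    minkForm n (l x) v • -fderiv ℝ l x (Pi.single o 1)) ?_ (fun y hy hHy => ?_) hx
  · exact (h.continuousOn_fderiv_l.clm_apply continuousOn_const).sub
      ((((minkForm n).continuous.comp_continuousOn h.smooth_l.continuousOn).clm_apply
        continuousOn_const).smul (h.continuousOn_fderiv_l.clm_apply continuousOn_const).neg)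
  · obtain ⟨m, hm, hθ⟩ := hexp y hy
    have hl := (h.hasFDerivAt_l hy).differentiableAt
    rw [isScreen_iff] at hm
    have hlm : ∀ i, minkForm n (l y) (m i) = 0 := fun i => by rw [← h.metric_l hy]; exact hm.1 i
    have hmm : ∀ i j, minkForm n (m i) (m j) = if i = j then 1 else 0 := fun i j => by
      rw [← hm.2 i j, h.metric y hy, hlm]
      ring
    -- Once l is geodetic, the curved and the flat optical matrices agree on the diagonal for a
    -- screen, all connection terms containing ℓ(m_i) or dl(l).
    have hopt : ∀ i, optical G l y m i i = minkForm n (fderiv ℝ l y (m i)) (m i) := by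
      intro i
      rw [optical_eq hl, covDerivMap_apply, covariantDeriv, h.metric y hy, hlm i,
        h.connForm_eq hy, kerrSchildConn, minkForm_comm]
      simp only [hlm, h.null y hy, h.form_fderiv_right hy, hgeo y hy, mul_zero, zero_mul, add_zero, sub_zero,
        neg_zero, zero_smul, map_zero, zero_apply]
    rw [expansion, div_eq_zero_iff] at hθ
    have hθ' : ∑ i, minkForm n (fderiv ℝ l y (m i)) (m i) = 0 := by
      rcases hθ with hθ | hθ
      · simpa only [hopt] using hθ
      -- For n = 2 the expansion divides by zero and carries no information, but the sum over the
      -- screen is empty.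
      · have hn2 : n = 2 := by
          have : (n : ℝ) = 2 := by linarith
          exact_mod_cast this
        subst hn2
        rfl
    -- Since ℓ(e₀) = -1, the vector v + ℓ(v) e₀ is the projection of v along e₀ to the complement of
    -- l.
    have h1 := h.fderiv_l_eq_zero hn hy (hR y hy) hHy hgeo hlm hmm hθ'
      (Y := v + minkForm n (l y) v • Pi.single o 1) (by
        rw [map_add, map_smul, h.form_single hy, smul_eq_mul]
        ring)
    rw [map_add, map_smul] at h1
    rw [← h1]
    module

end IsKerrSchildOn

end KerrSchildVacuum

/-! ### Curvature along the leaves of a recurrent Kerr-Schild congruence -/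

section KerrSchildLeaves

open Coordinates

variable {n : ℕ} {G : (Fin n → ℝ) → Matrix (Fin n) (Fin n) ℝ} {H : (Fin n → ℝ) → ℝ}
  {l : (Fin n → ℝ) → (Fin n → ℝ)} {o : Fin n} {U : Set (Fin n → ℝ)} {x : Fin n → ℝ}

namespace IsKerrSchildOn

/-- Where H vanishes locally the metric is η. The contrapositive makes H ≠ 0 dense when the Weyl
tensor is nonzero on a dense set. -/
theorem curvature_eq_zero_of_eventually (h : IsKerrSchildOn G H l o U) (hx : x ∈ U)
    (hH : ∀ᶠ y in 𝓝 x, H y = 0) (u v w : Fin n → ℝ) : curvature (connForm G) x u v w = 0 := by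
  have h1 : connForm G =ᶠ[𝓝 x] fun _ => 0 := by
    filter_upwards [hH.eventually_nhds, h.isOpen.mem_nhds hx] with y hy hyU
    have h2 : fderiv ℝ H y = 0 := by
      rw [(show H =ᶠ[𝓝 y] fun _ => 0 from hy).fderiv_eq, fderiv_fun_const]
      rfl
    ext1 u
    ext1 v
    rw [h.connForm_eq hyU, kerrSchildConn, hy.self_of_nhds, h2]
    simp
  rw [curvature, h1.fderiv_eq, h1.self_of_nhds, fderiv_fun_const]
  simp

variable (h : IsKerrSchildOn G H l o U) (hrec : ∀ x ∈ U, ∀ v,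
    fderiv ℝ l x v = minkForm n (l x) v • -fderiv ℝ l x (Pi.single o 1))
include h hrec

/-- The connection of a Kerr-Schild metric with recurrent congruence. -/
theorem connForm_of_recurrent (hx : x ∈ U) (u v : Fin n → ℝ) :
    connForm G x u v =
      -(fderiv ℝ H x u * minkForm n (l x) v) • l x + minkForm n (l x) u •
        (-fderiv ℝ H x v • l x + minkForm n (l x) v • (minkSharp n (fderiv ℝ H x) +
          (2 * H x) • fderiv ℝ l x (Pi.single o 1) + (2 * H x * fderiv ℝ H x (l x)) • l x)) := by
  have h1 : ∀ v, (minkForm n).flip v ∘L fderiv ℝ l x =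
      -minkForm n (fderiv ℝ l x (Pi.single o 1)) v • minkForm n (l x) := by
    intro v
    ext w
    rw [ContinuousLinearMap.comp_apply, hrec x hx]
    simp [mul_comm]
  rw [h.connForm_eq hx, kerrSchildConn, h1, h1, hrec x hx u, hrec x hx v, hrec x hx (l x),
    h.null x hx]
  simp only [map_smul, minkSharp_minkForm, zero_smul, map_zero, zero_apply, map_neg, neg_apply,
    smul_apply, smul_eq_mul]
  module

theorem covDerivMap_of_recurrent (hx : x ∈ U) {u : Fin n → ℝ} (hu : minkForm n (l x) u = 0) :
    covDerivMap (connForm G) l x u = 0 := by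
  rw [covDerivMap_apply, covariantDeriv, h.connForm_of_recurrent hrec hx, hrec x hx, hu,
    h.null x hx]
  simp

/-- For u, v orthogonal to l, the derivative of Γ(v)w along u is -(∂_u∂_v H) ℓ(w) l, which is
symmetric in u and v, and the products Γ(u)Γ(v) vanish because l is null. -/
theorem leafFlatAt_of_recurrent (hx : x ∈ U) : LeafFlatAt G (l x) x := by
  intro u v hu hv w
  rw [h.metric_l hx] at hu hv
  have hΓ := h.lorentz.isLeviCivitaOn.hasFDerivAt_conn hx
  have hl := h.hasFDerivAt_l hx
  have hdl : ∀ u, minkForm n (l x) u = 0 → fderiv ℝ l x u = 0 := fun u hu => by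
    rw [hrec x hx, hu, zero_smul]
  have key : ∀ u v, minkForm n (l x) u = 0 → minkForm n (l x) v = 0 →
      fderiv ℝ (connForm G) x u v w =
        -(fderiv ℝ (fderiv ℝ H) x u v * minkForm n (l x) w) • l x := by
    intro u v hu hv
    have d1 := ((((h.hasFDerivAt_fderiv_H hx).clm_apply_const v).mul
      (h.hasFDerivAt_form hx w)).neg).smul hl
    set R : (Fin n → ℝ) → (Fin n → ℝ) := fun y => -fderiv ℝ H y w • l y +
      minkForm n (l y) w • (minkSharp n (fderiv ℝ H y) + (2 * H y) • fderiv ℝ l y (Pi.single o 1)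
        + (2 * H y * fderiv ℝ H y (l y)) • l y) with hR
    have hRd : DifferentiableAt ℝ R x := by
      have d2 := (h.hasFDerivAt_H hx).differentiableAt
      have d4 := (h.hasFDerivAt_fderiv_H hx).differentiableAt
      have d5 := (h.hasFDerivAt_form hx w).differentiableAt
      have d7 : DifferentiableAt ℝ (fun y => minkSharp n (fderiv ℝ H y)) x :=
        (minkSharp n).differentiableAt.comp x d4
      have d11 := (h.hasFDerivAt_fderiv_l hx).differentiableAt.clm_apply
        (differentiableAt_const (Pi.single o (1 : ℝ)))
      have d9 := d4.clm_apply hl.differentiableAt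
      have d10 := d4.clm_apply (differentiableAt_const w)
      rw [hR]
      exact (d10.neg.smul hl.differentiableAt).add (d5.smul ((d7.add
        ((d2.const_mul 2).smul d11)).add (((d2.const_mul 2).mul d9).smul hl.differentiableAt)))
    have d3 := d1.add ((h.hasFDerivAt_form hx v).smul hRd.hasFDerivAt)
    have d4 := (hΓ.clm_apply_const v).clm_apply_const w
    have d5 := DFunLike.congr_fun (d4.unique (d3.congr_of_eventuallyEq (by
      filter_upwards [h.isOpen.mem_nhds hx] with y hy
      rw [h.connForm_of_recurrent hrec hy]
      rfl))) u
    simp only [ContinuousLinearMap.flip_apply, add_apply, smul_apply, neg_apply,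
      ContinuousLinearMap.coe_comp, Function.comp_apply, ContinuousLinearMap.smulRight_apply,
      hdl u hu, hv, map_zero, zero_smul, smul_zero, add_zero, zero_add,
      smul_eq_mul] at d5
    rw [d5]
    module
  have hs : fderiv ℝ (fderiv ℝ H) x u v = fderiv ℝ (fderiv ℝ H) x v u :=
    ((h.smooth_H.contDiffAt (h.isOpen.mem_nhds hx)).isSymmSndFDerivAt
      minSmoothness_two_le_infty).eq _ _
  have hΓΓ : ∀ u v, minkForm n (l x) u = 0 → minkForm n (l x) v = 0 →
      connForm G x u (connForm G x v w) = 0 := by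
    intro u v hu hv
    rw [h.connForm_of_recurrent hrec hx v, hv, h.connForm_of_recurrent hrec hx u, hu]
    simp [h.null x hx]
  rw [curvature, key u v hu hv, key v u hv hu, hΓΓ u v hu hv, hΓΓ v u hv hu, hs]
  simp

end IsKerrSchildOn

end KerrSchildLeaves

/-! ### Rescaling of the congruence -/

section Rescaling

open Coordinates

variable {n : ℕ} {G : (Fin n → ℝ) → Matrix (Fin n) (Fin n) ℝ} {U : Set (Fin n → ℝ)}
  {K l : (Fin n → ℝ) → (Fin n → ℝ)} {f : (Fin n → ℝ) → ℝ} {x : Fin n → ℝ}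

theorem covDerivMap_smul {E : Type*} [NormedAddCommGroup E] [NormedSpace ℝ E]
    {Γ : E → E →L[ℝ] E →L[ℝ] E} {K l : E → E} {f : E → ℝ} {x : E} (hf : DifferentiableAt ℝ f x)
    (hl : DifferentiableAt ℝ l x) (hK : K =ᶠ[𝓝 x] fun y => f y • l y) (u : E) :
    covDerivMap Γ K x u = fderiv ℝ f x u • l x + f x • covDerivMap Γ l x u := by
  have h1 : HasFDerivAt (fun y => f y • l y) _ x := hf.hasFDerivAt.smul hl.hasFDerivAt
  simp only [covDerivMap, add_apply, ContinuousLinearMap.flip_apply]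
  rw [hK.fderiv_eq, hK.self_of_nhds, h1.fderiv]
  simp only [add_apply, smul_apply, ContinuousLinearMap.smulRight_apply, map_smul]
  module

/-- The derivative of the factor contributes a multiple of l, which is orthogonal to the screen.
Hence zero expansion survives the normalisation of k. -/
theorem optical_smul (hf : DifferentiableAt ℝ f x)
    (hl : DifferentiableAt ℝ l x) (hK : K =ᶠ[𝓝 x] fun y => f y • l y)
    (hL : IsLorentzForm (metricForm G x))
    {m : Fin (n - 2) → (Fin n → ℝ)} (hm : ∀ i, metricForm G x (l x) (m i) = 0) (i j : Fin (n - 2)) :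
    optical G K x m i j = f x * optical G l x m i j := by
  have hKd : DifferentiableAt ℝ K x := (hf.smul hl).congr_of_eventuallyEq hK
  rw [optical_eq hKd, optical_eq hl, covDerivMap_smul hf hl hK, map_add, map_smul, map_smul,
    hL.symm, hm, smul_zero, zero_add, smul_eq_mul]

end Rescaling

/-! ### Nonexpanding Kerr-Schild congruences are Kundt, and the Weyl tensor is of type N -/

section KerrSchildManifold

open Coordinates IsManifold

variable {n : ℕ}

theorem minkowski_mul_self (n : ℕ) : minkowski n * minkowski n = 1 := by
  rw [minkowski, Matrix.diagonal_mul_diagonal, ← Matrix.diagonal_one]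
  congr 1
  funext a
  split_ifs <;> norm_num

theorem minkowski_inv (n : ℕ) : (minkowski n)⁻¹ = minkowski n :=
  Matrix.inv_eq_right_inv (minkowski_mul_self n)

theorem minkForm_minkowski_mulVec (κ v : Fin n → ℝ) :
    minkForm n (minkowski n *ᵥ κ) v = κ ⬝ᵥ v := by
  rw [minkForm_comm, minkForm_apply, Matrix.mulVec_mulVec, minkowski_mul_self, Matrix.one_mulVec,
    dotProduct_comm]

theorem minkForm_null_zeroth (hn : 0 < n) {v : Fin n → ℝ} (hv : minkForm n v v = 0)
    (h0 : v ⟨0, hn⟩ = 0) : v = 0 := by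
  rw [minkForm_apply, minkowski_form_eq hn, h0, mul_zero, mul_zero, sub_zero,
    Finset.sum_eq_zero_iff_of_nonneg fun a _ => mul_self_nonneg _] at hv
  funext a
  exact mul_self_eq_zero.1 (hv a (Finset.mem_univ a))

theorem metricForm_of_kerrSchild {G : (Fin n → ℝ) → Matrix (Fin n) (Fin n) ℝ} {x : Fin n → ℝ}
    {H : ℝ} {κ : Fin n → ℝ} (h : ∀ a b, G x a b = minkowski n a b - 2 * H * κ a * κ b)
    (u v : Fin n → ℝ) : metricForm G x u v = minkForm n u v -
      2 * H * minkForm n (minkowski n *ᵥ κ) u * minkForm n (minkowski n *ᵥ κ) v := by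
  revert u
  refine eq_of_isLinearMap_of_single ⟨fun _ _ => by simp, fun _ _ => by simp⟩
    ⟨fun _ _ => by simp; ring, fun _ _ => by simp; ring⟩ fun a => ?_
  revert v
  refine eq_of_isLinearMap_of_single ⟨fun _ _ => by simp, fun _ _ => by simp⟩
    ⟨fun _ _ => by simp; ring, fun _ _ => by simp; ring⟩ fun b => ?_
  rw [metricForm_single, h, minkForm_minkowski_mulVec, minkForm_minkowski_mulVec, minkForm,
    metricForm_single]
  simp

variable {M : Type*} [TopologicalSpace M] [ChartedSpace (Fin n → ℝ) M]
  {g : LorentzMetric n M} {k : ∀ p : M, TangentSpace 𝓘(ℝ, Fin n → ℝ) p}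
  {e : OpenPartialHomeomorph M (Fin n → ℝ)}

namespace LorentzMetric

/-- The Kerr-Schild form of a metric in terms of the rescaled congruence. -/
theorem isKerrSchildOn_of_chart (hn : 0 < n) (hk : g.IsNullCongruence k)
    (he : e ∈ maximalAtlas 𝓘(ℝ, Fin n → ℝ) ∞ M) {H : (Fin n → ℝ) → ℝ}
    {κ : (Fin n → ℝ) → (Fin n → ℝ)} (hH : ContDiffOn ℝ ∞ H e.target)
    (hκ : ∀ x ∈ e.target, κ x ⬝ᵥ ((minkowski n)⁻¹ *ᵥ κ x) = 0 ∧
      vectorInChart k e x = (minkowski n)⁻¹ *ᵥ κ x ∧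
      ∀ a b, g.inChart e x a b = minkowski n a b - 2 * H x * κ x a * κ x b) :
    (∀ x ∈ e.target, vectorInChart k e x ⟨0, hn⟩ ≠ 0) ∧
    IsKerrSchildOn (g.inChart e) (fun x => H x * vectorInChart k e x ⟨0, hn⟩ ^ 2)
      (fun x => (vectorInChart k e x ⟨0, hn⟩)⁻¹ • vectorInChart k e x) ⟨0, hn⟩ e.target := by
  simp only [minkowski_inv] at hκ
  have hnull : ∀ x ∈ e.target, minkForm n (vectorInChart k e x) (vectorInChart k e x) = 0 := by
    intro x hx
    obtain ⟨h1, h2, -⟩ := hκ x hx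
    nth_rw 1 [h2]
    rw [minkForm_minkowski_mulVec, h2, h1]
  have h0 : ∀ x ∈ e.target, vectorInChart k e x ⟨0, hn⟩ ≠ 0 := fun x hx h0 =>
    (hk.inChart he hx).1 (minkForm_null_zeroth hn (hnull x hx) h0)
  have hs0 : ContDiffOn ℝ ∞ (fun x => vectorInChart k e x ⟨0, hn⟩) e.target :=
    contDiffOn_pi.1 (hk.1 e he) _
  refine ⟨h0, g.isLorentzMetricOn he, hH.mul (hs0.pow 2), (hs0.inv h0).smul (hk.1 e he), ?_, rfl,
    ?_, ?_⟩
  · intro x hx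
    simp [hnull x hx]
  · intro x hx
    simp [h0 x hx]
  · intro x hx u v
    obtain ⟨h1, h2, h3⟩ := hκ x hx
    rw [metricForm_of_kerrSchild h3, ← h2]
    have := h0 x hx
    simp only [map_smul, smul_apply, smul_eq_mul]
    field_simp

/-- The local analysis is done for the rescaled field in the Kerr-Schild chart; both conclusions are
unaffected by the rescaling and are later carried to other charts. -/
theorem IsKerrSchildCongruence.kundt_leafFlat (hn : 2 ≤ n) (hvac : g.IsVacuum)
    (hflat : Dense {p : M | ¬ g.WeylVanishesAt p}) (hk : g.IsKerrSchildCongruence k)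
    (hexp : g.IsNonexpanding k) (p : M) :
    ∃ e ∈ maximalAtlas 𝓘(ℝ, Fin n → ℝ) ∞ M, p ∈ e.source ∧
      IsKundtAt (g.inChart e) (vectorInChart k e) (e p) ∧
      LeafFlatAt (g.inChart e) (vectorInChart k e (e p)) (e p) := by
  obtain ⟨hnc, hKS⟩ := hk
  obtain ⟨e, he, hp, H, κ, hH, -, hκ⟩ := hKS p
  have hn0 : 0 < n := by omega
  obtain ⟨h0, h⟩ := isKerrSchildOn_of_chart hn0 hnc he hH hκ
  refine ⟨e, he, hp, ?_⟩
  set K := vectorInChart k e with hK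
  set o : Fin n := ⟨0, hn0⟩
  set l : (Fin n → ℝ) → (Fin n → ℝ) := fun x => (K x o)⁻¹ • K x with hl
  have hKl : ∀ x ∈ e.target, K x = K x o • l x := fun x hx => by
    rw [hl, smul_inv_smul₀ (h0 x hx)]
  have hKl' : ∀ x ∈ e.target, K =ᶠ[𝓝 x] fun y => K y o • l y := fun x hx => by
    filter_upwards [e.open_target.mem_nhds hx] with y hy using hKl y hy
  have hdK : ∀ x ∈ e.target, DifferentiableAt ℝ (fun y => K y o) x := fun x hx =>
    differentiableAt_pi.1 (((hnc.1 e he).contDiffAt (e.open_target.mem_nhds hx)).differentiableAt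
      (by simp)) o
  have hR : ∀ x ∈ e.target, RicciFlatAt (g.inChart e) x := fun x hx => hvac.ricciFlatAt he hx
  have hperp : ∀ x ∈ e.target, ∀ u, metricForm (g.inChart e) x (K x) u = 0 ↔
      metricForm (g.inChart e) x (l x) u = 0 := fun x hx u => by
    nth_rw 1 [hKl x hx]
    rw [map_smul, smul_apply, smul_eq_mul, mul_eq_zero, or_iff_right (h0 x hx)]
  -- If the rescaled H vanished near x, the curvature would vanish on an open set, which would
  -- contain a point with nonzero Weyl tensor.
  have hdense : ∀ x ∈ e.target, ∃ᶠ y in 𝓝 x, H y * K y o ^ 2 ≠ 0 := by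
    intro x hx hcon
    simp only [ne_eq, not_not] at hcon
    obtain ⟨V, hV, hVo, hxV⟩ := _root_.eventually_nhds_iff.1
      (hcon.and (e.open_target.mem_nhds hx))
    obtain ⟨q, hq, hqW⟩ := hflat.inter_open_nonempty _ (e.isOpen_inter_preimage hVo)
      ⟨e.symm x, e.map_target hx, by simpa [e.right_inv hx] using hxV⟩
    refine hqW ((weylVanishesAt_iff hvac he hq.1).2 ?_)
    have hqt := e.map_source hq.1
    rw [(g.isLorentzMetricOn he).weylVanishes_iff hqt (hR _ hqt)]
    refine h.curvature_eq_zero_of_eventually hqt ?_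
    filter_upwards [hVo.mem_nhds hq.2] with y hy using (hV y hy).1
  have hexp' : ∀ x ∈ e.target, ∃ m, IsScreen (g.inChart e) l x m ∧
      expansion (g.inChart e) l x m = 0 := by
    intro x hx
    obtain ⟨m, hm, hθ⟩ := hexp e he x hx
    rw [isScreen_iff] at hm
    have hlm : ∀ i, metricForm (g.inChart e) x (l x) (m i) = 0 := fun i =>
      (hperp x hx _).1 (hm.1 i)
    refine ⟨m, (isScreen_iff _).2 ⟨hlm, hm.2⟩, ?_⟩
    have hopt : ∀ i, optical (g.inChart e) K x m i i = K x o * optical (g.inChart e) l x m i i :=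
      fun i => optical_smul (hdK x hx) (h.hasFDerivAt_l hx).differentiableAt (hKl' x hx)
        (h.lorentz.lorentz x hx) hlm i i
    rw [expansion, Finset.sum_congr rfl fun i _ => hopt i, ← Finset.mul_sum] at hθ
    rw [mul_div_assoc, mul_eq_zero, or_iff_right (h0 x hx)] at hθ
    exact hθ
  have hrec : ∀ x ∈ e.target, ∀ v, fderiv ℝ l x v =
      minkForm n (l x) v • -fderiv ℝ l x (Pi.single o 1) := fun x hx v =>
    h.fderiv_l_eq hn hR hdense hexp' hx v
  have hx := e.map_source hp
  constructor
  · intro u hu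
    rw [hperp _ hx, h.metric_l hx] at hu
    refine ⟨fderiv ℝ (fun y => K y o) (e p) u * (K (e p) o)⁻¹, ?_⟩
    rw [covDerivMap_smul (hdK _ hx) (h.hasFDerivAt_l hx).differentiableAt (hKl' _ hx),
      h.covDerivMap_of_recurrent hrec hx hu, smul_zero, add_zero, hl, smul_smul]
  · intro u v hu hv
    rw [hperp _ hx] at hu hv
    exact h.leafFlatAt_of_recurrent hrec hx u v hu hv

theorem kundt_typeN_of_kerrSchild (hn : 2 ≤ n) (hvac : g.IsVacuum)
    (hflat : Dense {p : M | ¬ g.WeylVanishesAt p}) (hk : g.IsKerrSchildCongruence k)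
    (hexp : g.IsNonexpanding k) : g.IsKundtCongruence k ∧ g.IsWeylTypeN := by
  have h := hk.kundt_leafFlat hn hvac hflat hexp
  refine ⟨(isKundtCongruence_iff hn).2 ⟨hk.1, fun e' he' x hx => ?_⟩,
    isWeylTypeN_of_leafFlatAt hn hvac hk.1 fun p => ?_⟩
  · obtain ⟨e, he, hpe, hkundt, -⟩ := h (e'.symm x)
    have := isKundtAt_transition he he' hk.1 (mem_overlap hpe (e'.map_target hx)) hkundt
    rwa [Function.comp_apply, e.left_inv hpe, e'.right_inv hx] at this
  · obtain ⟨e, he, hpe, -, hleaf⟩ := h p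
    exact ⟨e, he, hpe, hleaf⟩

end LorentzMetric

end KerrSchildManifold

/-! ### Straightening an integrable hyperplane field -/

section Foliations

universe u

theorem fderiv_frobenius_snd {V Z : Type u} [NormedAddCommGroup V] [NormedSpace ℝ V]
    [NormedAddCommGroup Z] [NormedSpace ℝ Z] {Φ : V × Z → Z} {z₀ : Z} {ε : ℝ}
    (hε : 0 < ε) (hΦ : ContDiffOn ℝ ∞ Φ (ball 0 ε ×ˢ ball z₀ ε))
    (h0 : ∀ z ∈ ball z₀ ε, Φ (0, z) = z) {z : Z} (hz : z ∈ ball z₀ ε) (w : Z) :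
    fderiv ℝ Φ (0, z) (0, w) = w := by
  have hΦd : HasFDerivAt Φ (fderiv ℝ Φ (0, z)) (0, z) :=
    ((hΦ.contDiffAt ((isOpen_ball.prod isOpen_ball).mem_nhds
      ⟨mem_ball_self hε, hz⟩)).differentiableAt (by simp)).hasFDerivAt
  have h1 : HasFDerivAt (fun z : Z => ((0 : V), z)) (ContinuousLinearMap.inr ℝ V Z) z :=
    hasFDerivAt_prodMk_right 0 z
  have h2 := hΦd.comp z h1
  have h3 := h2.unique ((hasFDerivAt_id z).congr_of_eventuallyEq (by
    filter_upwards [isOpen_ball.mem_nhds hz] with y hy using h0 y hy))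
  exact DFunLike.congr_fun h3 w

variable {E : Type u} [NormedAddCommGroup E] [NormedSpace ℝ E]

/-- The projection along `e` onto the kernel of `lam`. -/
def kerProj (lam : E →L[ℝ] ℝ) (e : E) : E →L[ℝ] E :=
  ContinuousLinearMap.id ℝ E - lam.smulRight e

@[simp]
theorem kerProj_apply (lam : E →L[ℝ] ℝ) (e v : E) : kerProj lam e v = v - lam v • e := rfl

theorem kerProj_of_mem {lam : E →L[ℝ] ℝ} {v : E} (e : E) (hv : lam v = 0) :
    kerProj lam e v = v := by simp [hv]

theorem apply_kerProj {lam : E →L[ℝ] ℝ} {e : E} (he : lam e = 1) (v : E) :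
    lam (kerProj lam e v) = 0 := by simp [he]

/-- Coordinates in which the integrable hyperplane field `ker α` is constant. -/
theorem exists_straightening [FiniteDimensional ℝ E] {α : E → E →L[ℝ] ℝ} {U : Set E}
    (hU : IsOpen U) (hα : ContDiffOn ℝ ∞ α U) {e : E} (he : ∀ x ∈ U, α x e = 1)
    (hint : ∀ x ∈ U, ∀ u v, α x u = 0 → α x v = 0 → fderiv ℝ α x u v = fderiv ℝ α x v u)
    {x₀ : E} (hx₀ : x₀ ∈ U) :
    ∃ h : OpenPartialHomeomorph E E, 0 ∈ h.source ∧ h 0 = x₀ ∧ (∀ y ∈ h.source, h y ∈ U) ∧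
      ContDiffOn ℝ ∞ h h.source ∧ ContDiffOn ℝ ∞ h.symm h.target ∧
      ∀ y ∈ h.source, ∀ v, α x₀ v = 0 → α (h y) (fderiv ℝ h y v) = 0 := by
  have : CompleteSpace E := FiniteDimensional.complete ℝ E
  -- The total differential equation dz = A(z) moves z only within ker α.
  set A : E → E →L[ℝ] E := fun x => kerProj (α x) e with hAdef
  have hA : ContDiffOn ℝ ∞ A U := contDiffOn_const.sub (hα.smulRight contDiffOn_const)
  have hαd : ∀ x ∈ U, HasFDerivAt α (fderiv ℝ α x) x := fun x hx =>
    ((hα.contDiffAt (hU.mem_nhds hx)).differentiableAt (by simp)).hasFDerivAt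
  have hα0 : ∀ x ∈ U, ∀ u, fderiv ℝ α x u e = 0 := by
    intro x hx u
    have h1 := ((hαd x hx).clm_apply_const e).unique
      ((hasFDerivAt_const (1 : ℝ) x).congr_of_eventuallyEq (by
        filter_upwards [hU.mem_nhds hx] with y hy using he y hy))
    exact DFunLike.congr_fun h1 u
  have hAd : ∀ x ∈ U, ∀ u w, fderiv ℝ A x u w = -(fderiv ℝ α x u w • e) := by
    intro x hx u w
    have h1 := (((hαd x hx).clm_apply_const w).smul_const e).const_sub w
    have h2 := (((hA.contDiffAt (hU.mem_nhds hx)).differentiableAt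
      (by simp)).hasFDerivAt.clm_apply_const w)
    exact DFunLike.congr_fun (h2.unique h1) u
  -- As α(e) = 1 is constant, dα(u)(e) = 0, so each vector may be replaced by its projection to ker
  -- α, where dα is symmetric.
  have hAint : ∀ x ∈ U, ∀ v w, fderiv ℝ A x (A x v) w = fderiv ℝ A x (A x w) v := by
    intro x hx v w
    have h1 : ∀ u w, fderiv ℝ α x u w = fderiv ℝ α x u (A x w) := fun u w => by
      simp [hAdef, hα0 x hx]
    rw [hAd x hx, hAd x hx, h1 _ w, h1 _ v, hint x hx _ _ (apply_kerProj (he x hx) v)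
      (apply_kerProj (he x hx) w)]
  obtain ⟨Φ, ε, hε, hΦ, hΦ0, hΦd⟩ := exists_frobenius_solution hU hA hAint hx₀
  set lam := α x₀ with hlam
  -- The new coordinates start on the transversal line x₀ + λ(y)e and then move inside the leaf by
  -- the component of y in ker λ; their derivative at 0 is the identity.
  set m : E → E × E := fun y => (kerProj lam e y, x₀ + lam y • e) with hm
  have hmd : ∀ y, HasFDerivAt m ((kerProj lam e).prod (lam.smulRight e)) y := fun y =>
    (kerProj lam e).hasFDerivAt.prodMk (((lam.smulRight e).hasFDerivAt).const_add x₀)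
  have hms : ContDiff ℝ ∞ m :=
    (kerProj lam e).contDiff.prodMk (contDiff_const.add (lam.smulRight e).contDiff)
  have hball : IsOpen (ball (0 : E) ε ×ˢ ball x₀ ε) := isOpen_ball.prod isOpen_ball
  set O := m ⁻¹' (ball (0 : E) ε ×ˢ ball x₀ ε) with hO
  have hOo : IsOpen O := hball.preimage hms.continuous
  have hψ : ContDiffOn ℝ ∞ (Φ ∘ m) O := hΦ.comp hms.contDiffOn fun y hy => hy
  have hm0 : m 0 = (0, x₀) := by simp [hm]
  have h0O : (0 : E) ∈ O := by
    rw [hO, mem_preimage, hm0]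
    exact ⟨mem_ball_self hε, mem_ball_self hε⟩
  have hψd : ∀ y ∈ O, HasFDerivAt (Φ ∘ m)
      (fderiv ℝ Φ (m y) ∘L (kerProj lam e).prod (lam.smulRight e)) y := fun y hy =>
    HasFDerivAt.comp y ((hΦ.contDiffAt (hball.mem_nhds hy)).differentiableAt
      (by simp)).hasFDerivAt (hmd y)
  have hψ0 : HasFDerivAt (Φ ∘ m) ((ContinuousLinearEquiv.refl ℝ E : E ≃L[ℝ] E) : E →L[ℝ] E) 0 := by
    refine (hψd 0 h0O).congr_fderiv ?_
    ext v
    have h1 : ((kerProj lam e).prod (lam.smulRight e)) v =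
        (kerProj lam e v, 0) + (0, lam v • e) := by simp
    rw [ContinuousLinearMap.comp_apply, hm0, h1, map_add,
      (hΦd 0 (mem_ball_self hε) x₀ (mem_ball_self hε)).2, hΦ0 x₀ (mem_ball_self hε),
      fderiv_frobenius_snd hε hΦ hΦ0 (mem_ball_self hε), hAdef]
    simp [he x₀ hx₀, hlam]
  obtain ⟨h, hh, h0, hsub, hsymm⟩ := exists_smooth_localInverse hOo hψ h0O hψ0
  refine ⟨h, h0, ?_, ?_, ?_, hsymm, ?_⟩
  · rw [hh, Function.comp_apply, hm0, hΦ0 x₀ (mem_ball_self hε)]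
  · intro y hy
    rw [hh]
    exact (hΦd _ (hsub hy).1 _ (hsub hy).2).1
  · rw [hh]
    exact hψ.mono hsub
  · intro y hy v hv
    have h1 := hΦd _ (hsub hy).1 _ (hsub hy).2
    have h2 : ((kerProj lam e).prod (lam.smulRight e)) v = (v, 0) := by simp [hv]
    rw [hh, (hψd y (hsub hy)).fderiv, ContinuousLinearMap.comp_apply, h2]
    refine (congrArg _ (h1.2 v)).trans ?_
    exact apply_kerProj (he _ h1.1) v

end Foliations

/-! ### Parallel coframes along flat leaves -/

section Coframes

variable {E : Type} [NormedAddCommGroup E] [NormedSpace ℝ E]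

/-- The system for a point, a parallel coframe and its primitive, in the directions `π v`. -/
def coframeSystem {V : Type} [NormedAddCommGroup V] [NormedSpace ℝ V] (Γ : E → E →L[ℝ] E →L[ℝ] E)
    (π : V →L[ℝ] E) (z : E × (E →L[ℝ] E) × E) : V →L[ℝ] E × (E →L[ℝ] E) × E :=
  π.prod (((ContinuousLinearMap.compL ℝ E E E z.2.1).comp ((Γ z.1).comp π)).prod (z.2.1.comp π))

theorem coframeSystem_apply {V : Type} [NormedAddCommGroup V] [NormedSpace ℝ V]
    (Γ : E → E →L[ℝ] E →L[ℝ] E) (π : V →L[ℝ] E) (z : E × (E →L[ℝ] E) × E) (v : V) :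
    coframeSystem Γ π z v = (π v, z.2.1.comp (Γ z.1 (π v)), z.2.1 (π v)) := rfl

/-- Of the three integrability conditions, the one for the point is trivial, the one for the coframe
is the vanishing of the curvature on the image of π, and the one for the primitive is the symmetry
of Γ. -/
theorem exists_coframeSystem_solution [FiniteDimensional ℝ E] {V : Type} [NormedAddCommGroup V]
    [NormedSpace ℝ V] [FiniteDimensional ℝ V] {Γ : E → E →L[ℝ] E →L[ℝ] E} {U : Set E}
    (hU : IsOpen U) (hΓ : ContDiffOn ℝ ∞ Γ U) (htor : ∀ x ∈ U, ∀ u v, Γ x u v = Γ x v u)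
    (π : V →L[ℝ] E) (hflat : ∀ x ∈ U, ∀ u v w, curvature Γ x (π u) (π v) w = 0)
    {z₀ : E × (E →L[ℝ] E) × E} (hz₀ : z₀.1 ∈ U) :
    ∃ Φ : V × (E × (E →L[ℝ] E) × E) → E × (E →L[ℝ] E) × E, ∃ ε > 0,
      ContDiffOn ℝ ∞ Φ (ball 0 ε ×ˢ ball z₀ ε) ∧
      (∀ z ∈ ball z₀ ε, Φ (0, z) = z) ∧
      ∀ v ∈ ball (0 : V) ε, ∀ z ∈ ball z₀ ε, (Φ (v, z)).1 ∈ U ∧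
        ∀ w, fderiv ℝ Φ (v, z) (w, 0) = coframeSystem Γ π (Φ (v, z)) w := by
  have : CompleteSpace V := FiniteDimensional.complete ℝ V
  have hO : IsOpen {z : E × (E →L[ℝ] E) × E | z.1 ∈ U} := hU.preimage continuous_fst
  have hs : ContDiffOn ℝ ∞ (coframeSystem Γ π) {z | z.1 ∈ U} := by
    rw [contDiffOn_clm_apply]
    intro v
    simp only [coframeSystem_apply]
    have h1 : ContDiffOn ℝ ∞ (fun z : E × (E →L[ℝ] E) × E => z.2.1) {z | z.1 ∈ U} :=
      (contDiff_fst.comp contDiff_snd).contDiffOn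
    exact contDiffOn_const.prodMk ((h1.clm_comp ((hΓ.comp contDiffOn_fst fun z hz => hz).clm_apply
      contDiffOn_const)).prodMk (h1.clm_apply contDiffOn_const))
  refine exists_frobenius_solution hO hs (fun z hz u v => ?_) hz₀
  have hΓd : HasFDerivAt Γ (fderiv ℝ Γ z.1) z.1 :=
    ((hΓ.contDiffAt (hU.mem_nhds hz)).differentiableAt (by simp)).hasFDerivAt
  have h1 : HasFDerivAt (fun z : E × (E →L[ℝ] E) × E => z.2.1) ((ContinuousLinearMap.fst ℝ _ _).comp
      (ContinuousLinearMap.snd ℝ E ((E →L[ℝ] E) × E))) z :=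
    ((ContinuousLinearMap.fst ℝ (E →L[ℝ] E) E).comp
      (ContinuousLinearMap.snd ℝ E ((E →L[ℝ] E) × E))).hasFDerivAt
  have h2 : ∀ v, HasFDerivAt (fun z : E × (E →L[ℝ] E) × E => Γ z.1 (π v))
      (((fderiv ℝ Γ z.1).flip (π v)).comp (ContinuousLinearMap.fst ℝ E ((E →L[ℝ] E) × E))) z :=
    fun v => (hΓd.clm_apply_const (π v)).comp z hasFDerivAt_fst
  have hd : ∀ v, HasFDerivAt (fun z => coframeSystem Γ π z v) _ z := fun v =>
    (hasFDerivAt_const (π v) z).prodMk ((h1.clm_comp (h2 v)).prodMk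
      (h1.clm_apply (hasFDerivAt_const (π v) z)))
  have hA : ∀ d v, fderiv ℝ (coframeSystem Γ π) z d v =
      (0, z.2.1.comp (fderiv ℝ Γ z.1 d.1 (π v)) + d.2.1.comp (Γ z.1 (π v)), d.2.1 (π v)) := by
    intro d v
    rw [← fderiv_apply_const ((hs.contDiffAt (hO.mem_nhds hz)).differentiableAt (by simp)),
      (hd v).fderiv]
    simp
  rw [hA, hA]
  simp only [coframeSystem_apply, Prod.mk.injEq, true_and, ContinuousLinearMap.comp_apply]
  refine ⟨?_, by rw [htor _ hz]⟩
  ext w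
  have h3 := congrArg z.2.1 (hflat _ hz u v w)
  rw [curvature, map_sub, map_add, map_sub, map_zero] at h3
  simp only [add_apply, ContinuousLinearMap.comp_apply]
  rw [← sub_eq_zero, ← h3]
  abel

/-- A coframe that is parallel along the leaves `lam = const` and along the line spanned by `e`,
with its primitive. -/
theorem exists_coframe [FiniteDimensional ℝ E] {Γ : E → E →L[ℝ] E →L[ℝ] E} {U : Set E}
    (hU : IsOpen U) (hΓ : ContDiffOn ℝ ∞ Γ U) (htor : ∀ x ∈ U, ∀ u v, Γ x u v = Γ x v u)
    (h0 : 0 ∈ U) {lam : E →L[ℝ] ℝ} {e : E} (he : lam e = 1)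
    (hflat : ∀ x ∈ U, ∀ u v w, lam u = 0 → lam v = 0 → curvature Γ x u v w = 0)
    (θ₀ : E →L[ℝ] E) :
    ∃ ε > 0, ∃ θ : E → E →L[ℝ] E, ∃ Ξ : E → E, ball 0 ε ⊆ U ∧ ContDiffOn ℝ ∞ θ (ball 0 ε) ∧
      ContDiffOn ℝ ∞ Ξ (ball 0 ε) ∧ θ 0 = θ₀ ∧
      (∀ x ∈ ball 0 ε, ∀ v, lam v = 0 →
        fderiv ℝ θ x v = (θ x).comp (Γ x v) ∧ fderiv ℝ Ξ x v = θ x v) ∧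
      ∀ t : ℝ, t • e ∈ ball (0 : E) ε →
        fderiv ℝ θ (t • e) e = (θ (t • e)).comp (Γ (t • e) e) ∧
        fderiv ℝ Ξ (t • e) e = θ (t • e) e := by
  set z₀ : E × (E →L[ℝ] E) × E := (0, θ₀, 0) with hz₀
  set π₁ : ℝ →L[ℝ] E := (ContinuousLinearMap.id ℝ ℝ).smulRight e with hπ₁
  set π := kerProj lam e with hπ
  -- Along a line the curvature condition is empty by skewness, so the same system serves for the
  -- transversal curve.
  obtain ⟨Φ₁, ε₁, hε₁, hs₁, hi₁, hd₁⟩ := exists_coframeSystem_solution hU hΓ htor π₁ (by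
    intro x hx u v w
    simp only [hπ₁, curvature, ContinuousLinearMap.smulRight_apply, ContinuousLinearMap.id_apply,
      map_smul, smul_apply, smul_comm u v]
    abel) (z₀ := z₀) h0
  obtain ⟨Φ₂, ε₂, hε₂, hs₂, hi₂, hd₂⟩ := exists_coframeSystem_solution hU hΓ htor π
    (fun x hx u v w => hflat x hx _ _ w (apply_kerProj he u) (apply_kerProj he v)) (z₀ := z₀) h0
  -- the curve over the line, and the extension along the leaves
  set γ : ℝ → E × (E →L[ℝ] E) × E := fun t => Φ₁ (t, z₀) with hγ
  have hγ0 : γ 0 = z₀ := hi₁ z₀ (mem_ball_self hε₁)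
  have hγs : ContDiffOn ℝ ∞ γ (ball 0 ε₁) :=
    hs₁.comp (contDiffOn_id.prodMk contDiffOn_const) fun t ht => ⟨ht, mem_ball_self hε₁⟩
  have hγd : ∀ t ∈ ball (0 : ℝ) ε₁, HasDerivAt γ (coframeSystem Γ π₁ (γ t) 1) t := by
    intro t ht
    have h1 : HasFDerivAt Φ₁ (fderiv ℝ Φ₁ (t, z₀)) (t, z₀) :=
      ((hs₁.contDiffAt ((isOpen_ball.prod isOpen_ball).mem_nhds
        ⟨ht, mem_ball_self hε₁⟩)).differentiableAt (by simp)).hasFDerivAt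
    have h2 : HasDerivAt (fun t : ℝ => (t, z₀)) (1, 0) t :=
      (hasDerivAt_id t).prodMk (hasDerivAt_const t z₀)
    have h3 := h1.comp_hasDerivAt t h2
    rwa [(hd₁ t ht z₀ (mem_ball_self hε₁)).2] at h3
  have hγ1 : ∀ t ∈ ball (0 : ℝ) ε₁, (γ t).1 = t • e := by
    intro t ht
    have h1 : ∀ s ∈ ball (0 : ℝ) ε₁, HasDerivAt (fun s => (γ s).1 - s • e) 0 s := by
      intro s hs
      have h2 := (ContinuousLinearMap.fst ℝ E ((E →L[ℝ] E) × E)).hasFDerivAt.comp_hasDerivAt s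
        (hγd s hs)
      have h3 : HasDerivAt (fun s => (γ s).1 - s • e) _ s :=
        h2.sub ((hasDerivAt_id s).smul_const e)
      simpa [coframeSystem_apply, hπ₁] using h3
    have h2 := (convex_ball (0 : ℝ) ε₁).is_const_of_fderivWithin_eq_zero (𝕜 := ℝ)
      (f := fun s => (γ s).1 - s • e)
      (fun s hs => (h1 s hs).differentiableAt.differentiableWithinAt) (fun s hs => by
        rw [fderivWithin_of_isOpen isOpen_ball hs]
        ext
        simpa using (h1 s hs).deriv) ht (mem_ball_self hε₁)
    simp only [hγ0, hz₀, zero_smul, sub_zero] at h2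
    exact sub_eq_zero.1 h2
  obtain ⟨δ₁, hδ₁, hδ₁γ⟩ : ∃ δ > 0, ∀ t ∈ ball (0 : ℝ) δ, t ∈ ball (0 : ℝ) ε₁ ∧ γ t ∈ ball z₀ ε₂ := by
    have h1 : ContinuousAt γ 0 := (hγd 0 (mem_ball_self hε₁)).continuousAt
    have h2 : ∀ᶠ t in 𝓝 (0 : ℝ), t ∈ ball (0 : ℝ) ε₁ ∧ γ t ∈ ball z₀ ε₂ := by
      filter_upwards [isOpen_ball.mem_nhds (mem_ball_self hε₁),
        h1 (isOpen_ball.mem_nhds (by rw [hγ0]; exact mem_ball_self hε₂))] with t h h' using ⟨h, h'⟩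
    obtain ⟨δ, hδ, h⟩ := Metric.eventually_nhds_iff.1 h2
    exact ⟨δ, hδ, fun t ht => h ht⟩
  obtain ⟨ε, hε, hεU⟩ : ∃ ε > 0, ∀ x ∈ ball (0 : E) ε, x ∈ U ∧ lam x ∈ ball (0 : ℝ) δ₁ ∧
      π x ∈ ball (0 : E) ε₂ := by
    have h2 : ∀ᶠ x in 𝓝 (0 : E), x ∈ U ∧ lam x ∈ ball (0 : ℝ) δ₁ ∧ π x ∈ ball (0 : E) ε₂ := by
      filter_upwards [hU.mem_nhds h0, lam.continuous.continuousAt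
        (isOpen_ball.mem_nhds (by rw [map_zero]; exact mem_ball_self hδ₁)),
        π.continuous.continuousAt (isOpen_ball.mem_nhds (by
          rw [map_zero]; exact mem_ball_self hε₂))] with x h h' h'' using ⟨h, h', h''⟩
    obtain ⟨δ, hδ, h⟩ := Metric.eventually_nhds_iff.1 h2
    exact ⟨δ, hδ, fun t ht => h ht⟩
  set F : E → E × (E →L[ℝ] E) × E := fun x => Φ₂ (π x, γ (lam x)) with hF
  have hFs : ContDiffOn ℝ ∞ F (ball 0 ε) := by
    refine hs₂.comp (π.contDiff.contDiffOn.prodMk (hγs.comp lam.contDiff.contDiffOn fun x hx =>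
      (hδ₁γ _ (hεU x hx).2.1).1)) fun x hx => ⟨(hεU x hx).2.2, (hδ₁γ _ (hεU x hx).2.1).2⟩
  -- The point is carried as an unknown of the system because Γ depends on it; its equation has
  -- constant coefficients, which shows that it is x.
  have hFx : ∀ x ∈ ball (0 : E) ε, (F x).1 = x := by
    intro x hx
    obtain ⟨-, hx1, hx2⟩ := hεU x hx
    obtain ⟨hx3, hx4⟩ := hδ₁γ _ hx1
    have h1 : ∀ v ∈ ball (0 : E) ε₂,
        HasFDerivAt (fun v => (Φ₂ (v, γ (lam x))).1 - π v) (0 : E →L[ℝ] E) v := by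
      intro v hv
      have h1 : HasFDerivAt Φ₂ (fderiv ℝ Φ₂ (v, γ (lam x))) (v, γ (lam x)) :=
        ((hs₂.contDiffAt ((isOpen_ball.prod isOpen_ball).mem_nhds
          ⟨hv, hx4⟩)).differentiableAt (by simp)).hasFDerivAt
      have h2 : HasFDerivAt (fun v => Φ₂ (v, γ (lam x))) _ v :=
        h1.comp v (hasFDerivAt_prodMk_left v (γ (lam x)))
      refine (h2.fst.sub π.hasFDerivAt).congr_fderiv ?_
      ext w
      simp [(hd₂ v hv _ hx4).2, coframeSystem_apply]
    have h2 := (convex_ball (0 : E) ε₂).is_const_of_fderivWithin_eq_zero (𝕜 := ℝ)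
      (f := fun v => (Φ₂ (v, γ (lam x))).1 - π v)
      (fun s hs => (h1 s hs).differentiableAt.differentiableWithinAt) (fun s hs => by
        rw [fderivWithin_of_isOpen isOpen_ball hs, (h1 s hs).fderiv]) hx2 (mem_ball_self hε₂)
    simp only [hi₂ _ hx4, hγ1 _ hx3, map_zero, sub_zero] at h2
    have h3 : π (π x) = π x := kerProj_of_mem e (apply_kerProj he x)
    rw [sub_eq_iff_eq_add, h3, hπ, kerProj_apply] at h2
    simp only [hF]
    rw [hπ, kerProj_apply, h2]
    abel
  have hFd : ∀ x ∈ ball (0 : E) ε, ∀ v, lam v = 0 → fderiv ℝ F x v = coframeSystem Γ π (F x) v := by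
    intro x hx v hv
    obtain ⟨-, hx1, hx2⟩ := hεU x hx
    obtain ⟨hx3, hx4⟩ := hδ₁γ _ hx1
    have h1 : HasFDerivAt Φ₂ (fderiv ℝ Φ₂ (π x, γ (lam x))) (π x, γ (lam x)) :=
      ((hs₂.contDiffAt ((isOpen_ball.prod isOpen_ball).mem_nhds
        ⟨hx2, hx4⟩)).differentiableAt (by simp)).hasFDerivAt
    have h2 := h1.comp x (π.hasFDerivAt.prodMk
      ((hγd _ hx3).hasFDerivAt.comp x lam.hasFDerivAt))
    have h3 : fderiv ℝ F x = _ := h2.fderiv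
    rw [h3]
    have h4 : π v = v := kerProj_of_mem e hv
    simp only [ContinuousLinearMap.comp_apply, ContinuousLinearMap.prod_apply, hv, map_zero, h4,
      (hd₂ _ hx2 _ hx4).2]
    rfl
  have hFline : ∀ t : ℝ, t • e ∈ ball (0 : E) ε → F (t • e) = γ t := by
    intro t ht
    obtain ⟨-, hx1, hx2⟩ := hεU _ ht
    have h1 : lam (t • e) = t := by simp [he]
    have h2 : π (t • e) = 0 := by simp [hπ, he]
    rw [h1] at hx1
    simp only [hF, h1, h2]
    exact hi₂ _ (hδ₁γ _ hx1).2
  have hFe : ∀ t : ℝ, t • e ∈ ball (0 : E) ε →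
      fderiv ℝ F (t • e) e = coframeSystem Γ π₁ (F (t • e)) 1 := by
    intro t ht
    have h1 : HasFDerivAt F (fderiv ℝ F (t • e)) (t • e) :=
      ((hFs.contDiffAt (isOpen_ball.mem_nhds ht)).differentiableAt (by simp)).hasFDerivAt
    have h2 : HasDerivAt (fun t : ℝ => t • e) e t := by
      simpa using (hasDerivAt_id t).smul_const e
    have h3 := h1.comp_hasDerivAt t h2
    have hcont : ∀ᶠ s in 𝓝 t, s • e ∈ ball (0 : E) ε :=
      h2.continuousAt (isOpen_ball.mem_nhds ht)
    have h4 : HasDerivAt (F ∘ fun t : ℝ => t • e) (coframeSystem Γ π₁ (γ t) 1) t := by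
      have hx1 := (hεU _ ht).2.1
      rw [show lam (t • e) = t by simp [he]] at hx1
      exact (hγd t (hδ₁γ _ hx1).1).congr_of_eventuallyEq (by
        filter_upwards [hcont] with s hs using hFline s hs)
    rw [hFline t ht]
    exact h3.unique h4
  have hFdiff : ∀ x ∈ ball (0 : E) ε, HasFDerivAt F (fderiv ℝ F x) x := fun x hx =>
    ((hFs.contDiffAt (isOpen_ball.mem_nhds hx)).differentiableAt (by simp)).hasFDerivAt
  have hθd : ∀ x ∈ ball (0 : E) ε, ∀ v, fderiv ℝ (fun x => (F x).2.1) x v = (fderiv ℝ F x v).2.1 :=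
    fun x hx v => by rw [(hFdiff x hx).snd.fst.fderiv]; rfl
  have hΞd : ∀ x ∈ ball (0 : E) ε, ∀ v, fderiv ℝ (fun x => (F x).2.2) x v = (fderiv ℝ F x v).2.2 :=
    fun x hx v => by rw [(hFdiff x hx).snd.snd.fderiv]; rfl
  refine ⟨ε, hε, fun x => (F x).2.1, fun x => (F x).2.2, fun x hx => (hεU x hx).1,
    hFs.snd.fst, hFs.snd.snd, ?_, fun x hx v hv => ?_, fun t ht => ?_⟩
  · have h1 := hFline 0 (by rw [zero_smul]; exact mem_ball_self hε)
    rw [zero_smul, hγ0] at h1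
    simp only [h1, hz₀]
  · rw [hθd x hx, hΞd x hx, hFd x hx v hv, coframeSystem_apply, hFx x hx, kerProj_of_mem e hv]
    exact ⟨rfl, rfl⟩
  · rw [hθd _ ht, hΞd _ ht, hFe t ht, coframeSystem_apply, hFx _ ht, hπ₁]
    simp

end Coframes

/-! ### Kerr-Schild coordinates from a parallel coframe along the leaves -/

section Segments

/-- Grönwall's inequality on a segment. Only the derivative in the direction of the segment is
controlled, which suits equations that hold along leaves only. -/
theorem eq_zero_of_segment {E F : Type*} [NormedAddCommGroup E] [NormedSpace ℝ E]
    [NormedAddCommGroup F] [NormedSpace ℝ F] {y : E → F} {a w : E} {C : ℝ → ℝ}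
    (hy : ∀ s ∈ Icc (0 : ℝ) 1, DifferentiableAt ℝ y (a + s • w)) (hC : ContinuousOn C (Icc 0 1))
    (hbound : ∀ s ∈ Icc (0 : ℝ) 1, ‖fderiv ℝ y (a + s • w) w‖ ≤ C s * ‖y (a + s • w)‖)
    (h0 : y a = 0) : y (a + w) = 0 := by
  obtain ⟨B, hB⟩ := isCompact_Icc.exists_bound_of_continuousOn hC
  have hd : ∀ s ∈ Icc (0 : ℝ) 1, HasDerivAt (fun s => y (a + s • w))
      (fderiv ℝ y (a + s • w) w) s := by
    intro s hs
    have h1 : HasDerivAt (fun s : ℝ => a + s • w) w s := by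
      simpa using ((hasDerivAt_id s).smul_const w).const_add a
    exact (hy s hs).hasFDerivAt.comp_hasDerivAt s h1
  have h1 := eq_zero_of_abs_deriv_le_mul_abs_self_of_eq_zero_right (f := fun s => y (a + s • w))
    (K := B) (a := 0) (b := 1) (fun s hs => (hd s hs).continuousAt.continuousWithinAt)
    (fun s hs => (hd s (Ico_subset_Icc_self hs)).hasDerivWithinAt) (by simp [h0]) (fun s hs => by
      have hs' := Ico_subset_Icc_self hs
      refine (hbound s hs').trans (mul_le_mul_of_nonneg_right ?_ (norm_nonneg _))
      exact (le_abs_self _).trans (hB s hs')) 1 (by simp)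
  simpa using h1

end Segments

/-! ### Adapted coframes and their orthonormality -/

section LeafCoframe

open Coordinates

variable {n : ℕ}

/-- A coframe `θ` with primitive `Ξ` adapted to a leafwise flat Kundt congruence whose leaves are
the hyperplanes `lam = const`. -/
structure IsLeafCoframe (G : (Fin n → ℝ) → Matrix (Fin n) (Fin n) ℝ)
    (K : (Fin n → ℝ) → (Fin n → ℝ)) (lam : (Fin n → ℝ) →L[ℝ] ℝ) (e : Fin n → ℝ)
    (θ : (Fin n → ℝ) → (Fin n → ℝ) →L[ℝ] (Fin n → ℝ)) (Ξ : (Fin n → ℝ) → (Fin n → ℝ)) (ε : ℝ) :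
    Prop where
  pos : 0 < ε
  metric : IsLorentzMetricOn G (ball 0 ε)
  smooth_K : ContDiffOn ℝ ∞ K (ball 0 ε)
  null : ∀ x ∈ ball 0 ε, metricForm G x (K x) (K x) = 0
  ne_zero : ∀ x ∈ ball 0 ε, K x ≠ 0
  kundt : ∀ x ∈ ball 0 ε, IsKundtAt G K x
  leafFlat : ∀ x ∈ ball 0 ε, LeafFlatAt G (K x) x
  lam_e : lam e = 1
  perp : ∀ x ∈ ball 0 ε, ∀ v, lam v = 0 → metricForm G x (K x) v = 0
  smooth_θ : ContDiffOn ℝ ∞ θ (ball 0 ε)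
  smooth_Ξ : ContDiffOn ℝ ∞ Ξ (ball 0 ε)
  gram_zero : ∀ u v, minkForm n (θ 0 u) (θ 0 v) = metricForm G 0 u v
  leaf : ∀ x ∈ ball 0 ε, ∀ v, lam v = 0 →
    fderiv ℝ θ x v = (θ x).comp (connForm G x v) ∧ fderiv ℝ Ξ x v = θ x v
  line : ∀ t : ℝ, t • e ∈ ball (0 : Fin n → ℝ) ε →
    fderiv ℝ θ (t • e) e = (θ (t • e)).comp (connForm G (t • e) e) ∧
    fderiv ℝ Ξ (t • e) e = θ (t • e) e

/-- The points of the ball that are joined to the line spanned by `e` within their leaf. -/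
def leafDomain (lam : (Fin n → ℝ) →L[ℝ] ℝ) (e : Fin n → ℝ) (ε : ℝ) : Set (Fin n → ℝ) :=
  ball 0 ε ∩ {x | lam x • e ∈ ball 0 ε}

namespace IsLeafCoframe

variable {G : (Fin n → ℝ) → Matrix (Fin n) (Fin n) ℝ} {K : (Fin n → ℝ) → (Fin n → ℝ)}
  {lam : (Fin n → ℝ) →L[ℝ] ℝ} {e : Fin n → ℝ}
  {θ : (Fin n → ℝ) → (Fin n → ℝ) →L[ℝ] (Fin n → ℝ)} {Ξ : (Fin n → ℝ) → (Fin n → ℝ)} {ε : ℝ}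
  {x : Fin n → ℝ}

theorem isOpen_leafDomain : IsOpen (leafDomain lam e ε) :=
  isOpen_ball.inter (isOpen_ball.preimage (lam.continuous.smul continuous_const))

theorem hasFDerivAt_θ (h : IsLeafCoframe G K lam e θ Ξ ε) (hx : x ∈ ball 0 ε) :
    HasFDerivAt θ (fderiv ℝ θ x) x :=
  ((h.smooth_θ.contDiffAt (isOpen_ball.mem_nhds hx)).differentiableAt (by simp)).hasFDerivAt

theorem hasFDerivAt_K (h : IsLeafCoframe G K lam e θ Ξ ε) (hx : x ∈ ball 0 ε) :
    HasFDerivAt K (fderiv ℝ K x) x :=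
  ((h.smooth_K.contDiffAt (isOpen_ball.mem_nhds hx)).differentiableAt (by simp)).hasFDerivAt

theorem zero_mem (h : IsLeafCoframe G K lam e θ Ξ ε) : (0 : Fin n → ℝ) ∈ leafDomain lam e ε := by
  simp [leafDomain, h.pos]

/-- The leaves fix the kernel of the 1-form of K, so that form is a multiple of lam. -/
theorem perp_iff (h : IsLeafCoframe G K lam e θ Ξ ε) (hx : x ∈ ball 0 ε) (v : Fin n → ℝ) :
    metricForm G x (K x) v = lam v * metricForm G x (K x) e := by
  have h1 := h.perp x hx _ (apply_kerProj h.lam_e v)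
  rw [kerProj_apply, map_sub, map_smul, smul_eq_mul] at h1
  linarith

theorem form_e_ne_zero (h : IsLeafCoframe G K lam e θ Ξ ε) (hx : x ∈ ball 0 ε) :
    metricForm G x (K x) e ≠ 0 := fun h0 =>
  h.ne_zero x hx ((h.metric.lorentz x hx).nondeg fun v => by rw [h.perp_iff hx, h0, mul_zero])

theorem lam_eq_zero (h : IsLeafCoframe G K lam e θ Ξ ε) (hx : x ∈ ball 0 ε) {v : Fin n → ℝ}
    (hv : metricForm G x (K x) v = 0) : lam v = 0 := by
  rw [h.perp_iff hx, mul_eq_zero] at hv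
  exact hv.resolve_right (h.form_e_ne_zero hx)

theorem segment_mem (hx : x ∈ leafDomain lam e ε) {s : ℝ} (hs : s ∈ Icc (0 : ℝ) 1) :
    lam x • e + s • kerProj lam e x ∈ ball 0 ε := by
  have h1 := (convex_ball (0 : Fin n → ℝ) ε) hx.2 hx.1 (sub_nonneg.2 hs.2) hs.1 (by ring)
  convert h1 using 1
  simp only [kerProj_apply]
  module

theorem lam_segment (h : IsLeafCoframe G K lam e θ Ξ ε) (s : ℝ) :
    lam (lam x • e + s • kerProj lam e x) = lam x := by
  rw [map_add, map_smul, map_smul, apply_kerProj h.lam_e, h.lam_e]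
  simp

theorem segment_mem_leafDomain (h : IsLeafCoframe G K lam e θ Ξ ε) (hx : x ∈ leafDomain lam e ε)
    {s : ℝ} (hs : s ∈ Icc (0 : ℝ) 1) :
    lam x • e + s • kerProj lam e x ∈ leafDomain lam e ε := by
  refine ⟨segment_mem hx hs, ?_⟩
  change lam _ • e ∈ ball 0 ε
  rw [h.lam_segment]
  exact hx.2

/-- Transports vanishing from the transversal line to x along the segment inside the leaf;
`leafDomain` keeps both endpoints, hence the segment, in the ball. -/
theorem eq_zero_of_leaf {F : Type*} [NormedAddCommGroup F] [NormedSpace ℝ F]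
    (hx : x ∈ leafDomain lam e ε)
    {y : (Fin n → ℝ) → F} (hy : DifferentiableOn ℝ y (ball 0 ε)) {C : (Fin n → ℝ) → ℝ}
    (hC : ContinuousOn C (ball 0 ε))
    (hbound : ∀ s ∈ Icc (0 : ℝ) 1,
      ‖fderiv ℝ y (lam x • e + s • kerProj lam e x) (kerProj lam e x)‖ ≤
        C (lam x • e + s • kerProj lam e x) * ‖y (lam x • e + s • kerProj lam e x)‖)
    (h0 : y (lam x • e) = 0) : y x = 0 := by
  have h1 := eq_zero_of_segment (y := y) (a := lam x • e) (w := kerProj lam e x)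
    (fun s hs => (hy.differentiableAt (isOpen_ball.mem_nhds (segment_mem hx hs))))
    (hC.comp (t := ball 0 ε) (f := fun s : ℝ => lam x • e + s • kerProj lam e x)
      (by fun_prop) fun s hs => segment_mem hx hs) hbound h0
  rwa [kerProj_apply, add_sub_cancel] at h1

/-- The coframe is orthonormal. -/
theorem gram (h : IsLeafCoframe G K lam e θ Ξ ε) (hx : x ∈ leafDomain lam e ε) (u v : Fin n → ℝ) :
    minkForm n (θ x u) (θ x v) = metricForm G x u v := by
  have hLC := h.metric.isLeviCivitaOn
  -- The difference between the pulled-back flat form and the metric. In every direction in which θ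
  -- is parallel it satisfies a homogeneous linear equation, first along the line and then along the
  -- leaf.
  set y : (Fin n → ℝ) → (Fin n → ℝ) →L[ℝ] (Fin n → ℝ) →L[ℝ] ℝ := fun x =>
    (minkForm n).bilinearComp (θ x) (θ x) - metricForm G x with hy
  have hyuv : ∀ x u v, y x u v = minkForm n (θ x u) (θ x v) - metricForm G x u v :=
    fun x u v => by simp [hy]
  have hys : ContDiffOn ℝ ∞ y (ball 0 ε) := by
    refine contDiffOn_clm_apply.2 fun u => contDiffOn_clm_apply.2 fun v => ?_
    simp only [hyuv]
    exact ((contDiffOn_const.clm_apply (h.smooth_θ.clm_apply contDiffOn_const)).clm_apply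
      (h.smooth_θ.clm_apply contDiffOn_const)).sub
      ((h.metric.smooth_metricForm.clm_apply contDiffOn_const).clm_apply contDiffOn_const)
  have hyd : ∀ p ∈ ball 0 ε, ∀ w, fderiv ℝ θ p w = (θ p).comp (connForm G p w) →
      ∀ u v, fderiv ℝ y p w u v = y p (connForm G p w u) v + y p u (connForm G p w v) := by
    intro p hp w hw u v
    have h1 := (((hys.contDiffAt (isOpen_ball.mem_nhds hp)).differentiableAt
      (by simp)).hasFDerivAt.clm_apply_const u).clm_apply_const v
    have hθ := h.hasFDerivAt_θ hp
    have h2 := (((minkForm n).hasFDerivAt.comp p (hθ.clm_apply_const u)).clm_apply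
      (hθ.clm_apply_const v)).sub
      (((hLC.hasFDerivAt_metric hp).clm_apply_const u).clm_apply_const v)
    have h3 := DFunLike.congr_fun (h1.unique (h2.congr_of_eventuallyEq
      (Eventually.of_forall fun q => hyuv q u v))) w
    simp only [ContinuousLinearMap.flip_apply, sub_apply, add_apply, ContinuousLinearMap.comp_apply,
      Function.comp_apply, hw, hLC.compat p hp] at h3
    rw [h3, hyuv, hyuv]
    ring
  have hbound : ∀ p ∈ ball 0 ε, ∀ w, fderiv ℝ θ p w = (θ p).comp (connForm G p w) →
      ‖fderiv ℝ y p w‖ ≤ 2 * ‖connForm G p w‖ * ‖y p‖ := by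
    intro p hp w hw
    refine ContinuousLinearMap.opNorm_le_bound₂ _ (by positivity) fun u v => ?_
    rw [hyd p hp w hw]
    have h1 : ‖y p (connForm G p w u) v‖ ≤ ‖y p‖ * (‖connForm G p w‖ * ‖u‖) * ‖v‖ :=
      ((y p).le_opNorm₂ _ _).trans (by gcongr; exact ContinuousLinearMap.le_opNorm _ _)
    have h2 : ‖y p u (connForm G p w v)‖ ≤ ‖y p‖ * ‖u‖ * (‖connForm G p w‖ * ‖v‖) :=
      ((y p).le_opNorm₂ _ _).trans (by gcongr; exact ContinuousLinearMap.le_opNorm _ _)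
    refine (norm_add_le _ _).trans ((add_le_add h1 h2).trans (le_of_eq (by ring)))
  have hΓc : ∀ w, ContinuousOn (fun p => 2 * ‖connForm G p w‖) (ball 0 ε) := fun w =>
    continuousOn_const.mul (h.metric.smooth_connForm.continuousOn.clm_apply continuousOn_const).norm
  have hydiff := hys.differentiableOn (by simp)
  have hseg : ∀ s ∈ Icc (0 : ℝ) 1, s • lam x • e ∈ ball (0 : Fin n → ℝ) ε := fun s hs =>
    (convex_ball (0 : Fin n → ℝ) ε).smul_mem_of_zero_mem (mem_ball_self h.pos) hx.2 hs
  have hline : y (lam x • e) = 0 := by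
    have h1 := eq_zero_of_segment (y := y) (a := 0) (w := lam x • e)
      (C := fun s => 2 * ‖connForm G (s • lam x • e) (lam x • e)‖)
      (fun s hs => by
        rw [zero_add]
        exact hydiff.differentiableAt (isOpen_ball.mem_nhds (hseg s hs)))
      ((hΓc (lam x • e)).comp (t := ball 0 ε) (f := fun s : ℝ => s • lam x • e) (by fun_prop)
        fun s hs => hseg s hs)
      (fun s hs => by
        rw [zero_add]
        refine hbound _ (hseg s hs) _ ?_
        have h2 := (h.line (s * lam x) (by rw [← smul_smul]; exact hseg s hs)).1
        rw [smul_smul, map_smul, h2, map_smul, ContinuousLinearMap.comp_smul])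
      (by
        ext1 u
        ext1 v
        rw [hyuv, h.gram_zero, sub_self]
        rfl)
    rwa [zero_add] at h1
  have h1 := eq_zero_of_leaf hx hydiff (hΓc (kerProj lam e x)) (fun s hs =>
    hbound _ (segment_mem hx hs) _ (h.leaf _ (segment_mem hx hs) _ (apply_kerProj h.lam_e x)).1)
    hline
  rw [← sub_eq_zero, ← hyuv, h1]
  rfl

end IsLeafCoframe

end LeafCoframe

/-! ### Transport of the coframe error along the leaves -/

section LeafCoframeTransport

open Coordinates

variable {n : ℕ} {G : (Fin n → ℝ) → Matrix (Fin n) (Fin n) ℝ} {K : (Fin n → ℝ) → (Fin n → ℝ)}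
  {lam : (Fin n → ℝ) →L[ℝ] ℝ} {e : Fin n → ℝ}
  {θ : (Fin n → ℝ) → (Fin n → ℝ) →L[ℝ] (Fin n → ℝ)} {Ξ : (Fin n → ℝ) → (Fin n → ℝ)} {ε : ℝ}
  {x : Fin n → ℝ}

namespace IsLeafCoframe

section Direction

variable {o : Fin n} (ho : o.val = 0)

/-- The direction of the congruence in the coframe, normalised by its component `o`. -/
def direction (K : (Fin n → ℝ) → (Fin n → ℝ)) (θ : (Fin n → ℝ) → (Fin n → ℝ) →L[ℝ] (Fin n → ℝ))
    (o : Fin n) (x : Fin n → ℝ) : Fin n → ℝ :=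
  (θ x (K x) o)⁻¹ • θ x (K x)

include ho

/-- The coframe maps K to a nonzero null vector of Minkowski space, and such a vector has a nonzero
time component. -/
theorem coframe_K_ne_zero (h : IsLeafCoframe G K lam e θ Ξ ε) (hx : x ∈ leafDomain lam e ε) :
    θ x (K x) o ≠ 0 := by
  intro h0
  have hn : 0 < n := o.pos
  have hoo : o = ⟨0, hn⟩ := Fin.ext ho
  have h1 := minkForm_null_zeroth hn (v := θ x (K x)) (by rw [h.gram hx, h.null x hx.1])
    (by rwa [← hoo])
  refine h.ne_zero x hx.1 ((h.metric.lorentz x hx.1).nondeg fun v => ?_)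
  rw [← h.gram hx, h1, map_zero, zero_apply]

theorem direction_smul (h : IsLeafCoframe G K lam e θ Ξ ε) (hx : x ∈ leafDomain lam e ε) :
    θ x (K x) = θ x (K x) o • direction K θ o x := by
  rw [direction, smul_inv_smul₀ (h.coframe_K_ne_zero ho hx)]

theorem direction_apply (h : IsLeafCoframe G K lam e θ Ξ ε) (hx : x ∈ leafDomain lam e ε) :
    direction K θ o x o = 1 := by
  rw [direction, Pi.smul_apply, smul_eq_mul, inv_mul_cancel₀ (h.coframe_K_ne_zero ho hx)]

/-- Along a leaf θ is parallel and K is recurrent, so the derivative of θ(K) is a multiple of θ(K);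
normalising one component to 1 removes this factor. -/
theorem fderiv_direction (h : IsLeafCoframe G K lam e θ Ξ ε) (hx : x ∈ leafDomain lam e ε)
    {v : Fin n → ℝ} (hv : lam v = 0) :
    DifferentiableAt ℝ (direction K θ o) x ∧ fderiv ℝ (direction K θ o) x v = 0 := by
  have h0 := h.coframe_K_ne_zero ho hx
  have hT := (h.hasFDerivAt_θ hx.1).clm_apply (h.hasFDerivAt_K hx.1)
  have hTo := hasFDerivAt_pi'.1 hT o
  have hN : HasFDerivAt (direction K θ o) _ x :=
    ((hasDerivAt_inv h0).comp_hasFDerivAt x hTo).smul hT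
  refine ⟨hN.differentiableAt, ?_⟩
  obtain ⟨c, hc⟩ := h.kundt x hx.1 v (h.perp x hx.1 v hv)
  rw [covDerivMap_apply, covariantDeriv] at hc
  have h1 : θ x (fderiv ℝ K x v) + fderiv ℝ θ x v (K x) = c • θ x (K x) := by
    rw [(h.leaf x hx.1 v hv).1, ContinuousLinearMap.comp_apply, ← map_add, hc, map_smul]
  rw [hN.fderiv]
  simp only [add_apply, smul_apply, ContinuousLinearMap.smulRight_apply,
    ContinuousLinearMap.comp_apply, ContinuousLinearMap.flip_apply, ContinuousLinearMap.proj_apply,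
    h1, Pi.smul_apply, smul_eq_mul]
  rw [smul_smul, ← add_smul]
  refine smul_eq_zero_of_left ?_ _
  simp only [Function.comp_apply]
  field_simp
  ring

theorem direction_eq (h : IsLeafCoframe G K lam e θ Ξ ε) (hx : x ∈ leafDomain lam e ε) :
    direction K θ o x = direction K θ o (lam x • e) := by
  have h1 := eq_zero_of_segment (a := lam x • e) (w := kerProj lam e x) (C := fun _ => 0)
    (y := fun p => direction K θ o p - direction K θ o (lam x • e))
    (fun s hs => ((h.fderiv_direction ho (h.segment_mem_leafDomain hx hs)
      (apply_kerProj h.lam_e x)).1.sub_const _)) continuousOn_const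
    (fun s hs => by
      rw [fderiv_sub_const, (h.fderiv_direction ho (h.segment_mem_leafDomain hx hs)
        (apply_kerProj h.lam_e x)).2]
      simp) (sub_self _)
  rw [kerProj_apply, add_sub_cancel] at h1
  exact sub_eq_zero.1 h1

theorem direction_segment (h : IsLeafCoframe G K lam e θ Ξ ε) (hx : x ∈ leafDomain lam e ε) {s : ℝ}
    (hs : s ∈ Icc (0 : ℝ) 1) : direction K θ o (lam x • e + s • kerProj lam e x) =
      direction K θ o (lam x • e) := by
  rw [h.direction_eq ho (h.segment_mem_leafDomain hx hs), h.lam_segment]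

end Direction

/-- The failure of the coframe to be parallel in the direction `e`. -/
def transverse (G : (Fin n → ℝ) → Matrix (Fin n) (Fin n) ℝ)
    (θ : (Fin n → ℝ) → (Fin n → ℝ) →L[ℝ] (Fin n → ℝ)) (e x : Fin n → ℝ) :
    (Fin n → ℝ) →L[ℝ] (Fin n → ℝ) :=
  fderiv ℝ θ x e - (θ x).comp (connForm G x e)

/-- The failure of `Ξ` to be a primitive of the coframe in the direction `e`. -/
def defect (θ : (Fin n → ℝ) → (Fin n → ℝ) →L[ℝ] (Fin n → ℝ)) (Ξ : (Fin n → ℝ) → (Fin n → ℝ))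
    (e x : Fin n → ℝ) : Fin n → ℝ :=
  θ x e - fderiv ℝ Ξ x e

theorem smooth_transverse (h : IsLeafCoframe G K lam e θ Ξ ε) :
    ContDiffOn ℝ ∞ (transverse G θ e) (ball 0 ε) :=
  ((h.smooth_θ.fderiv_of_isOpen isOpen_ball (m := ∞) (by norm_cast)).clm_apply
    contDiffOn_const).sub (h.smooth_θ.clm_comp
      (h.metric.smooth_connForm.clm_apply contDiffOn_const))

theorem smooth_defect (h : IsLeafCoframe G K lam e θ Ξ ε) :
    ContDiffOn ℝ ∞ (defect θ Ξ e) (ball 0 ε) :=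
  (h.smooth_θ.clm_apply contDiffOn_const).sub
    ((h.smooth_Ξ.fderiv_of_isOpen isOpen_ball (m := ∞) (by norm_cast)).clm_apply contDiffOn_const)

/-- Differentiating the leafwise equation for θ along e and exchanging second derivatives of θ
leaves the curvature R(e, v) as a source. -/
theorem fderiv_transverse (h : IsLeafCoframe G K lam e θ Ξ ε) (hx : x ∈ ball 0 ε)
    {v : Fin n → ℝ} (hv : lam v = 0) (u : Fin n → ℝ) :
    fderiv ℝ (transverse G θ e) x v u =
      transverse G θ e x (connForm G x v u) + θ x (curvature (connForm G) x e v u) := by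
  have hU := isOpen_ball.mem_nhds hx
  have hθ := h.hasFDerivAt_θ hx
  have hΓ := h.metric.isLeviCivitaOn.hasFDerivAt_conn hx
  have hdd : HasFDerivAt (fderiv ℝ θ) (fderiv ℝ (fderiv ℝ θ) x) x :=
    (((h.smooth_θ.contDiffAt hU).fderiv_right (m := 1) (by norm_cast)).differentiableAt
      one_ne_zero).hasFDerivAt
  have hsymm : fderiv ℝ (fderiv ℝ θ) x v e = fderiv ℝ (fderiv ℝ θ) x e v :=
    ((h.smooth_θ.contDiffAt hU).isSymmSndFDerivAt minSmoothness_two_le_infty).eq v e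
  have h1 := (hdd.clm_apply_const v).unique ((hθ.clm_comp (hΓ.clm_apply_const v)).congr_of_eventuallyEq
    (by filter_upwards [hU] with y hy using (h.leaf y hy v hv).1))
  have h2 := DFunLike.congr_fun (DFunLike.congr_fun h1 e) u
  have h3 : HasFDerivAt (transverse G θ e) _ x :=
    (hdd.clm_apply_const e).sub (hθ.clm_comp (hΓ.clm_apply_const e))
  rw [h3.fderiv]
  simp only [sub_apply, add_apply, ContinuousLinearMap.flip_apply, ContinuousLinearMap.comp_apply,
    ContinuousLinearMap.compL_apply] at h2 ⊢
  rw [hsymm, h2, (h.leaf x hx v hv).1, transverse, curvature]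
  simp only [sub_apply, map_sub, map_add, ContinuousLinearMap.comp_apply]
  abel

/-- Equality of the mixed second derivatives of Ξ, together with the symmetry of Γ, reduces the
change of the error to the failure of parallelism along e. -/
theorem fderiv_defect (h : IsLeafCoframe G K lam e θ Ξ ε) (hx : x ∈ ball 0 ε)
    {v : Fin n → ℝ} (hv : lam v = 0) :
    fderiv ℝ (defect θ Ξ e) x v = -transverse G θ e x v := by
  have hU := isOpen_ball.mem_nhds hx
  have hθ := h.hasFDerivAt_θ hx
  have hdd : HasFDerivAt (fderiv ℝ Ξ) (fderiv ℝ (fderiv ℝ Ξ) x) x :=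
    (((h.smooth_Ξ.contDiffAt hU).fderiv_right (m := 1) (by norm_cast)).differentiableAt
      one_ne_zero).hasFDerivAt
  have hsymm : fderiv ℝ (fderiv ℝ Ξ) x v e = fderiv ℝ (fderiv ℝ Ξ) x e v :=
    ((h.smooth_Ξ.contDiffAt hU).isSymmSndFDerivAt minSmoothness_two_le_infty).eq v e
  have h1 := (hdd.clm_apply_const v).unique ((hθ.clm_apply_const v).congr_of_eventuallyEq
    (by filter_upwards [hU] with y hy using (h.leaf y hy v hv).2))
  have h2 := DFunLike.congr_fun h1 e
  have h3 : HasFDerivAt (defect θ Ξ e) _ x := (hθ.clm_apply_const e).sub (hdd.clm_apply_const e)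
  rw [h3.fderiv]
  simp only [sub_apply, ContinuousLinearMap.flip_apply] at h2 ⊢
  rw [hsymm, h2, (h.leaf x hx v hv).1, transverse, ContinuousLinearMap.comp_apply,
    h.metric.isLeviCivitaOn.torsion x hx v e, sub_apply, ContinuousLinearMap.comp_apply]
  abel

/-- By pair symmetry g(R(e, v)u, w) = g(R(u, w)e, v), which vanishes by leaf flatness for every w
orthogonal to K. -/
theorem curvature_transverse (h : IsLeafCoframe G K lam e θ Ξ ε) (hn : 2 ≤ n) (hx : x ∈ ball 0 ε)
    {u : Fin n → ℝ} (hu : lam u = 0) (v : Fin n → ℝ) :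
    ∃ c : ℝ, curvature (connForm G) x e v u = c • K x := by
  refine (h.metric.lorentz x hx).exists_smul_of_orthogonal hn (h.ne_zero x hx) (h.null x hx)
    fun w hw => ?_
  rw [h.metric.isLeviCivitaOn.curvature_pair_symm hx,
    h.leafFlat x hx u w (h.perp x hx u hu) hw, map_zero, zero_apply]

/-- The leaves are totally geodesic: differentiating g(K, u) = 0 along v leaves g(K, Γ(v, u)),
because ∇_v K is a multiple of K. -/
theorem lam_connForm (h : IsLeafCoframe G K lam e θ Ξ ε) (hx : x ∈ ball 0 ε)
    {u v : Fin n → ℝ} (hu : lam u = 0) (hv : lam v = 0) : lam (connForm G x v u) = 0 := by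
  refine h.lam_eq_zero hx ?_
  obtain ⟨κ', hκ', hκ'eq⟩ := h.metric.isLeviCivitaOn.hasFDerivAt_lower hx h.smooth_K
  have h1 := DFunLike.congr_fun ((hκ'.clm_apply_const u).unique
    ((hasFDerivAt_const (0 : ℝ) x).congr_of_eventuallyEq (by
      filter_upwards [isOpen_ball.mem_nhds hx] with y hy using h.perp y hy u hu))) v
  rw [ContinuousLinearMap.flip_apply, hκ'eq, zero_apply] at h1
  obtain ⟨c, hc⟩ := h.kundt x hx v (h.perp x hx v hv)
  rw [hc, map_smul, smul_apply, h.perp x hx u hu, smul_zero, add_zero] at h1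
  exact h1

variable {o : Fin n} (ho : o.val = 0)
include ho

/-- Modulo the direction of θ(K), which is constant on the leaf, the curvature source drops out. The
remaining equation is homogeneous and the initial value on the transversal line is zero. -/
theorem transverse_eq (h : IsLeafCoframe G K lam e θ Ξ ε) (hn : 2 ≤ n)
    (hx : x ∈ leafDomain lam e ε) {u : Fin n → ℝ} (hu : lam u = 0) :
    transverse G θ e x u = transverse G θ e x u o • direction K θ o x := by
  set a := lam x • e with ha
  set N := direction K θ o a with hN
  set ν : (Fin n → ℝ) →L[ℝ] ℝ := ContinuousLinearMap.proj o with hν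
  set π := kerProj lam e with hπ
  -- L restricts an operator to leaf vectors and projects its values along N, so that Grönwall's
  -- inequality applies to a single operator norm.
  set L : ((Fin n → ℝ) →L[ℝ] (Fin n → ℝ)) →L[ℝ] ((Fin n → ℝ) →L[ℝ] (Fin n → ℝ)) :=
    (ContinuousLinearMap.compL ℝ (Fin n → ℝ) (Fin n → ℝ) (Fin n → ℝ) (kerProj ν N)).comp
      ((ContinuousLinearMap.compL ℝ (Fin n → ℝ) (Fin n → ℝ) (Fin n → ℝ)).flip π) with hL
  have hLa : ∀ T u, L T u = T (π u) - T (π u) o • N := fun T u => rfl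
  have hs := h.smooth_transverse
  have hy : ContDiffOn ℝ ∞ (fun p => L (transverse G θ e p)) (ball 0 ε) :=
    L.contDiff.comp_contDiffOn hs
  have haa : a ∈ ball (0 : Fin n → ℝ) ε := hx.2
  have h0 : transverse G θ e a = 0 := by
    rw [transverse, (h.line (lam x) haa).1, sub_self]
  have hπ0 : ∀ u, lam (π u) = 0 := apply_kerProj h.lam_e
  have hππ : ∀ u, lam u = 0 → π u = u := fun u hu => kerProj_of_mem e hu
  have key := eq_zero_of_leaf hx (hy.differentiableOn (by simp))
    (C := fun p => ‖connForm G p (π x)‖ * ‖π‖)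
    ((h.metric.smooth_connForm.continuousOn.clm_apply continuousOn_const).norm.mul
      continuousOn_const) (fun s hs' => by
      set p := lam x • e + s • kerProj lam e x with hp
      have hpb : p ∈ ball 0 ε := segment_mem hx hs'
      have hpD : p ∈ leafDomain lam e ε := h.segment_mem_leafDomain hx hs'
      have hNp : direction K θ o p = N := h.direction_segment ho hx hs'
      refine ContinuousLinearMap.opNorm_le_bound _ (by positivity) fun u => ?_
      have hd : fderiv ℝ (fun p => L (transverse G θ e p)) p (π x) =
          L (fderiv ℝ (transverse G θ e) p (π x)) :=
        DFunLike.congr_fun (L.hasFDerivAt.comp p ((hs.contDiffAt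
          (isOpen_ball.mem_nhds hpb)).differentiableAt (by simp)).hasFDerivAt).fderiv (π x)
      obtain ⟨c, hc⟩ := h.curvature_transverse hn hpb (hπ0 u) (π x)
      have h1 : L (fderiv ℝ (transverse G θ e) p (π x)) u =
          L (transverse G θ e p) (connForm G p (π x) (π u)) := by
        rw [hLa, hLa, h.fderiv_transverse hpb (hπ0 x), hc, map_smul,
          hππ _ (h.lam_connForm hpb (hπ0 u) (hπ0 x)), h.direction_smul ho hpD, hNp]
        simp only [Pi.add_apply, Pi.smul_apply, smul_eq_mul]
        rw [hN, h.direction_apply ho (x := a) ⟨haa, by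
          change lam (lam x • e) • e ∈ ball (0 : Fin n → ℝ) ε
          rw [map_smul, h.lam_e, smul_eq_mul, mul_one]
          exact haa⟩]
        module
      rw [hd, h1]
      calc ‖L (transverse G θ e p) (connForm G p (π x) (π u))‖
          ≤ ‖L (transverse G θ e p)‖ * (‖connForm G p (π x)‖ * (‖π‖ * ‖u‖)) :=
            ContinuousLinearMap.le_opNorm_of_le _ (ContinuousLinearMap.le_opNorm_of_le _
              (π.le_opNorm u))
        _ = ‖connForm G p (π x)‖ * ‖π‖ * ‖L (transverse G θ e p)‖ * ‖u‖ := by ring)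
    (by change L (transverse G θ e a) = 0; rw [h0, map_zero])
  have h2 := DFunLike.congr_fun key u
  rw [hLa, hππ u hu, zero_apply, sub_eq_zero, hN, ← h.direction_eq ho hx] at h2
  exact h2

/-- The error vanishes on the transversal line, and its derivative along a leaf is parallel to the
constant direction N. -/
theorem defect_eq (h : IsLeafCoframe G K lam e θ Ξ ε) (hn : 2 ≤ n)
    (hx : x ∈ leafDomain lam e ε) :
    defect θ Ξ e x = defect θ Ξ e x o • direction K θ o x := by
  set a := lam x • e with ha
  set N := direction K θ o a with hN
  set L : (Fin n → ℝ) →L[ℝ] (Fin n → ℝ) := kerProj (ContinuousLinearMap.proj o) N with hL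
  have hLa : ∀ w, L w = w - w o • N := fun w => rfl
  have hs := h.smooth_defect
  have haa : a ∈ ball (0 : Fin n → ℝ) ε := hx.2
  have h0 : defect θ Ξ e a = 0 := by
    rw [defect, (h.line (lam x) haa).2, sub_self]
  have key := eq_zero_of_leaf hx (y := fun p => L (defect θ Ξ e p))
    ((L.contDiff.comp_contDiffOn hs).differentiableOn (by simp)) (C := fun _ => 0)
    continuousOn_const (fun s hs' => by
      set p := lam x • e + s • kerProj lam e x with hp
      have hpb : p ∈ ball 0 ε := segment_mem hx hs'
      have hpD : p ∈ leafDomain lam e ε := h.segment_mem_leafDomain hx hs'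
      have hNp : direction K θ o p = N := h.direction_segment ho hx hs'
      have hπx := apply_kerProj h.lam_e x
      have hd : fderiv ℝ (fun p => L (defect θ Ξ e p)) p (kerProj lam e x) =
          L (fderiv ℝ (defect θ Ξ e) p (kerProj lam e x)) :=
        DFunLike.congr_fun (L.hasFDerivAt.comp p ((hs.contDiffAt
          (isOpen_ball.mem_nhds hpb)).differentiableAt (by simp)).hasFDerivAt).fderiv _
      rw [hd, h.fderiv_defect hpb hπx, map_neg, hLa, ← hNp, ← h.transverse_eq ho hn hpD hπx]
      simp)
    (by change L (defect θ Ξ e a) = 0; rw [h0, map_zero])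
  change L (defect θ Ξ e x) = 0 at key
  rw [hLa, sub_eq_zero, hN, ← h.direction_eq ho hx] at key
  exact key

/-- Here dΞ = θ - lam ⊗ (error), the error is a multiple of θ(K), and lam is a multiple of the
1-form of K. The cross terms give the rank-one correction, and the quadratic term vanishes because
θ(K) is null. -/
theorem kerrSchild_form (h : IsLeafCoframe G K lam e θ Ξ ε) (hn : 2 ≤ n)
    (hx : x ∈ leafDomain lam e ε) (u v : Fin n → ℝ) :
    metricForm G x u v = minkForm n (fderiv ℝ Ξ x u) (fderiv ℝ Ξ x v) +
      2 * (defect θ Ξ e x o * (θ x (K x) o)⁻¹ * (metricForm G x (K x) e)⁻¹) *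
        metricForm G x (K x) u * metricForm G x (K x) v := by
  have hd : ∀ w, fderiv ℝ Ξ x w =
      θ x w - (lam w * defect θ Ξ e x o * (θ x (K x) o)⁻¹) • θ x (K x) := by
    intro w
    have h1 : fderiv ℝ Ξ x w = fderiv ℝ Ξ x (kerProj lam e w) + lam w • fderiv ℝ Ξ x e := by
      rw [← map_smul, ← map_add, kerProj_apply, sub_add_cancel]
    have h2 : fderiv ℝ Ξ x e = θ x e - defect θ Ξ e x := by simp [defect]
    rw [h1, (h.leaf x hx.1 _ (apply_kerProj h.lam_e w)).2, h2, h.defect_eq ho hn hx, direction,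
      kerProj_apply, map_sub, map_smul]
    have h3 : ∀ c : ℝ, (c • (θ x (K x) o)⁻¹ • θ x (K x)) o = c := by
      intro c
      simp [h.coframe_K_ne_zero ho hx]
    rw [h3]
    module
  have hκ := h.form_e_ne_zero hx.1
  rw [hd, hd]
  simp only [map_sub, map_smul, sub_apply, smul_apply, smul_eq_mul, h.gram hx, h.null x hx.1,
    (h.metric.lorentz x hx.1).symm u (K x), h.perp_iff hx.1 u, h.perp_iff hx.1 v]
  field_simp
  ring

end IsLeafCoframe

end LeafCoframeTransport

/-! ### Kerr-Schild coordinates for Kundt congruences of type N -/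

section KundtToKerrSchild

open Coordinates IsManifold

variable {n : ℕ}

/-- The initial coframe at the origin is the inverse of a linear map that brings the metric there to
Minkowski form. -/
theorem exists_isLeafCoframe {G : (Fin n → ℝ) → Matrix (Fin n) (Fin n) ℝ} {U : Set (Fin n → ℝ)}
    {K : (Fin n → ℝ) → (Fin n → ℝ)} (hG : IsLorentzMetricOn G U) (h0 : 0 ∈ U)
    (hK : ContDiffOn ℝ ∞ K U) (hnull : ∀ x ∈ U, metricForm G x (K x) (K x) = 0)
    (hne : ∀ x ∈ U, K x ≠ 0) (hkundt : ∀ x ∈ U, IsKundtAt G K x)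
    (hflat : ∀ x ∈ U, LeafFlatAt G (K x) x) {lam : (Fin n → ℝ) →L[ℝ] ℝ} {e : Fin n → ℝ}
    (he : lam e = 1) (hperp : ∀ x ∈ U, ∀ v, lam v = 0 → metricForm G x (K x) v = 0) :
    ∃ ε θ Ξ, ball 0 ε ⊆ U ∧ IsLeafCoframe G K lam e θ Ξ ε := by
  obtain ⟨P, hP⟩ := hG.lorentz 0 h0
  have hLC := hG.isLeviCivitaOn
  obtain ⟨ε, hε, θ, Ξ, hsub, hθ, hΞ, hθ0, hleaf, hline⟩ := exists_coframe hG.isOpen hLC.smooth_conn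
    hLC.torsion h0 he (fun x hx u v w hu hv => hflat x hx u v (hperp x hx u hu) (hperp x hx v hv) w)
    (P.symm : (Fin n → ℝ) →L[ℝ] (Fin n → ℝ))
  refine ⟨ε, θ, Ξ, hsub, hε, hG.mono isOpen_ball hsub, hK.mono hsub, fun x hx => hnull x (hsub hx),
    fun x hx => hne x (hsub hx), fun x hx => hkundt x (hsub hx), fun x hx => hflat x (hsub hx), he,
    fun x hx => hperp x (hsub hx), hθ, hΞ, fun u v => ?_, hleaf, hline⟩
  rw [hθ0, minkForm_apply, ← hP]
  simp

/-- The change of coordinates to a chart composed with `h`. -/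
theorem transition_trans_eventuallyEq {M : Type*} [TopologicalSpace M]
    {e : OpenPartialHomeomorph M (Fin n → ℝ)} {h : OpenPartialHomeomorph (Fin n → ℝ) (Fin n → ℝ)}
    {x : Fin n → ℝ} (hx : x ∈ e.target) :
    ((e.trans h) ∘ e.symm) =ᶠ[𝓝 x] h := by
  filter_upwards [e.open_target.mem_nhds hx] with y hy
  simp [e.right_inv hy]

variable {M : Type*} [TopologicalSpace M] [ChartedSpace (Fin n → ℝ) M]
  {g : LorentzMetric n M} {k : ∀ p : M, TangentSpace 𝓘(ℝ, Fin n → ℝ) p}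

namespace LorentzMetric

/-- A Kundt congruence is tangent to the hyperplanes `lam = const` in suitable coordinates. -/
theorem IsKundtCongruence.exists_adapted_chart [IsManifold 𝓘(ℝ, Fin n → ℝ) ∞ M] (hn : 2 ≤ n)
    (hk : g.IsKundtCongruence k) (p : M) :
    ∃ e₁ ∈ maximalAtlas 𝓘(ℝ, Fin n → ℝ) ∞ M, p ∈ e₁.source ∧ e₁ p = 0 ∧
      ∃ (lam : (Fin n → ℝ) →L[ℝ] ℝ) (a : Fin n → ℝ), lam a = 1 ∧ ∀ x ∈ e₁.target, ∀ v, lam v = 0 →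
        metricForm (g.inChart e₁) x (vectorInChart k e₁ x) v = 0 := by
  have hkundt := ((isKundtCongruence_iff hn).1 hk).2
  have hkn := hk.1
  set e := chartAt (Fin n → ℝ) p with he_def
  have he : e ∈ maximalAtlas 𝓘(ℝ, Fin n → ℝ) ∞ M := chart_mem_maximalAtlas p
  have hp : p ∈ e.source := mem_chart_source _ p
  have hG := g.isLorentzMetricOn he
  have hLC := hG.isLeviCivitaOn
  set G := g.inChart e with hGdef
  set K := vectorInChart k e with hKdef
  have hK : ContDiffOn ℝ ∞ K e.target := hkn.1 e he
  set x₀ := e p with hx₀def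
  have hx₀ : x₀ ∈ e.target := e.map_source hp
  set κ : (Fin n → ℝ) → (Fin n → ℝ) →L[ℝ] ℝ := fun x => metricForm G x (K x) with hκ
  have hκs : ContDiffOn ℝ ∞ κ e.target := hG.smooth_metricForm.clm_apply hK
  obtain ⟨a, ha⟩ : ∃ a, κ x₀ a ≠ 0 := by
    by_contra! hcon
    exact (hkn.inChart he hx₀).1 ((hG.lorentz x₀ hx₀).nondeg hcon)
  have hκa : ContDiffOn ℝ ∞ (fun x => κ x a) e.target := hκs.clm_apply contDiffOn_const
  set U := e.target ∩ {x | κ x a ≠ 0} with hU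
  have hUo : IsOpen U := hκa.continuousOn.isOpen_inter_preimage e.open_target isOpen_ne
  set α : (Fin n → ℝ) → (Fin n → ℝ) →L[ℝ] ℝ := fun x => (κ x a)⁻¹ • κ x with hα
  have hαs : ContDiffOn ℝ ∞ α U :=
    ((hκa.mono inter_subset_left).inv fun x hx => hx.2).smul (hκs.mono inter_subset_left)
  have hα0 : ∀ x ∈ U, ∀ v, α x v = 0 ↔ κ x v = 0 := fun x hx v => by
    simp only [hα, smul_apply, smul_eq_mul, mul_eq_zero, inv_eq_zero]
    exact or_iff_right hx.2
  have hαa : ∀ x ∈ U, α x a = 1 := fun x hx => inv_mul_cancel₀ hx.2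
  obtain ⟨h, h0, hh0, hhU, hhs, hhs', hhα⟩ := exists_straightening hUo hαs hαa (x₀ := x₀)
    (fun x hx u v hu hv => by
      rw [hα0 x hx] at hu hv
      obtain ⟨κ', hκ', hκ'eq⟩ := hLC.hasFDerivAt_lower hx.1 hK
      -- On the kernel, recurrence kills the covariant term and only Γ contributes; its symmetry is
      -- the integrability condition.
      have key : ∀ u v, κ x u = 0 → κ x v = 0 →
          fderiv ℝ α x u v = (κ x a)⁻¹ * κ x (connForm G x u v) := by
        intro u v hu hv
        have h1 := ((hαs.contDiffAt (hUo.mem_nhds hx)).differentiableAt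
          (by simp)).hasFDerivAt.clm_apply_const v
        have h2 := ((hasDerivAt_inv hx.2).comp_hasFDerivAt x (hκ'.clm_apply_const a)).mul
          (hκ'.clm_apply_const v)
        have h3 := DFunLike.congr_fun (h1.unique h2) u
        obtain ⟨c, hc⟩ := hkundt e he x hx.1 u hu
        have hv' : metricForm G x (K x) v = 0 := hv
        simp only [ContinuousLinearMap.flip_apply, add_apply, smul_apply, hκ'eq, hv',
          smul_eq_mul, zero_mul, add_zero, Function.comp_apply] at h3
        have h4 : metricForm G x (covDerivMap (connForm G) K x u) v = 0 := by
          rw [hc, map_smul, smul_apply, hv', smul_zero]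
        rw [h4, add_zero] at h3
        exact h3
      rw [key u v hu hv, key v u hv hu, hLC.torsion x hx.1 u v]) ⟨hx₀, ha⟩
  have he₁ : e.trans h.symm ∈ maximalAtlas 𝓘(ℝ, Fin n → ℝ) ∞ M :=
    trans_mem_maximalAtlas he hhs' hhs
  have hx₀h : x₀ ∈ h.target := by rw [← hh0]; exact h.map_source h0
  refine ⟨e.trans h.symm, he₁, ⟨hp, hx₀h⟩, ?_, α x₀, a, hαa x₀ ⟨hx₀, ha⟩, fun y hy v hv => ?_⟩
  · change h.symm x₀ = 0
    rw [← hh0, h.left_inv h0]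
  · have hyo : y ∈ overlap (e.trans h.symm) e := ⟨hy, e.map_target hy.2⟩
    have hys : y ∈ h.source := hy.1
    have hy2 : h y ∈ e.target := hy.2
    have hev : (e ∘ (e.trans h.symm).symm) =ᶠ[𝓝 y] h := by
      filter_upwards [(e.trans h.symm).open_target.mem_nhds hy] with z hz
      exact e.right_inv hz.2
    rw [(isLocalIsometryOn he₁ he g).metric y hyo, ← vectorInChart_transition he₁ he k hyo,
      hev.fderiv_eq, hev.self_of_nhds]
    exact (hα0 _ (hhU y hys) _).1 (hhα y hys v hv)

/-- The components of Ξ are the required coordinates: by `kerrSchild_form` the metric is flat up to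
a multiple of the square of the 1-form of k. -/
theorem IsKundtCongruence.isKerrSchildCongruence [IsManifold 𝓘(ℝ, Fin n → ℝ) ∞ M] (hn : 2 ≤ n)
    (hvac : g.IsVacuum) (hk : g.IsKundtCongruence k) (hN : g.IsWeylTypeN) :
    g.IsKerrSchildCongruence k := by
  refine ⟨hk.1, fun p => ?_⟩
  obtain ⟨e, he, hp, hep, lam, a, hlam, hperp⟩ := hk.exists_adapted_chart hn p
  have hkn := hk.1
  have hG := g.isLorentzMetricOn he
  have h0t : (0 : Fin n → ℝ) ∈ e.target := by rw [← hep]; exact e.map_source hp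
  obtain ⟨ε, θ, Ξ, hsub, h⟩ := exists_isLeafCoframe hG h0t (hkn.1 e he)
    (fun x hx => (hkn.inChart he hx).2) (fun x hx => (hkn.inChart he hx).1)
    (((isKundtCongruence_iff hn).1 hk).2 e he) (fun x hx => hk.leafFlatAt hn hvac hN he hx)
    hlam hperp
  set G := g.inChart e with hGdef
  set K := vectorInChart k e with hKdef
  set o : Fin n := ⟨0, by omega⟩
  have ho : o.val = 0 := rfl
  set D := leafDomain lam a ε with hD
  have hDo : IsOpen D := IsLeafCoframe.isOpen_leafDomain
  set s : (Fin n → ℝ) → ℝ := fun x =>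
    IsLeafCoframe.defect θ Ξ a x o * (θ x (K x) o)⁻¹ * (metricForm G x (K x) a)⁻¹ with hs
  have hform : ∀ x ∈ D, ∀ u v, metricForm G x u v =
      minkForm n (fderiv ℝ Ξ x u) (fderiv ℝ Ξ x v) +
        2 * s x * metricForm G x (K x) u * metricForm G x (K x) v :=
    fun x hx u v => h.kerrSchild_form ho hn hx u v
  have hKD : ContDiffOn ℝ ∞ K D := h.smooth_K.mono inter_subset_left
  have hss : ContDiffOn ℝ ∞ s D := by
    have h1 : ContDiffOn ℝ ∞ (fun x => IsLeafCoframe.defect θ Ξ a x o) D :=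
      contDiffOn_pi.1 (h.smooth_defect.mono inter_subset_left) o
    have h2 : ContDiffOn ℝ ∞ (fun x => θ x (K x) o) D :=
      contDiffOn_pi.1 ((h.smooth_θ.mono inter_subset_left).clm_apply hKD) o
    have h3 : ContDiffOn ℝ ∞ (fun x => metricForm G x (K x) a) D :=
      (((h.metric.smooth_metricForm.mono inter_subset_left).clm_apply hKD).clm_apply
        contDiffOn_const)
    exact (h1.mul (h2.inv fun x hx => h.coframe_K_ne_zero ho hx)).mul
      (h3.inv fun x hx => h.form_e_ne_zero hx.1)
  -- Since K is null, lowering its index with g or with the flat metric gives the same 1-form.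
  have hκ : ∀ x ∈ D, ∀ v, metricForm G x (K x) v =
      minkForm n (fderiv ℝ Ξ x (K x)) (fderiv ℝ Ξ x v) := fun x hx v => by
    have h1 := hform x hx (K x) v
    rwa [h.null x hx.1, mul_zero, zero_mul, add_zero] at h1
  -- A vector killed by dΞ is orthogonal to K, and then both terms of the metric formula vanish on
  -- it, against nondegeneracy.
  have hinj : ∀ x ∈ D, Function.Injective (fderiv ℝ Ξ x) := by
    intro x hx
    rw [injective_iff_map_eq_zero]
    intro u hu
    have h1 : metricForm G x (K x) u = 0 := by rw [hκ x hx, hu, map_zero]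
    refine (h.metric.lorentz x hx.1).nondeg fun v => ?_
    rw [hform x hx, hu, h1, map_zero, zero_apply, mul_zero, zero_mul, add_zero]
  have hΞs : ContDiffOn ℝ ∞ Ξ D := h.smooth_Ξ.mono inter_subset_left
  have h0D : (0 : Fin n → ℝ) ∈ D := h.zero_mem
  set S' : (Fin n → ℝ) ≃L[ℝ] (Fin n → ℝ) := (LinearEquiv.ofInjectiveEndo
    ((fderiv ℝ Ξ 0 : (Fin n → ℝ) →L[ℝ] (Fin n → ℝ)) : (Fin n → ℝ) →ₗ[ℝ] (Fin n → ℝ))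
    (hinj 0 h0D)).toContinuousLinearEquiv
  have hS' : HasFDerivAt Ξ (S' : (Fin n → ℝ) →L[ℝ] (Fin n → ℝ)) 0 :=
    (((hΞs.contDiffAt (hDo.mem_nhds h0D)).differentiableAt (by simp)).hasFDerivAt).congr_fderiv
      (by ext; rfl)
  obtain ⟨ψ, hψ, hψ0, hψD, hψs⟩ := exists_smooth_localInverse hDo hΞs h0D hS'
  have he₂ : e.trans ψ ∈ maximalAtlas 𝓘(ℝ, Fin n → ℝ) ∞ M :=
    trans_mem_maximalAtlas he (by rw [hψ]; exact hΞs.mono hψD) hψs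
  have hK₂ := hkn.1 _ he₂
  -- The sign of s is reversed because the correction enters the Kerr-Schild form as -2H; κ is k
  -- lowered with η.
  refine ⟨e.trans ψ, he₂, ⟨hp, by change e p ∈ ψ.source; rwa [hep]⟩, fun y => -s (ψ.symm y),
    fun y => minkowski n *ᵥ vectorInChart k (e.trans ψ) y, ?_, ?_, fun y hy => ?_⟩
  · exact (hss.comp (hψs.mono fun y hy => hy.1) fun y hy => hψD (ψ.map_target hy.1)).neg
  · exact (Matrix.mulVecLin (minkowski n)).toContinuousLinearMap.contDiff.comp_contDiffOn hK₂
  · set x := ψ.symm y with hx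
    have hxψ : x ∈ ψ.source := ψ.map_target hy.1
    have hxD : x ∈ D := hψD hxψ
    have hxe : x ∈ e.target := hy.2
    have hyx : (e.trans ψ ∘ e.symm) x = y := by
      rw [Function.comp_apply, OpenPartialHomeomorph.trans_apply, e.right_inv hxe, hx,
        ψ.right_inv hy.1]
    have hxo : x ∈ overlap e (e.trans ψ) := ⟨hxe, e.map_target hxe, by
      change e (e.symm x) ∈ ψ.source
      rwa [e.right_inv hxe]⟩
    have hfd : fderiv ℝ (e.trans ψ ∘ e.symm) x = fderiv ℝ Ξ x := by
      rw [(transition_trans_eventuallyEq hxe).fderiv_eq, hψ]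
    have hKy : vectorInChart k (e.trans ψ) y = fderiv ℝ Ξ x (K x) := by
      have h1 := vectorInChart_transition he he₂ k hxo
      rwa [hyx, hfd] at h1
    have hiso := isLocalIsometryOn he he₂ g
    have hmet : ∀ u v, metricForm (g.inChart (e.trans ψ)) y (fderiv ℝ Ξ x u) (fderiv ℝ Ξ x v) =
        metricForm G x u v := fun u v => by
      have h1 := hiso.metric x hxo u v
      rw [hyx, hfd] at h1
      exact h1.symm
    have hsurj : Function.Surjective (fderiv ℝ Ξ x) := by
      have h1 := hiso.surj x hxo
      rwa [hfd] at h1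
    rw [minkowski_inv, Matrix.mulVec_mulVec, minkowski_mul_self, Matrix.one_mulVec]
    refine ⟨?_, rfl, fun b c => ?_⟩
    · rw [dotProduct_comm, ← minkForm_apply, hKy, ← hκ x hxD, h.null x hxD.1]
    · obtain ⟨u, hu⟩ := hsurj (Pi.single b 1)
      obtain ⟨v, hv⟩ := hsurj (Pi.single c 1)
      have hcomp : ∀ b, (minkowski n *ᵥ fderiv ℝ Ξ x (K x)) b =
          minkForm n (fderiv ℝ Ξ x (K x)) (Pi.single b 1) := fun b => by
        rw [minkForm_comm, minkForm_apply, single_one_dotProduct]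
      have hη : minkForm n (Pi.single b 1) (Pi.single c 1) = minkowski n b c := by
        rw [minkForm, metricForm_single]
      change _ = minkowski n b c - 2 * (-s x) * (minkowski n *ᵥ vectorInChart k (e.trans ψ) y) b *
        (minkowski n *ᵥ vectorInChart k (e.trans ψ) y) c
      rw [← metricForm_single (g.inChart (e.trans ψ)) y b c, ← hu, ← hv, hmet, hform x hxD,
        hκ x hxD, hκ x hxD, hu, hv, hη, hKy, hcomp, hcomp]
      ring

end LorentzMetric

end KundtToKerrSchild

end

end

/-! ### The equivalence for a given congruence and for existence -/

theorem proposition3 (n : ℕ) (hn : 4 ≤ n) {M : Type*} [TopologicalSpace M]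
    [ChartedSpace (Fin n → ℝ) M] [IsManifold 𝓘(ℝ, Fin n → ℝ) ∞ M]
    (g : LorentzMetric n M) (hvac : g.IsVacuum)
    (hflat : Dense {p : M | ¬ g.WeylVanishesAt p}) :
    ((∃ k : ∀ p : M, TangentSpace 𝓘(ℝ, Fin n → ℝ) p,
        g.IsKerrSchildCongruence k ∧ g.IsNonexpanding k) ↔
      (∃ k : ∀ p : M, TangentSpace 𝓘(ℝ, Fin n → ℝ) p, g.IsKundtCongruence k) ∧
        g.IsWeylTypeN) ∧
    ∀ k : ∀ p : M, TangentSpace 𝓘(ℝ, Fin n → ℝ) p,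
      (g.IsKerrSchildCongruence k ∧ g.IsNonexpanding k) ↔
        (g.IsKundtCongruence k ∧ g.IsWeylTypeN) := by
  have hn2 : 2 ≤ n := by omega
  have key : ∀ k : ∀ p : M, TangentSpace 𝓘(ℝ, Fin n → ℝ) p,
      (g.IsKerrSchildCongruence k ∧ g.IsNonexpanding k) ↔
        (g.IsKundtCongruence k ∧ g.IsWeylTypeN) := fun k =>
    ⟨fun h => LorentzMetric.kundt_typeN_of_kerrSchild hn2 hvac hflat h.1 h.2,
      fun h => ⟨h.1.isKerrSchildCongruence hn2 hvac h.2, h.1.isNonexpanding hn2⟩⟩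
  refine ⟨⟨fun ⟨k, hk⟩ => ?_, fun ⟨⟨k, hk⟩, hN⟩ => ⟨k, (key k).2 ⟨hk, hN⟩⟩⟩, key⟩
  have h := (key k).1 hk
  exact ⟨⟨k, h.1⟩, h.2⟩
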